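/- Setting. All manifolds and maps are $C^\infty$. Let $M$ be an $m$-dimensional manifold (Hausdorff, second countable), and let $TM\oplus T^*M$ carry the pairing $g((X,\alpha),(Y,\beta))=\tfrac12(\alpha(Y)+\beta(X))$ and the Courant bracket $$[(X,\alpha),(Y,\beta)]=\bigl([X,Y],\,L_X\beta-L_Y\alpha+\tfrac12 d(\alpha(Y)-\beta(X))\bigr).$$ A big-isotropic structure of rank $k$ on $M$ is a rank $k$ vector subbundle $E\subseteq TM\oplus T^*M$ that is $g$-isotropic; it is integrable if its space $\Gamma(E)$ of global sections is closed under the Courant bracket. Put $\mathcal E_x=pr_{T_xM}E_x$. For integrable $E$, $\mathcal E$ is a generalized foliation; its leaves, the characteristic leaves, are the sets of points that can be joined by finitely many pieces of integral curves of vector fields $X$ with $(X,\alpha)\in\Gamma(E)$. A tubular neighborhood of a characteristic slice is an open set $U\subseteq M$ with coordinates $(x,w)\in\mathbb R^r\times\mathbb R^s$ that map $U$ onto a product $A\times B$ of connected open sets with $0\in B$, such that the slice $\mathcal U=\{w=0\}$ satisfies $T_y\,\mathcal U=\mathcal E_y$ for all $y\in\mathcal U$. Its tubular foliation $\mathcal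 F$ is the foliation of $U$ by the fibers $x=\mathrm{const}$. For $y\in U$ put $$H(E,\mathcal F)_y=\{Z\in T_yM \;:\; \exists\,\alpha\in T^*_yM \text{ with } \alpha|_{T_y\mathcal F}=0,\ (Z,\alpha)\in E_y\}.$$ $E$ is locally decomposable if each point of $M$ lies on the slice of some tubular neighborhood $U$ with $T_yM=H(E,\mathcal F)_y\oplus T_y\mathcal F$ for all $y\in U$. It is strongly, locally decomposable if, moreover, for every tubular neighborhood of every characteristic slice this decomposition holds at all points of a neighborhood of the slice. For a smooth map $f:N\to M$ and $q\in N$, the pullback of $E$ is $f^*(E)_q=\{(X,f^*\alpha): X\in T_qN,\ \alpha\in T^*_{f(q)}M,\ (f_*X,\alpha)\in E_{f(q)}\}$. A local transversal to the characteristic leaf through $x_0$ is an embedded submanifold $\iota_0:N_0\to M$ with a point $q_0$ such that $\iota_0(q_0)=x_0$ and $T_{x_0}M=\iota_{0*}(T_{q_0}N_0)\oplus\mathcal E_{x_0}$. The transversal structure that it carries near $q_0$ is $E^{tr}=\iota_0^*E$. Proposition 4.3. Let $E$ be a strongly, locally decomposable, integrable, big-isotropic structure on $M$. Let $x_0,x_1$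 be points (possibly equal) of the same characteristic leaf, and let $\iota_0:N_0\to M$, $\iota_1:N_1\to M$ be local transversals to this leaf at $x_0=\iota_0(q_0)$ and $x_1=\iota_1(q_1)$, of dimension $n$. Then there is a diffeomorphism $\Phi$ from an open neighborhood of $q_0$ in $N_0$ onto an open neighborhood of $q_1$ in $N_1$ such that $\Phi(q_0)=q_1$ and $\Phi$ preserves the transversal structures: $\Phi^*(\iota_1^*E)_q=(\iota_0^*E)_q$ for every $q$ in the domain of $\Phi$. In particular ($x_1=x_0$), the transversal structure of $E$ at $x_0$ does not depend, up to a structure preserving local diffeomorphism, on the choice of the local transversal. -/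

import Mathlib

open scoped Manifold ContDiff Topology

noncomputable section

namespace BigIso

section Basic

variable {m : ℕ} {M : Type*} [TopologicalSpace M] [ChartedSpace (EuclideanSpace ℝ (Fin m)) M]

/-- The cotangent space `T*ₓM`. -/
abbrev Cotangent (m : ℕ) {M : Type*} [TopologicalSpace M]
    [ChartedSpace (EuclideanSpace ℝ (Fin m)) M] (x : M) : Type :=
  TangentSpace (𝓡 m) x →L[ℝ] ℝ

/-- The fibre at `x` of the big tangent bundle `TM ⊕ T*M`. -/
abbrev BigTangent (m : ℕ) {M : Type*} [TopologicalSpace M]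
    [ChartedSpace (EuclideanSpace ℝ (Fin m)) M] (x : M) : Type :=
  TangentSpace (𝓡 m) x × Cotangent m x

/-- The neutral metric `g((X, α), (Y, β)) = (α(Y) + β(X)) / 2`. -/
def pairing {x : M} (e e' : BigTangent m x) : ℝ :=
  (1 / 2) * (e.2 e'.1 + e'.2 e.1)

/-- Smoothness of the vector field `X` on the set `U`. -/
def SmoothVectorFieldOn [IsManifold (𝓡 m) ∞ M] (X : ∀ x : M, TangentSpace (𝓡 m) x)
    (U : Set M) : Prop :=
  ContMDiffOn (𝓡 m) (𝓡 m).tangent ∞ (fun x => (⟨x, X x⟩ : TangentBundle (𝓡 m) M)) U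

/-- Smoothness of the `1`-form `α` on the set `U`, as a section of the bundle
`Hom(TM, ℝ) = T*M`. -/
def SmoothOneFormOn [IsManifold (𝓡 m) ∞ M] (α : ∀ x : M, Cotangent m x) (U : Set M) : Prop :=
  ContMDiffOn (𝓡 m) ((𝓡 m).prod 𝓘(ℝ, EuclideanSpace ℝ (Fin m) →L[ℝ] ℝ)) ∞
    (fun x => Bundle.TotalSpace.mk' (EuclideanSpace ℝ (Fin m) →L[ℝ] ℝ)
      (E := fun y : M => TangentSpace (𝓡 m) y →L[ℝ] Bundle.Trivial M ℝ y) x (α x)) U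

/-- Smoothness on `U` of a (set-theoretic) section of the big tangent bundle. -/
def SmoothSectionOn [IsManifold (𝓡 m) ∞ M] (e : ∀ x : M, BigTangent m x) (U : Set M) : Prop :=
  SmoothVectorFieldOn (fun x => (e x).1) U ∧ SmoothOneFormOn (fun x => (e x).2) U

/-- The differential `df` of a function, as a `1`-form. -/
def differential (f : M → ℝ) (x : M) : Cotangent m x :=
  mfderiv (𝓡 m) 𝓘(ℝ, ℝ) f x

/-- The expression of the `1`-form `α` in the preferred chart around `x`, i.e. its pullback by the
inverse of that chart. -/
def oneFormInChart (α : ∀ x : M, Cotangent m x) (x : M) (p : EuclideanSpace ℝ (Fin m)) :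
    EuclideanSpace ℝ (Fin m) →L[ℝ] ℝ :=
  (α ((extChartAt (𝓡 m) x).symm p)).comp
    (mfderiv 𝓘(ℝ, EuclideanSpace ℝ (Fin m)) (𝓡 m) (extChartAt (𝓡 m) x).symm p)

/-- The value `dα(u, v)` of the exterior derivative of a `1`-form at `x`, computed in the preferred
chart `φ` around `x`: if `a = Σ aⱼ dxʲ` is the expression of `α` in that chart, then
`dα(u, v) = (D a)(dφ u)(dφ v) - (D a)(dφ v)(dφ u)`, i.e. `(∂ᵢ aⱼ - ∂ⱼ aᵢ) uⁱ vʲ`.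
Here it is written as the `1`-form `v ↦ dα(u, v) = (i(u) dα)(v)`. -/
def interiorExtDeriv (α : ∀ x : M, Cotangent m x) (x : M) (u : TangentSpace (𝓡 m) x) :
    Cotangent m x :=
  let D : TangentSpace (𝓡 m) x →L[ℝ] EuclideanSpace ℝ (Fin m) :=
    mfderiv (𝓡 m) 𝓘(ℝ, EuclideanSpace ℝ (Fin m)) (extChartAt (𝓡 m) x) x
  let A : EuclideanSpace ℝ (Fin m) →L[ℝ] EuclideanSpace ℝ (Fin m) →L[ℝ] ℝ :=
    fderiv ℝ (oneFormInChart α x) (extChartAt (𝓡 m) x x)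
  (A (D u) - A.flip (D u)).comp D

/-- The Lie derivative `L_X β = i(X) dβ + d(β(X))` of a `1`-form. -/
def lieDerivative (X : ∀ x : M, TangentSpace (𝓡 m) x) (β : ∀ x : M, Cotangent m x) (x : M) :
    Cotangent m x :=
  interiorExtDeriv β x (X x) + differential (fun y => β y (X y)) x

/-- The Courant bracket
`[(X, α), (Y, β)] = ([X, Y], L_X β - L_Y α + d(α(Y) - β(X)) / 2)`. -/
def courantBracket (e e' : ∀ x : M, BigTangent m x) (x : M) : BigTangent m x :=
  (VectorField.mlieBracket (𝓡 m) (fun y => (e y).1) (fun y => (e' y).1) x,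
    lieDerivative (fun y => (e y).1) (fun y => (e' y).2) x
      - lieDerivative (fun y => (e' y).1) (fun y => (e y).2) x
      + (1 / 2 : ℝ) • differential (fun y => (e y).2 (e' y).1 - (e' y).2 (e y).1) x)

/-- `e ∈ Γ(E)`: a global smooth section of the field of subspaces `E`. -/
def IsSection [IsManifold (𝓡 m) ∞ M] (E : ∀ x : M, Submodule ℝ (BigTangent m x))
    (e : ∀ x : M, BigTangent m x) : Prop :=
  SmoothSectionOn e Set.univ ∧ ∀ x, e x ∈ E x

/-- `E` is a smooth vector subbundle of rank `k` of the big tangent bundle: it has smooth local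
frames. -/
def IsSubbundle [IsManifold (𝓡 m) ∞ M] (k : ℕ)
    (E : ∀ x : M, Submodule ℝ (BigTangent m x)) : Prop :=
  ∀ x₀ : M, ∃ U : Set M, IsOpen U ∧ x₀ ∈ U ∧ ∃ e : Fin k → ∀ x : M, BigTangent m x,
    (∀ i, SmoothSectionOn (e i) U) ∧
    ∀ x ∈ U, LinearIndependent ℝ (fun i => e i x) ∧
      Submodule.span ℝ (Set.range fun i => e i x) = E x

/-- A big-isotropic structure of rank `k`: a `g`-isotropic subbundle of `TM ⊕ T*M`. -/
def IsBigIsotropic [IsManifold (𝓡 m) ∞ M] (k : ℕ)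
    (E : ∀ x : M, Submodule ℝ (BigTangent m x)) : Prop :=
  IsSubbundle k E ∧ ∀ x : M, ∀ e ∈ E x, ∀ e' ∈ E x, pairing e e' = 0

/-- Integrability: `Γ(E)` is closed under the Courant bracket. -/
def IsIntegrable [IsManifold (𝓡 m) ∞ M] (E : ∀ x : M, Submodule ℝ (BigTangent m x)) : Prop :=
  ∀ e e' : ∀ x : M, BigTangent m x, IsSection E e → IsSection E e' →
    IsSection E (courantBracket e e')

/-- The characteristic distribution `𝓔ₓ = pr_{TₓM} Eₓ`. -/
def charDistribution (E : ∀ x : M, Submodule ℝ (BigTangent m x)) (x : M) :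
    Submodule ℝ (TangentSpace (𝓡 m) x) :=
  (E x).map (LinearMap.fst ℝ (TangentSpace (𝓡 m) x) (Cotangent m x))

/-- There is a section `(X, α)` of `E` such that `X` has an integral curve, defined on `[0, 1]`, that
goes from `x` to `y`. -/
def FlowStep [IsManifold (𝓡 m) ∞ M] (E : ∀ x : M, Submodule ℝ (BigTangent m x)) (x y : M) : Prop :=
  ∃ e : ∀ x : M, BigTangent m x, IsSection E e ∧ ∃ γ : ℝ → M,
    IsMIntegralCurveOn (I := 𝓡 m) γ (fun z => (e z).1) (Set.Icc 0 1) ∧ γ 0 = x ∧ γ 1 = y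

/-- `x` and `y` lie on the same characteristic leaf, i.e. on the same leaf of the generalized
foliation `𝓔`: they are joined by finitely many pieces of integral curves of vector fields
`X = pr_{TM}(X, α)`, `(X, α) ∈ Γ(E)`. -/
def SameCharLeaf [IsManifold (𝓡 m) ∞ M] (E : ∀ x : M, Submodule ℝ (BigTangent m x)) :
    M → M → Prop :=
  Relation.ReflTransGen (FlowStep E)

/-- A tubular neighbourhood of a characteristic slice, in coordinates `(x, w) ∈ ℝʳ × ℝˢ`
(`w` comprises all the coordinates that vanish on the slice). The neighbourhood is `chart.source`,
it is a product in the coordinates, the slice has the equation `w = 0`, and the slice is an integral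
manifold of the characteristic distribution. -/
structure TubularNbhd (E : ∀ x : M, Submodule ℝ (BigTangent m x)) (r s : ℕ) where
  /-- the coordinates `(x, w)` -/
  chart : OpenPartialHomeomorph M (EuclideanSpace ℝ (Fin r) × EuclideanSpace ℝ (Fin s))
  smooth_chart : ContMDiffOn (𝓡 m)
    𝓘(ℝ, EuclideanSpace ℝ (Fin r) × EuclideanSpace ℝ (Fin s)) ∞ chart chart.source
  smooth_symm : ContMDiffOn
    𝓘(ℝ, EuclideanSpace ℝ (Fin r) × EuclideanSpace ℝ (Fin s)) (𝓡 m) ∞ chart.symm chart.target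
  /-- the range of `x` -/
  base : Set (EuclideanSpace ℝ (Fin r))
  /-- the range of `w` -/
  fibre : Set (EuclideanSpace ℝ (Fin s))
  target_eq : chart.target = base ×ˢ fibre
  isConnected_base : IsConnected base
  isConnected_fibre : IsConnected fibre
  zero_mem_fibre : (0 : EuclideanSpace ℝ (Fin s)) ∈ fibre
  /-- the tangent spaces of the slice `w = 0` are those of the characteristic distribution -/
  tangent_slice : ∀ y ∈ chart.source, (chart y).2 = 0 →
    LinearMap.ker (mfderiv (𝓡 m) 𝓘(ℝ, EuclideanSpace ℝ (Fin s)) (fun z => (chart z).2) y).toLinearMap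
      = charDistribution E y

/-- The characteristic slice `𝓤`: the points of equation `w = 0`. -/
def TubularNbhd.slice {E : ∀ x : M, Submodule ℝ (BigTangent m x)} {r s : ℕ}
    (T : TubularNbhd E r s) : Set M :=
  {y | y ∈ T.chart.source ∧ (T.chart y).2 = 0}

/-- The tangent space `T_y𝓕` of the tubular foliation `𝓕`, whose leaves are the tubular fibres
`x = const`. -/
def TubularNbhd.fibreTangent {E : ∀ x : M, Submodule ℝ (BigTangent m x)} {r s : ℕ}
    (T : TubularNbhd E r s) (y : M) : Submodule ℝ (TangentSpace (𝓡 m) y) :=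
  LinearMap.ker
    (mfderiv (𝓡 m) 𝓘(ℝ, EuclideanSpace ℝ (Fin r)) (fun z => (T.chart z).1) y).toLinearMap

/-- The pseudo-normal space
`H(E, 𝓕) = {Z ∈ TM / ∃ α ∈ ann T𝓕, (Z, α) ∈ E}` at `y`, where `V = T_y𝓕`. -/
def pseudoNormal (E : ∀ x : M, Submodule ℝ (BigTangent m x)) (y : M)
    (V : Submodule ℝ (TangentSpace (𝓡 m) y)) : Submodule ℝ (TangentSpace (𝓡 m) y) where
  carrier := {Z | ∃ α : Cotangent m y, (∀ v ∈ V, α v = 0) ∧ ((Z, α) : BigTangent m y) ∈ E y}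
  zero_mem' := ⟨0, fun _ _ => rfl, (E y).zero_mem⟩
  add_mem' := by
    rintro Z Z' ⟨α, hα, h⟩ ⟨α', hα', h'⟩
    exact ⟨α + α', fun v hv => by simp [hα v hv, hα' v hv], (E y).add_mem h h'⟩
  smul_mem' := by
    rintro c Z ⟨α, hα, h⟩
    exact ⟨c • α, fun v hv => by simp [hα v hv], (E y).smul_mem c h⟩

/-- The decomposition `T_yM = H(E, 𝓕) ⊕ T_y𝓕` at the point `y`. -/
def TubularNbhd.DecomposesAt {E : ∀ x : M, Submodule ℝ (BigTangent m x)} {r s : ℕ}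
    (T : TubularNbhd E r s) (y : M) : Prop :=
  IsCompl (pseudoNormal E y (T.fibreTangent y)) (T.fibreTangent y)

/-- Local decomposability: each point has a tubular neighbourhood `U` of a characteristic slice
through it such that `TM = H(E, 𝓕) ⊕ T𝓕` over `U`. -/
def IsLocallyDecomposable (E : ∀ x : M, Submodule ℝ (BigTangent m x)) : Prop :=
  ∀ x : M, ∃ (r s : ℕ) (T : TubularNbhd E r s), x ∈ T.slice ∧
    ∀ y ∈ T.chart.source, T.DecomposesAt y

/-- Strong local decomposability: `E` is locally decomposable, and the decomposition
`TM = H(E, 𝓕) ⊕ T𝓕` holds for any tubular neighbourhood of any characteristic slice, after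
shrinking the neighbourhood around the slice if necessary. -/
def IsStronglyLocallyDecomposable (E : ∀ x : M, Submodule ℝ (BigTangent m x)) : Prop :=
  IsLocallyDecomposable E ∧
    ∀ (r s : ℕ) (T : TubularNbhd E r s), ∀ᶠ y in 𝓝ˢ T.slice, T.DecomposesAt y

end Basic

section Pullback

variable {m n : ℕ}
  {M : Type*} [TopologicalSpace M] [ChartedSpace (EuclideanSpace ℝ (Fin m)) M]
  {N : Type*} [TopologicalSpace N] [ChartedSpace (EuclideanSpace ℝ (Fin n)) N]

/-- The pullback
`f*(E) = {(X, f*α) / X ∈ T_qN, α ∈ T*_{f(q)}M, (f_* X, α) ∈ E_{f(q)}}` at `q`. -/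
def pullback (f : N → M) (E : ∀ x : M, Submodule ℝ (BigTangent m x)) (q : N) :
    Submodule ℝ (BigTangent n q) where
  carrier := {e | ∃ α : Cotangent m (f q),
    ((mfderiv (𝓡 n) (𝓡 m) f q e.1, α) : BigTangent m (f q)) ∈ E (f q) ∧
      e.2 = α.comp (mfderiv (𝓡 n) (𝓡 m) f q)}
  zero_mem' := ⟨0, by
    rw [Prod.fst_zero, map_zero]; exact (E (f q)).zero_mem, by simp⟩
  add_mem' := by
    rintro e e' ⟨α, h, hα⟩ ⟨α', h', hα'⟩
    refine ⟨α + α', ?_, ?_⟩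
    · rw [Prod.fst_add, map_add]; exact (E (f q)).add_mem h h'
    · simp only [Prod.snd_add, hα, hα', ContinuousLinearMap.add_comp]
  smul_mem' := by
    rintro c e ⟨α, h, hα⟩
    refine ⟨c • α, ?_, ?_⟩
    · rw [Prod.smul_fst, map_smul]; exact (E (f q)).smul_mem c h
    · simp only [Prod.smul_snd, hα, ContinuousLinearMap.smul_comp]

/-- The embedded submanifold `ι : N → M` is a local transversal, at the point `ι(q)`, to the
characteristic leaf through that point: its tangent space there is complementary to `𝓔`, which is
the tangent space of the leaf. -/
structure IsLocalTransversal (E : ∀ x : M, Submodule ℝ (BigTangent m x)) (ι : N → M) (q : N) :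
    Prop where
  embedding : Manifold.IsSmoothEmbedding (𝓡 n) (𝓡 m) ∞ ι
  isCompl : IsCompl (LinearMap.range (mfderiv (𝓡 n) (𝓡 m) ι q).toLinearMap)
    (charDistribution E (ι q))

/-- The transversal structure `E^tr = ι*E` induced on a local transversal `ι : N → M`. -/
def transversalStructure (E : ∀ x : M, Submodule ℝ (BigTangent m x)) (ι : N → M) :
    ∀ q : N, Submodule ℝ (BigTangent n q) :=
  pullback ι E

end Pullback

end BigIso

end

open scoped Manifold ContDiff Topology

noncomputable section

/-! Everything is reduced to tubular fibres. Fix a tubular neighbourhood with coordinates $(x,w)$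
over which $TM=H(E,\mathcal F)\oplus T\mathcal F$. A constant vector $\xi$ of the base lifts to a
section $(Z,\alpha)$ of $E$ whose base component is $\xi$ and for which $\alpha$ kills vertical
vectors. Let $(Y,b)$ be a section of $E$ with $Y$ vertical. Then $\alpha(Y)=0$, and isotropy gives
$b(Z)=0$, so the Courant bracket of the two is $([Z,Y],\,i_Z db-i_Y d\alpha)$. Restricted to
vertical vectors its covector part is $L_Z b$. By integrability the bracket lies in $E$, and $[Z,Y]$
is vertical; hence $L_Z$ maps the structure induced on the fibres into itself
(`exists_infinitesimal_transport`).

The flow of $Z$ carries fibres to fibres. Along it, generators of the fibre structure satisfy a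
linear differential equation with coefficients in their own span, so the flow preserves that
structure (`mem_span_transport_iff`, `exists_fibre_transport`). On the slice $Z$ is tangent to the
slice, so $w=0$ is mapped to $w=0$. Connectedness of the base then makes all fibres of one tubular
neighbourhood equivalent near the slice (`locEquiv_fibreMap`).

A general transversal is a graph $x=g(w)$ over a tubular fibre. Shearing the coordinates turns this
graph into a fibre of a second tubular neighbourhood that still shares another fibre with the first
(`exists_fibre_eq_graph`). Strong decomposability applies to both neighbourhoods, so the graph is
equivalent to the common fibre, and thus to the fibre through its own point (`locEquiv_graph`). In
particular, fibres of different tubular neighbourhoods through one point are equivalent.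

Finally, an integral curve of a section of $E$ stays locally in a slice (`eventually_mem_slice`).
Equivalence of fibres therefore propagates along each curve by connectedness of $[0,1]$, and along
the leaf by transitivity.

The smooth dependence of flows on initial data, together with the variational equation, is obtained
from the inverse function theorem in a Banach space of curves. -/

namespace BigIso

/-! ### Smoothness of superposition operators on spaces of continuous maps. -/

section Superposition

variable {K : Type*} [TopologicalSpace K]

/-- The superposition operator `γ ↦ Z ∘ γ`. -/
def superpose {F F' : Type*} [TopologicalSpace F] [TopologicalSpace F']
    (Z : F → F') (hZ : Continuous Z) (γ : C(K, F)) : C(K, F') :=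
  (⟨Z, hZ⟩ : C(F, F')).comp γ

@[simp] lemma superpose_apply {F F' : Type*} [TopologicalSpace F] [TopologicalSpace F']
    (Z : F → F') (hZ : Continuous Z) (γ : C(K, F)) (s : K) : superpose Z hZ γ s = Z (γ s) := rfl

variable [CompactSpace K]

/-- The pointwise action of a continuous family of operators on a continuous map. -/
def pointwiseApply (K F F' : Type*) [TopologicalSpace K] [CompactSpace K]
    [NormedAddCommGroup F] [NormedSpace ℝ F] [NormedAddCommGroup F'] [NormedSpace ℝ F'] :
    C(K, F →L[ℝ] F') →L[ℝ] C(K, F) →L[ℝ] C(K, F') :=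
  LinearMap.mkContinuous₂
    (LinearMap.mk₂ ℝ (fun (A : C(K, F →L[ℝ] F')) (h : C(K, F)) =>
        (⟨fun s => A s (h s), by fun_prop⟩ : C(K, F')))
      (fun A B h => by ext s; simp) (fun a A h => by ext s; simp)
      (fun A h h' => by ext s; simp) (fun a A h => by ext s; simp)) 1 (by
    intro A h
    rw [ContinuousMap.norm_le _ (by positivity)]
    intro s
    rw [one_mul]
    exact ((A s).le_opNorm (h s)).trans
      (mul_le_mul (A.norm_coe_le_norm s) (h.norm_coe_le_norm s) (norm_nonneg _) (norm_nonneg A)))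

@[simp] lemma pointwiseApply_apply {F F' : Type*}
    [NormedAddCommGroup F] [NormedSpace ℝ F] [NormedAddCommGroup F'] [NormedSpace ℝ F']
    (A : C(K, F →L[ℝ] F')) (h : C(K, F)) (s : K) : pointwiseApply K F F' A h s = A s (h s) := rfl

/-- Compact support makes the derivative of `Z` uniformly continuous, so the mean value estimate for
the remainder holds with one $\delta$ for all points of `K`. -/
lemma hasFDerivAt_superpose {F F' : Type*}
    [NormedAddCommGroup F] [NormedSpace ℝ F] [NormedAddCommGroup F'] [NormedSpace ℝ F']
    {Z : F → F'} (hZ : ContDiff ℝ 1 Z) (hc : HasCompactSupport Z) (γ : C(K, F)) :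
    HasFDerivAt (superpose (K := K) Z hZ.continuous)
      (pointwiseApply K F F' (superpose (fderiv ℝ Z) (hZ.continuous_fderiv one_ne_zero) γ)) γ := by
  have huc : UniformContinuous (fderiv ℝ Z) :=
    (hc.fderiv ℝ).uniformContinuous_of_continuous (hZ.continuous_fderiv one_ne_zero)
  rw [hasFDerivAt_iff_isLittleO_nhds_zero, Asymptotics.isLittleO_iff]
  intro ε hε
  obtain ⟨δ, hδ, hδ'⟩ := Metric.uniformContinuous_iff.1 huc ε hε
  filter_upwards [Metric.ball_mem_nhds (0 : C(K, F)) hδ] with h hh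
  rw [ContinuousMap.norm_le _ (by positivity)]
  intro s
  have hs : ‖h s‖ ≤ ‖h‖ := h.norm_coe_le_norm s
  have hlt : ‖h‖ < δ := by simpa using hh
  have key : ‖Z (γ s + h s) - Z (γ s) - fderiv ℝ Z (γ s) (γ s + h s - γ s)‖
      ≤ ε * ‖γ s + h s - γ s‖ := by
    refine (convex_ball (γ s) δ).norm_image_sub_le_of_norm_hasFDerivWithin_le'
      (f' := fderiv ℝ Z) (fun x _ =>
        ((hZ.differentiable one_ne_zero) x).hasFDerivAt.hasFDerivWithinAt) ?_
      (Metric.mem_ball_self hδ) ?_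
    · intro x hx
      rw [← dist_eq_norm]
      exact (hδ' hx).le
    · simpa using lt_of_le_of_lt hs hlt
  simp only [add_sub_cancel_left] at key
  refine le_trans ?_ (mul_le_mul_of_nonneg_left hs hε.le)
  simpa using key

/-- The derivative of a superposition operator is the superposition operator of `fderiv ℝ Z`
followed by the bounded linear map `pointwiseApply`, so induction on the order applies. The two
spaces share a universe because the induction replaces `F'` by `F →L[ℝ] F'`. -/
lemma contDiff_superpose_nat.{u} (n : ℕ) : ∀ {F F' : Type u}
    [NormedAddCommGroup F] [NormedSpace ℝ F] [NormedAddCommGroup F'] [NormedSpace ℝ F']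
    {Z : F → F'} (hZ : ContDiff ℝ ∞ Z) (_ : HasCompactSupport Z),
    ContDiff ℝ n (superpose (K := K) Z hZ.continuous) := by
  induction n with
  | zero =>
    intro F F' _ _ _ _ Z hZ hc
    rw [Nat.cast_zero, contDiff_zero]
    exact ContinuousMap.continuous_postcomp _
  | succ n ih =>
    intro F F' _ _ _ _ Z hZ hc
    have h1 : ContDiff ℝ 1 Z := hZ.of_le (by exact_mod_cast le_top)
    have hd : ContDiff ℝ ∞ (fderiv ℝ Z) := hZ.fderiv_right (by simp)
    rw [Nat.cast_succ, contDiff_succ_iff_hasFDerivAt]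
    refine ⟨_, ?_, fun γ => hasFDerivAt_superpose h1 hc γ⟩
    exact (pointwiseApply K F F').contDiff.comp (ih hd (hc.fderiv ℝ))

lemma contDiff_superpose.{u} {F F' : Type u}
    [NormedAddCommGroup F] [NormedSpace ℝ F] [NormedAddCommGroup F'] [NormedSpace ℝ F']
    {Z : F → F'} (hZ : ContDiff ℝ ∞ Z) (hc : HasCompactSupport Z) :
    ContDiff ℝ ∞ (superpose (K := K) Z hZ.continuous) :=
  contDiff_infty.2 fun n => contDiff_superpose_nat n hZ hc

end Superposition

/-! ### The inverse function theorem with a smooth inverse on the whole target. -/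

section Inverse

/-- The smooth inverse function theorem, with smoothness on the whole domain. -/
lemma exists_openPartialHomeomorph_of_hasFDerivAt {X Y : Type*}
    [NormedAddCommGroup X] [NormedSpace ℝ X] [CompleteSpace X]
    [NormedAddCommGroup Y] [NormedSpace ℝ Y] [CompleteSpace Y]
    {f : X → Y} {a : X} {f' : X ≃L[ℝ] Y} {U : Set X} (hU : U ∈ 𝓝 a)
    (hf : ∀ x ∈ U, ContDiffAt ℝ ∞ f x) (hf' : HasFDerivAt f (f' : X →L[ℝ] Y) a) :
    ∃ Φ : OpenPartialHomeomorph X Y, a ∈ Φ.source ∧ (Φ : X → Y) = f ∧ Φ.source ⊆ U ∧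
      ContDiffOn ℝ ∞ Φ Φ.source ∧ ContDiffOn ℝ ∞ Φ.symm Φ.target := by
  have hfa := hf a (mem_of_mem_nhds hU)
  have hinf : (∞ : WithTop ℕ∞) ≠ 0 := by simp
  set Ψ := hfa.toOpenPartialHomeomorph f hf' hinf with hΨ
  have hΨf : (Ψ : X → Y) = f := hfa.toOpenPartialHomeomorph_coe hf' hinf
  have haΨ : a ∈ Ψ.source := hfa.mem_toOpenPartialHomeomorph_source hf' hinf
  -- Invertibility of the derivative is an open condition. Imposing it on the source makes the
  -- inverse smooth at every point of the target, not only at the image of `a`.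
  have hopen : ∀ᶠ x in 𝓝 a, x ∈ U ∧ fderiv ℝ f x ∈ Set.range ((↑) : (X ≃L[ℝ] Y) → X →L[ℝ] Y) := by
    have hc : ContinuousAt (fderiv ℝ f) a :=
      (hfa.fderiv_right (m := 0) (by simp)).continuousAt
    have : Set.range ((↑) : (X ≃L[ℝ] Y) → X →L[ℝ] Y) ∈ 𝓝 (fderiv ℝ f a) := by
      rw [hf'.fderiv]; exact ContinuousLinearEquiv.nhds f'
    exact (Filter.eventually_of_mem hU fun x hx => hx).and (hc this)
  obtain ⟨W, hW, hWo, haW⟩ := eventually_nhds_iff.1 hopen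
  have hsrc : (Ψ.restrOpen W hWo).source = Ψ.source ∩ W := rfl
  refine ⟨Ψ.restrOpen W hWo, ⟨haΨ, haW⟩, hΨf, fun x hx => (hW x hx.2).1, ?_, ?_⟩
  · intro x hx
    have : ((Ψ.restrOpen W hWo : OpenPartialHomeomorph X Y) : X → Y) = f := hΨf
    rw [this]
    exact (hf x (hW x hx.2).1).contDiffWithinAt
  · intro y hy
    have hx := (Ψ.restrOpen W hWo).map_target hy
    obtain ⟨e, he⟩ := (hW _ hx.2).2
    refine ((Ψ.restrOpen W hWo).contDiffAt_symm (f₀' := e) hy ?_ ?_).contDiffWithinAt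
    · rw [he]
      have : ((Ψ.restrOpen W hWo : OpenPartialHomeomorph X Y) : X → Y) = f := hΨf
      rw [this]
      exact ((hf _ (hW _ hx.2).1).differentiableAt hinf).hasFDerivAt
    · have : ((Ψ.restrOpen W hWo : OpenPartialHomeomorph X Y) : X → Y) = f := hΨf
      rw [this]
      exact hf _ (hW _ hx.2).1

end Inverse

/-! ### Local flows and the variational equation. -/

section LocalFlow

open Set

/-- The operator `γ ↦ (s ↦ ∫₀ˢ γ)` on continuous curves. -/
def integrateCurve (F : Type*) [NormedAddCommGroup F] [NormedSpace ℝ F] :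
    C(unitInterval, F) →L[ℝ] C(unitInterval, F) :=
  LinearMap.mkContinuous
    { toFun := fun γ => ⟨fun s => ∫ u in (0 : ℝ)..s, γ (projIcc 0 1 zero_le_one u), by
        have hc : Continuous fun u : ℝ => γ (projIcc 0 1 zero_le_one u) := by fun_prop
        exact (intervalIntegral.continuous_primitive (fun a b => hc.intervalIntegrable a b) 0).comp
          continuous_subtype_val⟩
      map_add' := fun γ γ' => by
        ext s
        have hc : Continuous fun u : ℝ => γ (projIcc 0 1 zero_le_one u) := by fun_prop
        have hc' : Continuous fun u : ℝ => γ' (projIcc 0 1 zero_le_one u) := by fun_prop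
        exact intervalIntegral.integral_add (hc.intervalIntegrable _ _) (hc'.intervalIntegrable _ _)
      map_smul' := fun c γ => by
        ext s
        exact intervalIntegral.integral_smul c _ } 1 (by
    intro γ
    rw [one_mul, ContinuousMap.norm_le _ (norm_nonneg _)]
    intro s
    refine (intervalIntegral.norm_integral_le_of_norm_le_const (C := ‖γ‖)
      fun u _ => γ.norm_coe_le_norm _).trans ?_
    rw [sub_zero, abs_of_nonneg s.2.1]
    exact mul_le_of_le_one_right (norm_nonneg _) s.2.2)

lemma integrateCurve_apply {F : Type*} [NormedAddCommGroup F] [NormedSpace ℝ F]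
    (γ : C(unitInterval, F)) (s : unitInterval) :
    integrateCurve F γ s = ∫ u in (0 : ℝ)..s, γ (projIcc 0 1 zero_le_one u) := rfl

lemma hasDerivWithinAt_integrateCurve {F : Type*} [NormedAddCommGroup F] [NormedSpace ℝ F]
    [CompleteSpace F] (γ : C(unitInterval, F)) {s : ℝ} (hs : s ∈ Icc (0 : ℝ) 1) :
    HasDerivWithinAt (fun s => integrateCurve F γ (projIcc 0 1 zero_le_one s))
      (γ (projIcc 0 1 zero_le_one s)) (Icc 0 1) s := by
  have hc : Continuous fun u : ℝ => γ (projIcc 0 1 zero_le_one u) := by fun_prop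
  have h := (intervalIntegral.integral_hasDerivAt_right (hc.intervalIntegrable 0 s)
    (hc.stronglyMeasurableAtFilter _ _) hc.continuousAt).hasDerivWithinAt (s := Icc (0 : ℝ) 1)
  refine h.congr (fun u hu => ?_) ?_
  · rw [integrateCurve_apply, projIcc_of_mem _ hu]
  · rw [integrateCurve_apply, projIcc_of_mem _ hs]

variable {F : Type*} [NormedAddCommGroup F] [NormedSpace ℝ F]

/-- The solution curves of `γ' = τ Z(γ)`, `γ(0) = q`, depend smoothly on `(τ, q)`, as elements of
the Banach space of continuous curves. -/
lemma exists_solution_curves [CompleteSpace F] {Z : F → F} (hZ : ContDiff ℝ ∞ Z)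
    (hc : HasCompactSupport Z) (p : F) :
    ∃ (W : Set (ℝ × F)) (Γ : ℝ × F → C(unitInterval, F)), IsOpen W ∧ (0, p) ∈ W ∧
      ContDiffOn ℝ ∞ Γ W ∧ Γ (0, p) = ContinuousMap.const _ p ∧
      ∀ y ∈ W, Γ y = ContinuousMap.const _ y.2 +
        y.1 • integrateCurve F (superpose Z hZ.continuous (Γ y)) := by
  let X := C(unitInterval, F)
  let N : X → X := superpose Z hZ.continuous
  have hN : ContDiff ℝ ∞ N := contDiff_superpose hZ hc
  let C : F →L[ℝ] X := ContinuousLinearMap.const ℝ unitInterval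
  -- Solutions of the integral equation are the zeros of the second component of `H`. The time is
  -- rescaled to $[0,1]$ and the vector field multiplied by $\tau$, so that the equation is trivial
  -- at $\tau=0$.
  let H : (ℝ × F) × X → (ℝ × F) × X := fun y =>
    (y.1, y.2 - (C y.1.2 + y.1.1 • integrateCurve F (N y.2)))
  have hH : ContDiff ℝ ∞ H := by
    refine contDiff_fst.prodMk (contDiff_snd.sub ?_)
    refine (C.contDiff.comp (contDiff_snd.comp contDiff_fst)).add ?_
    exact (contDiff_fst.comp contDiff_fst).smul
      ((integrateCurve F).contDiff.comp (hN.comp contDiff_snd))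
  let a : (ℝ × F) × X := ((0, p), C p)
  let c₀ : X := integrateCurve F (N (C p))
  let Λ : ℝ × F →L[ℝ] X := C ∘L ContinuousLinearMap.snd ℝ ℝ F +
    (ContinuousLinearMap.fst ℝ ℝ F).smulRight c₀
  -- At $\tau=0$ the nonlinear term contributes nothing to the derivative in the curve direction.
  -- The derivative of `H` is thus triangular with identity diagonal blocks, and invertible.
  let e : ((ℝ × F) × X) ≃L[ℝ] ((ℝ × F) × X) :=
    ContinuousLinearEquiv.skewProd (.refl ℝ (ℝ × F)) (.refl ℝ X) (-Λ)
  have hd : HasFDerivAt H (e : (ℝ × F) × X →L[ℝ] (ℝ × F) × X) a := by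
    have h1 : HasFDerivAt (fun y : (ℝ × F) × X => y.1.1)
        (ContinuousLinearMap.fst ℝ ℝ F ∘L ContinuousLinearMap.fst ℝ (ℝ × F) X) a :=
      (ContinuousLinearMap.fst ℝ ℝ F ∘L ContinuousLinearMap.fst ℝ (ℝ × F) X).hasFDerivAt
    have h2 : HasFDerivAt (fun y : (ℝ × F) × X => C y.1.2)
        (C ∘L ContinuousLinearMap.snd ℝ ℝ F ∘L ContinuousLinearMap.fst ℝ (ℝ × F) X) a :=
      (C ∘L ContinuousLinearMap.snd ℝ ℝ F ∘L
        ContinuousLinearMap.fst ℝ (ℝ × F) X).hasFDerivAt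
    have h3 : DifferentiableAt ℝ (fun y : (ℝ × F) × X => integrateCurve F (N y.2)) a :=
      (((integrateCurve F).contDiff.comp (hN.comp contDiff_snd)).differentiable
        (by simp)).differentiableAt
    have h4 := (hasFDerivAt_fst (𝕜 := ℝ) (p := a)).prodMk
      ((hasFDerivAt_snd (𝕜 := ℝ) (p := a)).sub (h2.add (h1.smul h3.hasFDerivAt)))
    refine h4.congr_fderiv ?_
    refine ContinuousLinearMap.ext fun v => Prod.ext ?_ ?_
    · simp [e]
    · simp [e, Λ, a, c₀, sub_eq_add_neg]
  obtain ⟨Φ, haΦ, hΦ, -, hs, hs'⟩ := exists_openPartialHomeomorph_of_hasFDerivAt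
    (U := univ) Filter.univ_mem (fun x _ => hH.contDiffAt) hd
  have hι : Continuous fun y : ℝ × F => (y, (0 : X)) := by fun_prop
  have hHa : H a = ((0, p), 0) := by simp [H, a]
  refine ⟨(fun y : ℝ × F => (y, (0 : X))) ⁻¹' Φ.target, fun y => (Φ.symm (y, 0)).2,
    Φ.open_target.preimage hι, ?_, ?_, ?_, ?_⟩
  · have := Φ.map_source haΦ
    rw [hΦ, hHa] at this
    exact this
  · exact contDiff_snd.comp_contDiffOn
      (hs'.comp (contDiff_id.prodMk contDiff_const).contDiffOn fun y hy => hy)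
  · have : Φ.symm ((0, p), 0) = a := by
      rw [← hHa, ← hΦ]; exact Φ.left_inv haΦ
    change (Φ.symm ((0, p), 0)).2 = _
    rw [this]; rfl
  · intro y hy
    have h := Φ.right_inv hy
    rw [hΦ] at h
    have h1 : (Φ.symm (y, 0)).1 = y := congrArg Prod.fst h
    have h2 : (Φ.symm (y, 0)).2 - (C (Φ.symm (y, 0)).1.2 + (Φ.symm (y, 0)).1.1 •
      integrateCurve F (N (Φ.symm (y, 0)).2)) = 0 := congrArg Prod.snd h
    rw [h1] at h2
    exact sub_eq_zero.1 h2

/-- A smooth vector field agrees near a given point with a compactly supported one. -/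
lemma exists_cutoff [FiniteDimensional ℝ F] {F' : Type*} [NormedAddCommGroup F']
    [NormedSpace ℝ F'] {Z : F → F'} {U : Set F} (hU : IsOpen U) {p : F}
    (hp : p ∈ U) (hZ : ContDiffOn ℝ ∞ Z U) :
    ∃ Z' : F → F', ContDiff ℝ ∞ Z' ∧ HasCompactSupport Z' ∧ ∃ O : Set F, IsOpen O ∧ p ∈ O ∧
      O ⊆ U ∧ EqOn Z' Z O := by
  obtain ⟨ε, hε, hεU⟩ := Metric.nhds_basis_closedBall.mem_iff.1 (hU.mem_nhds hp)
  let f : ContDiffBump p := ⟨ε / 2, ε, by positivity, by linarith⟩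
  have hcs : HasCompactSupport fun x => f x • Z x := f.hasCompactSupport.smul_right
  refine ⟨fun x => f x • Z x, ?_, hcs, Metric.ball p (ε / 2), Metric.isOpen_ball,
    Metric.mem_ball_self (by positivity), ?_, ?_⟩
  · refine contDiff_iff_contDiffAt.2 fun x => ?_
    by_cases hx : x ∈ U
    · exact f.contDiff.contDiffAt.smul (hZ.contDiffAt (hU.mem_nhds hx))
    · have hx' : x ∉ tsupport f := by
        rw [f.tsupport_eq]; exact fun h => hx (hεU h)
      refine contDiffAt_const (c := (0 : F')) |>.congr_of_eventuallyEq ?_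
      filter_upwards [(isClosed_tsupport f).isOpen_compl.mem_nhds hx'] with y hy
      rw [image_eq_zero_of_notMem_tsupport hy, zero_smul]
  · exact fun x hx => hεU (Metric.ball_subset_closedBall
      (Metric.ball_subset_ball (by linarith) hx))
  · intro x hx
    change f x • Z x = Z x
    rw [f.one_of_mem_closedBall (Metric.ball_subset_closedBall hx), one_smul]

/-- Existence of smooth local flows, together with the variational equation. `Ψ s (τ, q)` is the
value at time `s ∈ [0, 1]` of the integral curve of `τ Z` that starts at `q`. -/
theorem exists_local_flow [FiniteDimensional ℝ F] {Z : F → F} {U : Set F} (hU : IsOpen U) {p : F}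
    (hp : p ∈ U) (hZ : ContDiffOn ℝ ∞ Z U) :
    ∃ (W : Set (ℝ × F)) (Ψ : ℝ → ℝ × F → F), IsOpen W ∧ (0, p) ∈ W ∧
      (∀ s, ContDiffOn ℝ ∞ (Ψ s) W) ∧ (∀ s, ∀ y ∈ W, Ψ s y ∈ U) ∧
      (∀ y ∈ W, Ψ 0 y = y.2) ∧
      (∀ y ∈ W, ∀ s ∈ Icc (0 : ℝ) 1,
        HasDerivWithinAt (fun s => Ψ s y) (y.1 • Z (Ψ s y)) (Icc 0 1) s) ∧
      ∀ y ∈ W, ∀ v : F, fderiv ℝ (Ψ 0) y (0, v) = v ∧ ∀ s ∈ Icc (0 : ℝ) 1,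
        HasDerivWithinAt (fun s => fderiv ℝ (Ψ s) y (0, v))
          (y.1 • fderiv ℝ Z (Ψ s y) (fderiv ℝ (Ψ s) y (0, v))) (Icc 0 1) s := by
  obtain ⟨Z', hZ', hc, O, hO, hpO, hOU, hZO⟩ := exists_cutoff hU hp hZ
  have : CompleteSpace F := FiniteDimensional.complete ℝ F
  obtain ⟨W, Γ, hW, hpW, hΓ, hΓp, hΓeq⟩ := exists_solution_curves hZ' hc p
  -- The curves solve the equation of the cut-off field `Z'`. Those that remain in `O` also solve
  -- that of `Z`, and they form an open set since the parameter interval is compact.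
  let V : Set C(unitInterval, F) := {γ | MapsTo γ univ O}
  have hV : IsOpen V := ContinuousMap.isOpen_setOfPred_mapsTo isCompact_univ hO
  let π : ℝ → unitInterval := projIcc 0 1 zero_le_one
  let ev : unitInterval → C(unitInterval, F) →L[ℝ] F := fun s => ContinuousMap.evalCLM ℝ s
  have hW' : IsOpen (W ∩ Γ ⁻¹' V) := hΓ.continuousOn.isOpen_inter_preimage hW hV
  have hdiff : ∀ y ∈ W, DifferentiableAt ℝ Γ y := fun y hy =>
    (hΓ.contDiffAt (hW.mem_nhds hy)).differentiableAt (by simp)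
  have hfd : ∀ s, ∀ y ∈ W, fderiv ℝ (fun y => Γ y (π s)) y = ev (π s) ∘L fderiv ℝ Γ y := by
    intro s y hy
    exact ((ev (π s)).hasFDerivAt.comp y (hdiff y hy).hasFDerivAt).fderiv
  have hmem : ∀ s, ∀ y ∈ W ∩ Γ ⁻¹' V, Γ y (π s) ∈ O := fun s y hy => hy.2 (mem_univ _)
  have hπ0 : π 0 = 0 := by simp [π, projIcc_left]
  have hval : ∀ y ∈ W, ∀ s, Γ y (π s) =
      y.2 + y.1 • integrateCurve F (superpose Z' hZ'.continuous (Γ y)) (π s) := by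
    intro y hy s
    conv_lhs => rw [hΓeq y hy]
    simp
  have hJ0 : ∀ γ : C(unitInterval, F), integrateCurve F γ 0 = 0 := by
    intro γ; simp [integrateCurve_apply]
  -- The variational equation in integral form: the integral equation of the solution curves is
  -- differentiated in the direction $(0,v)$.
  have hvar : ∀ y ∈ W, ∀ v : F, ∀ s, fderiv ℝ Γ y (0, v) (π s) = v + y.1 •
      integrateCurve F (pointwiseApply _ F F (superpose (fderiv ℝ Z')
        (hZ'.continuous_fderiv (by simp)) (Γ y)) (fderiv ℝ Γ y (0, v))) (π s) := by
    intro y hy v s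
    have h1 : HasFDerivAt (fun y : ℝ × F => ContinuousMap.const unitInterval y.2 +
        y.1 • integrateCurve F (superpose Z' hZ'.continuous (Γ y))) (fderiv ℝ Γ y) y :=
      (hdiff y hy).hasFDerivAt.congr_of_eventuallyEq
        (Filter.eventuallyEq_of_mem (hW.mem_nhds hy) fun z hz => (hΓeq z hz).symm)
    have h2 : HasFDerivAt (fun y : ℝ × F => (ContinuousLinearMap.const ℝ unitInterval) y.2 +
        y.1 • integrateCurve F (superpose Z' hZ'.continuous (Γ y))) _ y :=
      ((ContinuousLinearMap.const ℝ unitInterval ∘L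
        ContinuousLinearMap.snd ℝ ℝ F).hasFDerivAt).add
      ((hasFDerivAt_fst (𝕜 := ℝ) (p := y)).smul ((integrateCurve F).hasFDerivAt.comp y
        ((hasFDerivAt_superpose (K := unitInterval) (hZ'.of_le (by simp)) hc (Γ y)).comp y
          (hdiff y hy).hasFDerivAt)))
    have h3 := congrArg (fun A => A (0, v) (π s)) (h1.unique h2)
    simpa using h3
  refine ⟨W ∩ Γ ⁻¹' V, fun s y => Γ y (π s), hW', ⟨hpW, ?_⟩, ?_, ?_, ?_, ?_, ?_⟩
  · change MapsTo (Γ (0, p)) univ O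
    rw [hΓp]; exact fun _ _ => hpO
  · intro s
    exact (ev (π s)).contDiff.comp_contDiffOn (hΓ.mono inter_subset_left)
  · exact fun s y hy => hOU (hmem s y hy)
  · intro y hy
    change Γ y (π 0) = y.2
    rw [hval y hy.1, hπ0, hJ0, smul_zero, add_zero]
  · intro y hy s hs
    have h := ((hasDerivWithinAt_integrateCurve (superpose Z' hZ'.continuous (Γ y)) hs).const_smul
      y.1).const_add y.2
    rw [superpose_apply, hZO (hmem s y hy)] at h
    exact h.congr (fun u _ => hval y hy.1 u) (hval y hy.1 s)
  · intro y hy v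
    have hpt : ∀ s, fderiv ℝ (fun y => Γ y (π s)) y (0, v) = fderiv ℝ Γ y (0, v) (π s) := by
      intro s; rw [hfd s y hy.1]; rfl
    refine ⟨?_, fun s hs => ?_⟩
    · rw [hpt, hvar y hy.1, hπ0, hJ0, smul_zero, add_zero]
    · have h := ((hasDerivWithinAt_integrateCurve (pointwiseApply _ F F (superpose (fderiv ℝ Z')
        (hZ'.continuous_fderiv (by simp)) (Γ y)) (fderiv ℝ Γ y (0, v))) hs).const_smul
          y.1).const_add v
      have hO' : fderiv ℝ Z' (Γ y (π s)) = fderiv ℝ Z (Γ y (π s)) :=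
        (Filter.eventuallyEq_of_mem (hO.mem_nhds (hmem s y hy)) hZO).fderiv_eq
      rw [pointwiseApply_apply, superpose_apply] at h
      rw [hpt, ← hO']
      exact h.congr (fun u _ => (hpt u).trans (hvar y hy.1 v u))
        ((hpt s).trans (hvar y hy.1 v s))

end LocalFlow

/-! ### Transport of subspaces by linear differential equations. -/

section LinearTransport

open Set

/-- Uniqueness for linear equations, from either end of the interval. Both ends are needed below, to
compare the vanishing of functionals at the two times. -/
lemma eqOn_zero_of_hasDerivWithinAt_linear {G : Type*} [NormedAddCommGroup G] [NormedSpace ℝ G]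
    {z : ℝ → G} {A : ℝ → G →L[ℝ] G} {a b : ℝ} (hA : ContinuousOn A (Icc a b))
    (hz : ∀ s ∈ Icc a b, HasDerivWithinAt z (A s (z s)) (Icc a b) s)
    (h0 : z a = 0 ∨ z b = 0) : EqOn z 0 (Icc a b) := by
  obtain ⟨C, hC⟩ := isCompact_Icc.exists_bound_of_continuousOn hA
  have hC' : ∀ s ∈ Icc a b, LipschitzOnWith C.toNNReal (fun x => A s x) univ := fun s hs =>
    ((A s).lipschitz.weaken (by
      rw [← NNReal.coe_le_coe]
      exact (hC s hs).trans (Real.le_coe_toNNReal C))).lipschitzOnWith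
  have hzc : ContinuousOn z (Icc a b) := fun s hs => (hz s hs).continuousWithinAt
  rcases h0 with h0 | h0
  · refine ODE_solution_unique_of_mem_Icc_right (v := fun s x => A s x) (s := fun _ => univ)
      (fun s hs => hC' s (Ico_subset_Icc_self hs)) hzc (fun s hs => ?_) (fun _ _ => mem_univ _)
      continuousOn_const (fun s hs => ?_) (fun _ _ => mem_univ _) h0
    · exact (hz s (Ico_subset_Icc_self hs)).mono_of_mem_nhdsWithin (Icc_mem_nhdsGE_of_mem hs)
    · exact (hasDerivWithinAt_const s (Ici s) (0 : G)).congr_deriv (map_zero _).symm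
  · refine ODE_solution_unique_of_mem_Icc_left (v := fun s x => A s x) (s := fun _ => univ)
      (fun s hs => hC' s (Ioc_subset_Icc_self hs)) hzc (fun s hs => ?_) (fun _ _ => mem_univ _)
      continuousOn_const (fun s hs => ?_) (fun _ _ => mem_univ _) h0
    · exact (hz s (Ioc_subset_Icc_self hs)).mono_of_mem_nhdsWithin (Icc_mem_nhdsLE_of_mem hs)
    · exact (hasDerivWithinAt_const s (Iic s) (0 : G)).congr_deriv (map_zero _).symm

/-- For a linear functional `ℓ`, the numbers `ℓ (v i s)` satisfy a homogeneous linear system. They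
all vanish at `a` iff they all vanish at `b`, so the two spans have the same annihilator. The
vectors need not be independent, and their rank need not be known in advance. -/
lemma span_range_eq_of_hasDerivWithinAt {G : Type*} [NormedAddCommGroup G] [NormedSpace ℝ G]
    [FiniteDimensional ℝ G] {ι : Type*} [Fintype ι] {v : ι → ℝ → G} {c : ι → ι → ℝ → ℝ} {a b : ℝ}
    (hab : a ≤ b) (hc : ∀ i j, ContinuousOn (c i j) (Icc a b))
    (hv : ∀ i, ∀ s ∈ Icc a b, HasDerivWithinAt (v i) (∑ j, c i j s • v j s) (Icc a b) s) :
    Submodule.span ℝ (range fun i => v i a) = Submodule.span ℝ (range fun i => v i b) := by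
  classical
  let C : ℝ → (ι → ℝ) →L[ℝ] (ι → ℝ) := fun s =>
    ∑ i, ∑ j, c i j s • (ContinuousLinearMap.proj j : (ι → ℝ) →L[ℝ] ℝ).smulRight (Pi.single i 1)
  have hCapp : ∀ s x i, C s x i = ∑ j, c i j s * x j := by
    intro s x i
    simp [C, Finset.sum_apply, Pi.single_apply]
  have hC : ContinuousOn C (Icc a b) :=
    continuousOn_finsetSum _ fun i _ => continuousOn_finsetSum _ fun j _ =>
      (hc i j).smul continuousOn_const
  have key : ∀ ℓ : Module.Dual ℝ G, (∀ i, ℓ (v i a) = 0) ↔ ∀ i, ℓ (v i b) = 0 := by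
    intro ℓ
    let ℓ' : G →L[ℝ] ℝ := LinearMap.toContinuousLinearMap ℓ
    let z : ℝ → ι → ℝ := fun s i => ℓ (v i s)
    have hz : ∀ s ∈ Icc a b, HasDerivWithinAt z (C s (z s)) (Icc a b) s := by
      intro s hs
      rw [hasDerivWithinAt_pi]
      intro i
      have h : HasDerivWithinAt (fun s => ℓ (v i s)) (ℓ (∑ j, c i j s • v j s)) (Icc a b) s :=
        ℓ'.hasFDerivAt.comp_hasDerivWithinAt s (hv i s hs)
      rw [hCapp]
      simpa [z] using h
    constructor
    · intro h i
      exact congrFun (eqOn_zero_of_hasDerivWithinAt_linear hC hz (Or.inl (funext h))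
        (right_mem_Icc.2 hab)) i
    · intro h i
      exact congrFun (eqOn_zero_of_hasDerivWithinAt_linear hC hz (Or.inr (funext h))
        (left_mem_Icc.2 hab)) i
  rw [← Subspace.dualAnnihilator_inj]
  ext ℓ
  have hspan : ∀ s, ℓ ∈ (Submodule.span ℝ (range fun i => v i s)).dualAnnihilator ↔
      ∀ i, ℓ (v i s) = 0 := by
    intro s
    rw [Submodule.mem_dualAnnihilator]
    refine ⟨fun h i => h _ (Submodule.subset_span ⟨i, rfl⟩), fun h w hw => ?_⟩
    have : Submodule.span ℝ (range fun i => v i s) ≤ LinearMap.ker ℓ :=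
      Submodule.span_le.2 (by rintro _ ⟨i, rfl⟩; exact h i)
    exact this hw
  rw [hspan, hspan, key]

lemma clm_eq_sum_smulRight {V : Type*} [NormedAddCommGroup V] [NormedSpace ℝ V]
    [FiniteDimensional ℝ V] {G : Type*} [NormedAddCommGroup G] [NormedSpace ℝ G] (T : V →L[ℝ] G) :
    T = ∑ i, (LinearMap.toContinuousLinearMap ((Module.finBasis ℝ V).coord i)).smulRight
      (T (Module.finBasis ℝ V i)) := by
  ext v
  conv_lhs => rw [← (Module.finBasis ℝ V).sum_repr v, map_sum]
  simp

lemma contDiffAt_clm_of_apply {V : Type*} [NormedAddCommGroup V] [NormedSpace ℝ V]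
    [FiniteDimensional ℝ V] {G D : Type*} [NormedAddCommGroup G] [NormedSpace ℝ G]
    [NormedAddCommGroup D] [NormedSpace ℝ D] {n : WithTop ℕ∞} {T : D → V →L[ℝ] G} {x : D}
    (h : ∀ v, ContDiffAt ℝ n (fun z => T z v) x) : ContDiffAt ℝ n T x := by
  have h' : ContDiffAt ℝ n (fun z => ∑ i, (LinearMap.toContinuousLinearMap
      ((Module.finBasis ℝ V).coord i)).smulRight (T z (Module.finBasis ℝ V i))) x :=
    ContDiffAt.sum fun i _ => (ContinuousLinearMap.smulRightL ℝ V G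
      (LinearMap.toContinuousLinearMap ((Module.finBasis ℝ V).coord i))).contDiff.contDiffAt.comp x
        (h _)
  exact h'.congr_of_eventuallyEq (Filter.Eventually.of_forall fun z => clm_eq_sum_smulRight (T z))

lemma hasDerivWithinAt_clm_of_apply {V : Type*} [NormedAddCommGroup V] [NormedSpace ℝ V]
    [FiniteDimensional ℝ V] {G : Type*} [NormedAddCommGroup G] [NormedSpace ℝ G]
    {B : ℝ → V →L[ℝ] G} {B' : V →L[ℝ] G} {S : Set ℝ} {s : ℝ}
    (h : ∀ v, HasDerivWithinAt (fun s => B s v) (B' v) S s) : HasDerivWithinAt B B' S s := by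
  have h' : HasDerivWithinAt
      (fun s => ∑ i, (LinearMap.toContinuousLinearMap
        ((Module.finBasis ℝ V).coord i)).smulRight (B s (Module.finBasis ℝ V i)))
      (∑ i, (LinearMap.toContinuousLinearMap
        ((Module.finBasis ℝ V).coord i)).smulRight (B' (Module.finBasis ℝ V i))) S s := by
    refine HasDerivWithinAt.fun_sum fun i _ => ?_
    exact ((ContinuousLinearMap.smulRightL ℝ V G
      (LinearMap.toContinuousLinearMap
        ((Module.finBasis ℝ V).coord i))).hasFDerivAt).comp_hasDerivWithinAt s
          (h (Module.finBasis ℝ V i))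
  rw [← clm_eq_sum_smulRight] at h'
  exact h'.congr (fun t _ => clm_eq_sum_smulRight (B t)) (clm_eq_sum_smulRight (B s))

/-- Transport of a family of subspaces of `V × V*` along a linear flow `B` with generator `A`: if
the family is spanned by elements whose covariant derivatives are combinations of these elements,
then it is preserved by the flow. -/
theorem mem_span_transport_iff {V : Type*} [NormedAddCommGroup V] [NormedSpace ℝ V]
    [FiniteDimensional ℝ V] {ι : Type*} [Fintype ι] {y : ι → ℝ → V} {b : ι → ℝ → V →L[ℝ] ℝ}
    {A B : ℝ → V →L[ℝ] V} {c : ι → ι → ℝ → ℝ}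
    (hA : ContinuousOn A (Icc 0 1)) (hc : ∀ i j, ContinuousOn (c i j) (Icc 0 1))
    (hB₀ : B 0 = .id ℝ V)
    (hB : ∀ v, ∀ s ∈ Icc (0 : ℝ) 1,
      HasDerivWithinAt (fun s => B s v) (A s (B s v)) (Icc 0 1) s)
    (hy : ∀ i, ∀ s ∈ Icc (0 : ℝ) 1,
      HasDerivWithinAt (y i) (A s (y i s) + ∑ j, c i j s • y j s) (Icc 0 1) s)
    (hb : ∀ i, ∀ s ∈ Icc (0 : ℝ) 1,
      HasDerivWithinAt (b i) (-(b i s ∘L A s) + ∑ j, c i j s • b j s) (Icc 0 1) s) :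
    (∃ B₁ : V ≃L[ℝ] V, (B₁ : V →L[ℝ] V) = B 1) ∧ ∀ (u : V) (β : V →L[ℝ] ℝ),
      ((u, β) ∈ Submodule.span ℝ (range fun i => (y i 0, b i 0)) ↔
        ∃ β' : V →L[ℝ] ℝ, (B 1 u, β') ∈ Submodule.span ℝ (range fun i => (y i 1, b i 1)) ∧
          β = β' ∘L B 1) := by
  have : CompleteSpace V := FiniteDimensional.complete ℝ V
  have hunit : ∀ s ∈ Icc (0 : ℝ) 1, IsUnit (B s) := by
    intro s hs
    -- A vector killed at time `s` gives a solution of the linear equation that vanishes there,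
    -- hence also at time $0$, where `B` is the identity.
    have hinj : Function.Injective (B s) := by
      rw [injective_iff_map_eq_zero]
      intro v hv
      have hsub : Icc 0 s ⊆ Icc (0 : ℝ) 1 := Icc_subset_Icc_right hs.2
      have := eqOn_zero_of_hasDerivWithinAt_linear (z := fun t => B t v) (hA.mono hsub)
        (fun t ht => (hB v t (hsub ht)).mono hsub) (Or.inr hv) (left_mem_Icc.2 hs.1)
      simpa [hB₀] using this
    let e : V ≃L[ℝ] V :=
      (LinearEquiv.ofInjectiveEndo (B s : V →ₗ[ℝ] V) hinj).toContinuousLinearEquiv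
    refine ⟨ContinuousLinearEquiv.toUnit e, ?_⟩
    ext v; rfl
  have hBd : ∀ s ∈ Icc (0 : ℝ) 1, HasDerivWithinAt B (A s ∘L B s) (Icc 0 1) s := fun s hs =>
    hasDerivWithinAt_clm_of_apply fun v => hB v s hs
  let K : ℝ → V →L[ℝ] V := fun s => Ring.inverse (B s)
  have hKB : ∀ s ∈ Icc (0 : ℝ) 1, K s ∘L B s = .id ℝ V := fun s hs =>
    Ring.inverse_mul_cancel _ (hunit s hs)
  have hBK : ∀ s ∈ Icc (0 : ℝ) 1, B s ∘L K s = .id ℝ V := fun s hs =>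
    Ring.mul_inverse_cancel _ (hunit s hs)
  have hKd : ∀ s ∈ Icc (0 : ℝ) 1, HasDerivWithinAt K (-(K s ∘L A s)) (Icc 0 1) s := by
    intro s hs
    obtain ⟨U, hU⟩ := hunit s hs
    have h1 := hasFDerivAt_ringInverse (𝕜 := ℝ) U
    rw [hU] at h1
    have h2 := h1.comp_hasDerivWithinAt s (hBd s hs)
    have hKs : ((U⁻¹ : (V →L[ℝ] V)ˣ) : V →L[ℝ] V) = K s := by
      change _ = Ring.inverse (B s)
      rw [← hU, Ring.inverse_unit]
    have h3 : -(K s ∘L A s) = (-ContinuousLinearMap.mulLeftRight ℝ (V →L[ℝ] V)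
        ((U⁻¹ : (V →L[ℝ] V)ˣ) : V →L[ℝ] V) ((U⁻¹ : (V →L[ℝ] V)ˣ) : V →L[ℝ] V)) (A s ∘L B s) := by
      rw [hKs, neg_apply, ContinuousLinearMap.mulLeftRight_apply]
      change -(K s ∘L A s) = -((K s ∘L (A s ∘L B s)) ∘L K s)
      rw [ContinuousLinearMap.comp_assoc, ContinuousLinearMap.comp_assoc, hBK s hs,
        ContinuousLinearMap.comp_id]
    rw [h3]
    exact h2
  -- Pulling the generators back by the flow cancels all terms with `A`, leaving a linear system
  -- with coefficients `c` in one fixed space.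
  let v : ι → ℝ → V × (V →L[ℝ] ℝ) := fun i s => (K s (y i s), b i s ∘L B s)
  have hv : ∀ i, ∀ s ∈ Icc (0 : ℝ) 1,
      HasDerivWithinAt (v i) (∑ j, c i j s • v j s) (Icc 0 1) s := by
    intro i s hs
    have h1 := (hKd s hs).clm_apply (hy i s hs)
    have h2 := (hb i s hs).clm_comp (hBd s hs)
    refine (h1.prodMk h2).congr_deriv ?_
    ext w
    · simp [v, Prod.fst_sum, map_sum]
    · simp [v, Prod.snd_sum]
  have hspan := span_range_eq_of_hasDerivWithinAt zero_le_one hc hv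
  have h01 : (1 : ℝ) ∈ Icc (0 : ℝ) 1 := right_mem_Icc.2 zero_le_one
  have hK0 : K 0 = .id ℝ V := by
    have := hKB 0 (left_mem_Icc.2 zero_le_one)
    rwa [hB₀, ContinuousLinearMap.comp_id] at this
  have hv0 : (fun i => v i 0) = fun i => (y i 0, b i 0) := by
    funext i; simp [v, hK0, hB₀]
  rw [hv0] at hspan
  let B₁ : V ≃L[ℝ] V := ContinuousLinearEquiv.equivOfInverse (B 1) (K 1)
    (fun x => DFunLike.congr_fun (hKB 1 h01) x) (fun x => DFunLike.congr_fun (hBK 1 h01) x)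
  refine ⟨⟨B₁, rfl⟩, fun u β => ?_⟩
  let P : V × (V →L[ℝ] ℝ) →ₗ[ℝ] V × (V →L[ℝ] ℝ) :=
    (K 1 : V →ₗ[ℝ] V).prodMap
      ((ContinuousLinearMap.compL ℝ V V ℝ).flip (B 1) : (V →L[ℝ] ℝ) →ₗ[ℝ] V →L[ℝ] ℝ)
  have hP : (fun i => v i 1) = P ∘ fun i => (y i 1, b i 1) := rfl
  rw [hspan, hP, range_comp, ← Submodule.map_span, Submodule.mem_map]
  constructor
  · rintro ⟨⟨u', β'⟩, hmem, heq⟩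
    have h1 : K 1 u' = u := congrArg Prod.fst heq
    have h2 : β' ∘L B 1 = β := congrArg Prod.snd heq
    refine ⟨β', ?_, h2.symm⟩
    have h3 : B 1 (K 1 u') = u' := DFunLike.congr_fun (hBK 1 h01) u'
    rwa [← h1, h3]
  · rintro ⟨β', hmem, rfl⟩
    refine ⟨_, hmem, Prod.ext ?_ rfl⟩
    exact DFunLike.congr_fun (hKB 1 h01) u

end LinearTransport

/-! ### Vector fields and forms in a smooth chart. -/

section Coordinates

open Set

variable {m : ℕ} {M : Type*} [TopologicalSpace M] [ChartedSpace (EuclideanSpace ℝ (Fin m)) M]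
  {F : Type*} [NormedAddCommGroup F] [NormedSpace ℝ F]

/-- The differential of a chart with values in a normed space. -/
def dchart (m : ℕ) {M : Type*} [TopologicalSpace M] [ChartedSpace (EuclideanSpace ℝ (Fin m)) M]
    {F : Type*} [NormedAddCommGroup F] [NormedSpace ℝ F] (φ : OpenPartialHomeomorph M F) (y : M) :
    TangentSpace (𝓡 m) y →L[ℝ] F :=
  mfderiv (𝓡 m) 𝓘(ℝ, F) φ y

/-- The differential of the inverse of a chart. -/
def dchartSymm (m : ℕ) {M : Type*} [TopologicalSpace M]
    [ChartedSpace (EuclideanSpace ℝ (Fin m)) M]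
    {F : Type*} [NormedAddCommGroup F] [NormedSpace ℝ F] (φ : OpenPartialHomeomorph M F) (q : F) :
    F →L[ℝ] TangentSpace (𝓡 m) (φ.symm q) :=
  mfderiv 𝓘(ℝ, F) (𝓡 m) φ.symm q

/-- The coordinate expression of a vector field. -/
def coordVec (φ : OpenPartialHomeomorph M F) (X : ∀ x : M, TangentSpace (𝓡 m) x) (q : F) : F :=
  dchart m φ (φ.symm q) (X (φ.symm q))

/-- The coordinate expression of a `1`-form. -/
def coordForm (φ : OpenPartialHomeomorph M F) (α : ∀ x : M, Cotangent m x) (q : F) : F →L[ℝ] ℝ :=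
  (α (φ.symm q)).comp (dchartSymm m φ q)

/-- A smooth chart with values in a normed space. -/
structure IsSmoothChart (m : ℕ) {M : Type*} [TopologicalSpace M]
    [ChartedSpace (EuclideanSpace ℝ (Fin m)) M]
    {F : Type*} [NormedAddCommGroup F] [NormedSpace ℝ F] (φ : OpenPartialHomeomorph M F) :
    Prop where
  smooth : ContMDiffOn (𝓡 m) 𝓘(ℝ, F) ∞ φ φ.source
  smooth_symm : ContMDiffOn 𝓘(ℝ, F) (𝓡 m) ∞ φ.symm φ.target

namespace IsSmoothChart

variable {φ : OpenPartialHomeomorph M F} (hφ : IsSmoothChart m φ)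
include hφ

lemma contMDiffAt {y : M} (hy : y ∈ φ.source) : ContMDiffAt (𝓡 m) 𝓘(ℝ, F) ∞ φ y :=
  hφ.smooth.contMDiffAt (φ.open_source.mem_nhds hy)

lemma contMDiffAt_symm {q : F} (hq : q ∈ φ.target) : ContMDiffAt 𝓘(ℝ, F) (𝓡 m) ∞ φ.symm q :=
  hφ.smooth_symm.contMDiffAt (φ.open_target.mem_nhds hq)

lemma dchart_dchartSymm {q : F} (hq : q ∈ φ.target) (v : F) :
    dchart m φ (φ.symm q) (dchartSymm m φ q v) = v := by
  have h1 := ((hφ.contMDiffAt (φ.map_target hq)).mdifferentiableAt (by simp)).hasMFDerivAt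
  have h2 := ((hφ.contMDiffAt_symm hq).mdifferentiableAt (by simp)).hasMFDerivAt
  have h3 := h1.comp q h2
  have h4 : HasMFDerivAt 𝓘(ℝ, F) 𝓘(ℝ, F) (φ ∘ φ.symm) q (.id ℝ F) :=
    (hasMFDerivAt_id q).congr_of_eventuallyEq (φ.eventually_right_inverse hq)
  exact DFunLike.congr_fun (hasMFDerivAt_unique h3 h4) v

lemma dchartSymm_dchart {q : F} (hq : q ∈ φ.target) (v : TangentSpace (𝓡 m) (φ.symm q)) :
    dchartSymm m φ q (dchart m φ (φ.symm q) v) = v := by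
  have hy := φ.map_target hq
  have hqq : φ (φ.symm q) = q := φ.right_inv hq
  have h1 := ((hφ.contMDiffAt hy).mdifferentiableAt (by simp)).hasMFDerivAt
  have h2 : HasMFDerivAt 𝓘(ℝ, F) (𝓡 m) φ.symm (φ (φ.symm q)) (dchartSymm m φ q) := by
    rw [hqq]
    exact ((hφ.contMDiffAt_symm hq).mdifferentiableAt (by simp)).hasMFDerivAt
  have h3 := h2.comp (φ.symm q) h1
  have h4 : HasMFDerivAt (𝓡 m) (𝓡 m) (φ.symm ∘ φ) (φ.symm q)
      (.id ℝ (EuclideanSpace ℝ (Fin m))) :=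
    (hasMFDerivAt_id _).congr_of_eventuallyEq (φ.eventually_left_inverse hy)
  exact DFunLike.congr_fun (hasMFDerivAt_unique h3 h4) v

variable [IsManifold (𝓡 m) ∞ M]

lemma contDiffAt_coordVec {X : ∀ x : M, TangentSpace (𝓡 m) x} {q : F} (hq : q ∈ φ.target)
    (hX : ContMDiffAt (𝓡 m) (𝓡 m).tangent ∞
      (fun x => (⟨x, X x⟩ : TangentBundle (𝓡 m) M)) (φ.symm q)) :
    ContDiffAt ℝ ∞ (coordVec φ X) q := by
  have hy := φ.map_target hq
  have h1 : ContMDiffOn (𝓡 m).tangent 𝓘(ℝ, F).tangent ∞ (tangentMapWithin (𝓡 m) 𝓘(ℝ, F) φ φ.source)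
      (Bundle.TotalSpace.proj ⁻¹' φ.source) :=
    hφ.smooth.contMDiffOn_tangentMapWithin (by simp) φ.open_source.uniqueMDiffOn
  have hXs := hX.comp q (hφ.contMDiffAt_symm hq)
  have hmem : (Bundle.TotalSpace.proj ⁻¹' φ.source : Set (TangentBundle (𝓡 m) M)) ∈
      𝓝 (⟨φ.symm q, X (φ.symm q)⟩ : TangentBundle (𝓡 m) M) :=
    (φ.open_source.preimage
      (FiberBundle.continuous_proj (EuclideanSpace ℝ (Fin m)) (TangentSpace (𝓡 m)))).mem_nhds hy
  have h2 := (h1.contMDiffAt hmem).comp q hXs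
  have h3 := (contMDiff_snd_tangentBundle_modelSpace F 𝓘(ℝ, F)).contMDiffAt.comp q h2
  rw [← contMDiffAt_iff_contDiffAt]
  refine h3.congr_of_eventuallyEq ?_
  filter_upwards [φ.open_target.mem_nhds hq] with z hz
  have hz' : mfderivWithin (𝓡 m) 𝓘(ℝ, F) φ φ.source (φ.symm z) =
      mfderiv (𝓡 m) 𝓘(ℝ, F) φ (φ.symm z) :=
    mfderivWithin_of_isOpen φ.open_source (φ.map_target hz)
  exact (DFunLike.congr_fun hz' (X (φ.symm z))).symm

lemma contMDiffAt_dchartSymm_apply {q : F} (hq : q ∈ φ.target) (u : F) :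
    ContMDiffAt 𝓘(ℝ, F) (𝓡 m).tangent ∞
      (fun z => (⟨φ.symm z, dchartSymm m φ z u⟩ : TangentBundle (𝓡 m) M)) q := by
  have h1 : ContMDiffOn 𝓘(ℝ, F).tangent (𝓡 m).tangent ∞
      (tangentMapWithin 𝓘(ℝ, F) (𝓡 m) φ.symm φ.target) (Bundle.TotalSpace.proj ⁻¹' φ.target) :=
    hφ.smooth_symm.contMDiffOn_tangentMapWithin (by simp) φ.open_target.uniqueMDiffOn
  have hu : ContMDiffAt 𝓘(ℝ, F) 𝓘(ℝ, F).tangent ∞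
      (fun z => (⟨z, u⟩ : TangentBundle 𝓘(ℝ, F) F)) q := by
    exact contMDiffAt_vectorSpace_iff_contDiffAt (V := fun _ => u) |>.2 contDiffAt_const
  have hmem : (Bundle.TotalSpace.proj ⁻¹' φ.target : Set (TangentBundle 𝓘(ℝ, F) F)) ∈
      𝓝 (⟨q, u⟩ : TangentBundle 𝓘(ℝ, F) F) :=
    (φ.open_target.preimage
      (FiberBundle.continuous_proj F (TangentSpace 𝓘(ℝ, F)))).mem_nhds hq
  have h2 := (h1.contMDiffAt hmem).comp q hu
  refine h2.congr_of_eventuallyEq ?_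
  filter_upwards [φ.open_target.mem_nhds hq] with z hz
  have hz' : mfderivWithin 𝓘(ℝ, F) (𝓡 m) φ.symm φ.target z = mfderiv 𝓘(ℝ, F) (𝓡 m) φ.symm z :=
    mfderivWithin_of_isOpen φ.open_target hz
  exact congrArg (Bundle.TotalSpace.mk (φ.symm z)) (DFunLike.congr_fun hz' u).symm

/-- Smoothness of a `1`-form at a point. -/
abbrev _root_.BigIso.SmoothOneFormAt (α : ∀ x : M, Cotangent m x) (x₀ : M) : Prop :=
  ContMDiffAt (𝓡 m) ((𝓡 m).prod 𝓘(ℝ, EuclideanSpace ℝ (Fin m) →L[ℝ] ℝ)) ∞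
    (fun x => Bundle.TotalSpace.mk' (EuclideanSpace ℝ (Fin m) →L[ℝ] ℝ)
      (E := fun y : M => TangentSpace (𝓡 m) y →L[ℝ] Bundle.Trivial M ℝ y) x (α x)) x₀

lemma contDiffAt_coordForm [FiniteDimensional ℝ F] {α : ∀ x : M, Cotangent m x} {q : F}
    (hq : q ∈ φ.target) (hα : SmoothOneFormAt α (φ.symm q)) :
    ContDiffAt ℝ ∞ (coordForm φ α) q := by
  have hαs := hα.comp q (hφ.contMDiffAt_symm hq)
  have key : ∀ u : F, ContDiffAt ℝ ∞ (fun z => coordForm φ α z u) q := by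
    intro u
    have h1 := ContMDiffAt.clm_bundle_apply (E₂ := Bundle.Trivial M ℝ) (F₂ := ℝ) (b := φ.symm)
      hαs (hφ.contMDiffAt_dchartSymm_apply hq u)
    rw [Bundle.contMDiffAt_totalSpace] at h1
    exact h1.2.contDiffAt
  exact contDiffAt_clm_of_apply key

end IsSmoothChart

end Coordinates

/-! ### Naturality of the Lie bracket and of the exterior derivative. -/

section CourantCoordinates

open Set

variable {m : ℕ} {M : Type*} [TopologicalSpace M] [ChartedSpace (EuclideanSpace ℝ (Fin m)) M]
  {F : Type*} [NormedAddCommGroup F] [NormedSpace ℝ F]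

lemma two_le_infty : (2 : WithTop ℕ∞) ≤ ∞ :=
  WithTop.coe_le_coe.2 (le_top : (2 : ℕ∞) ≤ ⊤)

lemma mlieBracket_eq_lieBracket {V W : ∀ x : F, TangentSpace 𝓘(ℝ, F) x} :
    VectorField.mlieBracket 𝓘(ℝ, F) V W = VectorField.lieBracket ℝ (E := F) V W := by
  rw [← VectorField.mlieBracketWithin_univ, VectorField.mlieBracketWithin_eq_lieBracketWithin]
  exact VectorField.lieBracketWithin_univ

lemma isSmoothChart_chartAt [IsManifold (𝓡 m) ∞ M] (x : M) :
    IsSmoothChart m (chartAt (EuclideanSpace ℝ (Fin m)) x) :=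
  ⟨contMDiffOn_chart, contMDiffOn_chart_symm⟩

namespace IsSmoothChart

variable {φ : OpenPartialHomeomorph M F} (hφ : IsSmoothChart m φ)
include hφ

lemma form_dchartSymm_dchart (α : ∀ x : M, Cotangent m x) {y : M} (hy : y ∈ φ.source)
    (v : TangentSpace (𝓡 m) y) :
    α (φ.symm (φ y)) (dchartSymm m φ (φ y) (dchart m φ y v)) = α y v := by
  -- Writing the point as `φ.symm q` avoids transporting vectors between the tangent spaces at `y`
  -- and at `φ.symm (φ y)`.
  obtain ⟨q, hq, rfl⟩ : ∃ q ∈ φ.target, φ.symm q = y := ⟨φ y, φ.map_source hy, φ.left_inv hy⟩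
  rw [φ.right_inv hq, hφ.dchartSymm_dchart hq]

variable [IsManifold (𝓡 m) ∞ M]

lemma coordVec_mlieBracket [CompleteSpace F] {X Y : ∀ x : M, TangentSpace (𝓡 m) x} {q : F}
    (hq : q ∈ φ.target)
    (hX : ContMDiffAt (𝓡 m) (𝓡 m).tangent ∞
      (fun x => (⟨x, X x⟩ : TangentBundle (𝓡 m) M)) (φ.symm q))
    (hY : ContMDiffAt (𝓡 m) (𝓡 m).tangent ∞
      (fun x => (⟨x, Y x⟩ : TangentBundle (𝓡 m) M)) (φ.symm q)) :
    coordVec φ (VectorField.mlieBracket (𝓡 m) X Y) q =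
      VectorField.lieBracket ℝ (coordVec φ X) (coordVec φ Y) q := by
  have hpull : ∀ Z : ∀ x : M, TangentSpace (𝓡 m) x, ∀ z ∈ φ.target,
      VectorField.mpullback 𝓘(ℝ, F) (𝓡 m) φ.symm Z z = coordVec φ Z z := by
    intro Z z hz
    rw [VectorField.mpullback_apply]
    have : (mfderiv 𝓘(ℝ, F) (𝓡 m) φ.symm z).inverse = dchart m φ (φ.symm z) :=
      ContinuousLinearMap.inverse_eq
        (ContinuousLinearMap.ext fun v => hφ.dchartSymm_dchart hz v)
        (ContinuousLinearMap.ext fun v => hφ.dchart_dchartSymm hz v)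
    rw [this]
    rfl
  have hm : minSmoothness ℝ 2 = 2 := minSmoothness_of_isRCLikeNormedField
  have : IsManifold (𝓡 m) (minSmoothness ℝ 2) M := by
    rw [hm]; exact IsManifold.of_le two_le_infty
  have : IsManifold (𝓡 m) (minSmoothness ℝ 3) M := by
    rw [minSmoothness_of_isRCLikeNormedField]
    exact IsManifold.of_le (n := ∞) (WithTop.coe_le_coe.2 (le_top : (3 : ℕ∞) ≤ ⊤))
  have h := VectorField.mpullback_mlieBracket (n := ∞) (hX.mdifferentiableAt (by simp))
    (hY.mdifferentiableAt (by simp)) (hφ.contMDiffAt_symm hq) (hm.le.trans two_le_infty)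
  rw [hpull _ q hq] at h
  refine h.trans (Eq.trans ?_ (congrFun (mlieBracket_eq_lieBracket (F := F)
    (V := coordVec φ X) (W := coordVec φ Y)) q))
  exact Filter.EventuallyEq.mlieBracket_vectorField_eq
    (Filter.eventuallyEq_of_mem (φ.open_target.mem_nhds hq) (hpull X))
    (Filter.eventuallyEq_of_mem (φ.open_target.mem_nhds hq) (hpull Y))

/-- The exterior derivative is defined through the preferred chart at the point, so its independence
of the chart must be proved. With `τ` the transition map, the local expressions are related by
$b=(a\circ\tau)\cdot D\tau$. The terms with $D^2\tau$ cancel on antisymmetrization, because second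
derivatives are symmetric. -/
lemma interiorExtDeriv_dchartSymm {α : ∀ x : M, Cotangent m x} {p : F}
    (hp : p ∈ φ.target) (hα : SmoothOneFormAt α (φ.symm p)) (u v : F) :
    interiorExtDeriv α (φ.symm p) (dchartSymm m φ p u) (dchartSymm m φ p v) =
      fderiv ℝ (coordForm φ α) p u v - fderiv ℝ (coordForm φ α) p v u := by
  set x := φ.symm p with hx
  let κ := chartAt (EuclideanSpace ℝ (Fin m)) x
  have hκ : IsSmoothChart m κ := isSmoothChart_chartAt x
  have hxκ : x ∈ κ.source := mem_chart_source _ x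
  let τ : F → EuclideanSpace ℝ (Fin m) := fun z => κ (φ.symm z)
  have hev : ∀ᶠ z in 𝓝 p, z ∈ φ.target ∧ φ.symm z ∈ κ.source :=
    (Filter.eventually_of_mem (φ.open_target.mem_nhds hp) fun _ h => h).and
      ((φ.continuousAt_symm hp).eventually (κ.open_source.mem_nhds hxκ))
  have hτd : ∀ z, z ∈ φ.target → φ.symm z ∈ κ.source →
      HasFDerivAt τ (dchart m κ (φ.symm z) ∘L dchartSymm m φ z) z := by
    intro z hz hz'
    have h1 := ((hκ.contMDiffAt hz').mdifferentiableAt (by simp)).hasMFDerivAt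
    have h2 := ((hφ.contMDiffAt_symm hz).mdifferentiableAt (by simp)).hasMFDerivAt
    exact (h1.comp z h2).hasFDerivAt
  have hτs : ContDiffAt ℝ ∞ τ p := by
    rw [← contMDiffAt_iff_contDiffAt]
    exact (hκ.contMDiffAt hxκ).comp p (hφ.contMDiffAt_symm hp)
  let a := coordForm κ α
  have hκx : κ.symm (κ x) = x := κ.left_inv hxκ
  have ha : ContDiffAt ℝ ∞ a (τ p) :=
    hκ.contDiffAt_coordForm (κ.map_source hxκ) (by
      have : κ.symm (τ p) = x := hκx
      rw [this]; exact hα)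
  have hab : coordForm φ α =ᶠ[𝓝 p] fun z => a (τ z) ∘L fderiv ℝ τ z := by
    filter_upwards [hev] with z hz
    ext w
    rw [(hτd z hz.1 hz.2).fderiv]
    exact (hκ.form_dchartSymm_dchart α hz.2 (dchartSymm m φ z w)).symm
  have hτ1 : HasFDerivAt τ (fderiv ℝ τ p) p := (hτs.differentiableAt (by simp)).hasFDerivAt
  have hτ2 : HasFDerivAt (fderiv ℝ τ) (fderiv ℝ (fderiv ℝ τ) p) p :=
    ((hτs.fderiv_right (m := ∞) (by simp)).differentiableAt (by simp)).hasFDerivAt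
  have hd := (((ha.differentiableAt (by simp)).hasFDerivAt.comp p hτ1).clm_comp
    hτ2).congr_of_eventuallyEq hab
  have hsymm : fderiv ℝ (fderiv ℝ τ) p u v = fderiv ℝ (fderiv ℝ τ) p v u :=
    hτs.isSymmSndFDerivAt (minSmoothness_of_isRCLikeNormedField.le.trans two_le_infty) u v
  have hD : ∀ w, dchart m κ x (dchartSymm m φ p w) = fderiv ℝ τ p w := by
    intro w
    rw [(hτd p hp hxκ).fderiv]; rfl
  have hmain : interiorExtDeriv α x (dchartSymm m φ p u) (dchartSymm m φ p v) =
      fderiv ℝ a (τ p) (dchart m κ x (dchartSymm m φ p u)) (dchart m κ x (dchartSymm m φ p v)) -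
      fderiv ℝ a (τ p) (dchart m κ x (dchartSymm m φ p v))
        (dchart m κ x (dchartSymm m φ p u)) := rfl
  rw [hmain, hD, hD, hd.fderiv]
  simp only [add_apply, ContinuousLinearMap.comp_apply, ContinuousLinearMap.compL_apply,
    ContinuousLinearMap.flip_apply, hsymm, Function.comp_def]
  ring

end IsSmoothChart

end CourantCoordinates

/-! ### Integrability for local sections, and its coordinate form. -/

section LocalIntegrability

open Set

variable {m : ℕ} {M : Type*} [TopologicalSpace M] [ChartedSpace (EuclideanSpace ℝ (Fin m)) M]

lemma interiorExtDeriv_congr {α α' : ∀ x : M, Cotangent m x} {x : M}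
    (h : ∀ᶠ y in 𝓝 x, α y = α' y) (u : TangentSpace (𝓡 m) x) :
    interiorExtDeriv α x u = interiorExtDeriv α' x u := by
  have h1 : oneFormInChart α x =ᶠ[𝓝 (extChartAt (𝓡 m) x x)] oneFormInChart α' x := by
    have hc := (continuousAt_extChartAt_symm (I := 𝓡 m) x).eventually
      (by rwa [extChartAt_to_inv])
    filter_upwards [hc] with z hz
    simp only [oneFormInChart, hz]
  simp only [interiorExtDeriv, h1.fderiv_eq]

lemma differential_congr {f g : M → ℝ} {x : M} (h : ∀ᶠ y in 𝓝 x, f y = g y) :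
    differential (m := m) f x = differential g x :=
  Filter.EventuallyEq.mfderiv_eq h

lemma lieDerivative_congr {X X' : ∀ x : M, TangentSpace (𝓡 m) x} {α α' : ∀ x : M, Cotangent m x}
    {x : M} (hX : ∀ᶠ y in 𝓝 x, X y = X' y) (hα : ∀ᶠ y in 𝓝 x, α y = α' y) :
    lieDerivative X α x = lieDerivative X' α' x := by
  have h1 : differential (m := m) (fun y => α y (X y)) x = differential (fun y => α' y (X' y)) x :=
    differential_congr (by filter_upwards [hX, hα] with y h h'; rw [h, h'])
  rw [lieDerivative, lieDerivative, h1, interiorExtDeriv_congr hα, hX.self_of_nhds]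

lemma courantBracket_congr {e₁ e₂ e₁' e₂' : ∀ x : M, BigTangent m x} {x : M}
    (h : ∀ᶠ y in 𝓝 x, e₁ y = e₂ y) (h' : ∀ᶠ y in 𝓝 x, e₁' y = e₂' y) :
    courantBracket e₁ e₁' x = courantBracket e₂ e₂' x := by
  have hf : ∀ᶠ y in 𝓝 x, (e₁ y).1 = (e₂ y).1 := h.mono fun y hy => by rw [hy]
  have hs : ∀ᶠ y in 𝓝 x, (e₁ y).2 = (e₂ y).2 := h.mono fun y hy => by rw [hy]
  have hf' : ∀ᶠ y in 𝓝 x, (e₁' y).1 = (e₂' y).1 := h'.mono fun y hy => by rw [hy]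
  have hs' : ∀ᶠ y in 𝓝 x, (e₁' y).2 = (e₂' y).2 := h'.mono fun y hy => by rw [hy]
  refine Prod.ext ?_ ?_
  · exact Filter.EventuallyEq.mlieBracket_vectorField_eq hf hf'
  · have h1 : differential (m := m) (fun y => (e₁ y).2 (e₁' y).1 - (e₁' y).2 (e₁ y).1) x =
        differential (fun y => (e₂ y).2 (e₂' y).1 - (e₂' y).2 (e₂ y).1) x :=
      differential_congr (by filter_upwards [h, h'] with y hy hy'; rw [hy, hy'])
    change _ - _ + _ = _ - _ + _
    rw [h1, lieDerivative_congr hf hs', lieDerivative_congr hf' hs]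

variable {F : Type*} [NormedAddCommGroup F] [NormedSpace ℝ F]

/-- The identification of `F × F*` with the fibre of the big tangent bundle given by a chart. -/
def toBigTangent (m : ℕ) {M : Type*} [TopologicalSpace M]
    [ChartedSpace (EuclideanSpace ℝ (Fin m)) M]
    {F : Type*} [NormedAddCommGroup F] [NormedSpace ℝ F] (φ : OpenPartialHomeomorph M F) (q : F) :
    F × (F →L[ℝ] ℝ) →ₗ[ℝ] BigTangent m (φ.symm q) where
  toFun e := (dchartSymm m φ q e.1, e.2.comp (dchart m φ (φ.symm q)))
  map_add' _ _ := Prod.ext (map_add _ _ _) (ContinuousLinearMap.add_comp _ _ _)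
  map_smul' _ _ := Prod.ext (map_smul _ _ _) (ContinuousLinearMap.ext fun _ => rfl)

/-- The coordinate expression of a field of subspaces of the big tangent bundle. -/
def coordStructure (φ : OpenPartialHomeomorph M F) (E : ∀ x : M, Submodule ℝ (BigTangent m x))
    (q : F) : Submodule ℝ (F × (F →L[ℝ] ℝ)) :=
  (E (φ.symm q)).comap (toBigTangent m φ q)

lemma mem_coordStructure {φ : OpenPartialHomeomorph M F}
    {E : ∀ x : M, Submodule ℝ (BigTangent m x)}
    {q : F} {e : F × (F →L[ℝ] ℝ)} : e ∈ coordStructure φ E q ↔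
      ((dchartSymm m φ q e.1, e.2.comp (dchart m φ (φ.symm q))) : BigTangent m (φ.symm q)) ∈
        E (φ.symm q) := Iff.rfl

variable [T2Space M] [IsManifold (𝓡 m) ∞ M]

/-- The Courant bracket of local sections of an integrable structure belongs to the structure. -/
lemma courantBracket_mem {E : ∀ x : M, Submodule ℝ (BigTangent m x)} (hint : IsIntegrable E)
    {U : Set M} (hU : IsOpen U) {x : M} (hx : x ∈ U) {e e' : ∀ x : M, BigTangent m x}
    (he : SmoothSectionOn e U) (he' : SmoothSectionOn e' U)
    (hE : ∀ y ∈ U, e y ∈ E y) (hE' : ∀ y ∈ U, e' y ∈ E y) : courantBracket e e' x ∈ E x := by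
  -- Integrability concerns global sections only. Multiplication by a bump function supported in `U`
  -- extends local sections by zero, and the bracket at `x` depends only on their germs there.
  obtain ⟨χ, -, hχ⟩ := (SmoothBumpFunction.nhds_basis_tsupport (I := 𝓡 m) x).mem_iff.1
    (hU.mem_nhds hx)
  have hsec : ∀ s : ∀ x : M, BigTangent m x, SmoothSectionOn s U → (∀ y ∈ U, s y ∈ E y) →
      IsSection E (fun y => χ y • s y) := by
    intro s hs hsE
    refine ⟨⟨?_, ?_⟩, fun y => ?_⟩
    · exact (ContMDiffOn.smul_section_of_tsupport (χ.contMDiff.contMDiffOn) hU hχ hs.1).contMDiffOn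
    · exact (ContMDiffOn.smul_section_of_tsupport (χ.contMDiff.contMDiffOn) hU hχ hs.2).contMDiffOn
    · by_cases hy : y ∈ U
      · exact (E y).smul_mem _ (hsE y hy)
      · have : χ y = 0 := image_eq_zero_of_notMem_tsupport fun h => hy (hχ h)
        change χ y • s y ∈ E y
        rw [this, zero_smul]
        exact (E y).zero_mem
  have hone : ∀ s : ∀ x : M, BigTangent m x, ∀ᶠ y in 𝓝 x, χ y • s y = s y := fun s =>
    χ.eventuallyEq_one.mono fun y hy => by
      have : χ y = 1 := hy
      rw [this, one_smul]
  rw [← courantBracket_congr (hone e) (hone e')]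
  exact (hint _ _ (hsec e he hE) (hsec e' he' hE')).2 x

namespace IsSmoothChart

variable {φ : OpenPartialHomeomorph M F} (hφ : IsSmoothChart m φ)
  {E : ∀ x : M, Submodule ℝ (BigTangent m x)}
include hφ

omit [T2Space M] [IsManifold (𝓡 m) ∞ M] in
lemma coord_mem_coordStructure {q : F} (hq : q ∈ φ.target) (e : ∀ x : M, BigTangent m x) :
    (coordVec φ (fun y => (e y).1) q, coordForm φ (fun y => (e y).2) q) ∈ coordStructure φ E q ↔
      e (φ.symm q) ∈ E (φ.symm q) := by
  have : ((dchartSymm m φ q (coordVec φ (fun y => (e y).1) q),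
      (coordForm φ (fun y => (e y).2) q).comp (dchart m φ (φ.symm q))) :
      BigTangent m (φ.symm q)) = e (φ.symm q) :=
    Prod.ext (hφ.dchartSymm_dchart hq _) (ContinuousLinearMap.ext fun v =>
      congrArg (e (φ.symm q)).2 (hφ.dchartSymm_dchart hq v))
  rw [mem_coordStructure, this]

/-- The Courant bracket of two sections, both pairings of which vanish, in coordinates. -/
lemma coord_courantBracket_mem [CompleteSpace F] (hint : IsIntegrable E) {p : F}
    (hp : p ∈ φ.target) {U : Set M} (hU : IsOpen U) (hpU : φ.symm p ∈ U)
    {e e' : ∀ x : M, BigTangent m x}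
    (he : SmoothSectionOn e U) (he' : SmoothSectionOn e' U)
    (hE : ∀ y ∈ U, e y ∈ E y) (hE' : ∀ y ∈ U, e' y ∈ E y)
    (h0 : ∀ y ∈ U, (e y).2 (e' y).1 = 0) (h0' : ∀ y ∈ U, (e' y).2 (e y).1 = 0)
    {X Y : F → F} {α β : F → F →L[ℝ] ℝ}
    (hX : coordVec φ (fun y => (e y).1) =ᶠ[𝓝 p] X) (hα : coordForm φ (fun y => (e y).2) =ᶠ[𝓝 p] α)
    (hY : coordVec φ (fun y => (e' y).1) =ᶠ[𝓝 p] Y)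
    (hβ : coordForm φ (fun y => (e' y).2) =ᶠ[𝓝 p] β) :
    ∃ γ : F →L[ℝ] ℝ, (fderiv ℝ Y p (X p) - fderiv ℝ X p (Y p), γ) ∈ coordStructure φ E p ∧
      ∀ w, γ w = fderiv ℝ β p (X p) w - fderiv ℝ β p w (X p) -
        (fderiv ℝ α p (Y p) w - fderiv ℝ α p w (Y p)) := by
  have hmem := courantBracket_mem hint hU hpU he he' hE hE'
  have hUn := hU.mem_nhds hpU
  refine ⟨coordForm φ (fun y => (courantBracket e e' y).2) p, ?_, fun w => ?_⟩
  · have h1 := (hφ.coord_mem_coordStructure hp (courantBracket e e')).2 hmem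
    have h2 := hφ.coordVec_mlieBracket hp (he.1.contMDiffAt hUn) (he'.1.contMDiffAt hUn)
    rw [VectorField.lieBracket, hX.fderiv_eq, hY.fderiv_eq, hX.self_of_nhds, hY.self_of_nhds] at h2
    rw [← h2]
    exact h1
  -- Since both pairings vanish near the point, every differential of a function drops out of the
  -- Courant bracket. Only $i_X d\beta-i_Y d\alpha$ is left.
  · have hz : ∀ f : M → ℝ, (∀ y ∈ U, f y = 0) → differential (m := m) f (φ.symm p) = 0 := by
      intro f hf
      rw [differential_congr (g := fun _ => 0) (Filter.eventually_of_mem hUn hf)]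
      exact mfderiv_const
    have h1 : ∀ v, (courantBracket e e' (φ.symm p)).2 v =
        interiorExtDeriv (fun y => (e' y).2) (φ.symm p) (e (φ.symm p)).1 v -
        interiorExtDeriv (fun y => (e y).2) (φ.symm p) (e' (φ.symm p)).1 v := by
      intro v
      have : (courantBracket e e' (φ.symm p)).2 =
          interiorExtDeriv (fun y => (e' y).2) (φ.symm p) (e (φ.symm p)).1 -
          interiorExtDeriv (fun y => (e y).2) (φ.symm p) (e' (φ.symm p)).1 := by
        change lieDerivative _ _ _ - lieDerivative _ _ _ + _ = _
        rw [lieDerivative, lieDerivative, hz _ h0, hz _ h0',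
          hz _ fun y hy => by rw [h0 y hy, h0' y hy, sub_zero]]
        simp
      rw [this]; rfl
    have h2 := hφ.interiorExtDeriv_dchartSymm hp (he'.2.contMDiffAt hUn) (X p) w
    have h3 := hφ.interiorExtDeriv_dchartSymm hp (he.2.contMDiffAt hUn) (Y p) w
    have hXp : dchartSymm m φ p (X p) = (e (φ.symm p)).1 := by
      rw [← hX.self_of_nhds]; exact hφ.dchartSymm_dchart hp _
    have hYp : dchartSymm m φ p (Y p) = (e' (φ.symm p)).1 := by
      rw [← hY.self_of_nhds]; exact hφ.dchartSymm_dchart hp _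
    rw [hXp, hβ.fderiv_eq] at h2
    rw [hYp, hα.fderiv_eq] at h3
    rw [← h2, ← h3]
    exact h1 _

end IsSmoothChart

end LocalIntegrability

/-! ### Infinitesimal invariance of the fibre structure under horizontal lifts. -/

section FibreTransport

open Set

lemma hasFDerivAt_of_contDiffOn {D G : Type*} [NormedAddCommGroup D] [NormedSpace ℝ D]
    [NormedAddCommGroup G] [NormedSpace ℝ G] {f : D → G} {O : Set D} (hf : ContDiffOn ℝ ∞ f O)
    (hO : IsOpen O) {q : D} (hq : q ∈ O) : HasFDerivAt f (fderiv ℝ f q) q :=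
  ((hf.contDiffAt (hO.mem_nhds hq)).differentiableAt (by simp)).hasFDerivAt

lemma hasFDerivAt_eq_zero_of_eqOn_const {D G : Type*} [NormedAddCommGroup D] [NormedSpace ℝ D]
    [NormedAddCommGroup G] [NormedSpace ℝ G] {f : D → G} {f' : D →L[ℝ] G} {g : G} {O : Set D}
    (hO : IsOpen O) {q : D} (hq : q ∈ O) (hf : ∀ z ∈ O, f z = g) (hf' : HasFDerivAt f f' q) :
    f' = 0 :=
  hf'.unique ((hasFDerivAt_const _ _).congr_of_eventuallyEq
    (Filter.eventuallyEq_of_mem (hO.mem_nhds hq) hf))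

/-- If $L_1$ is a left inverse of $A(p)$, then $L_1A(q)$ is invertible for `q` near `p`, and
$(L_1A(q))^{-1}L_1$ is a left inverse of $A(q)$ that depends smoothly on `q`. -/
lemma exists_smooth_leftInverse {D C G : Type*} [NormedAddCommGroup D] [NormedSpace ℝ D]
    [NormedAddCommGroup C] [NormedSpace ℝ C] [FiniteDimensional ℝ C]
    [NormedAddCommGroup G] [NormedSpace ℝ G] [FiniteDimensional ℝ G]
    {A : D → C →L[ℝ] G} {O : Set D} (hO : IsOpen O) {p : D} (hp : p ∈ O)
    (hA : ContDiffOn ℝ ∞ A O) (hinj : Function.Injective (A p)) :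
    ∃ O' ⊆ O, IsOpen O' ∧ p ∈ O' ∧ ∃ L : D → G →L[ℝ] C, ContDiffOn ℝ ∞ L O' ∧
      ∀ q ∈ O', ∀ c, L q (A q c) = c := by
  have : CompleteSpace C := FiniteDimensional.complete ℝ C
  obtain ⟨L₀, hL₀⟩ := LinearMap.exists_leftInverse_of_injective (A p : C →ₗ[ℝ] G)
    (LinearMap.ker_eq_bot.2 hinj)
  let L₁ : G →L[ℝ] C := LinearMap.toContinuousLinearMap L₀
  have hL₁ : L₁ ∘L A p = .id ℝ C := by
    ext c; exact LinearMap.congr_fun hL₀ c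
  have hD : ContDiffOn ℝ ∞ (fun q => L₁ ∘L A q) O := contDiffOn_const.clm_comp hA
  have hO' : IsOpen (O ∩ (fun q => L₁ ∘L A q) ⁻¹' {T : C →L[ℝ] C | IsUnit T}) :=
    hD.continuousOn.isOpen_inter_preimage hO Units.isOpen
  refine ⟨_, inter_subset_left, hO', ⟨hp, ?_⟩, fun q => Ring.inverse (L₁ ∘L A q) ∘L L₁, ?_, ?_⟩
  · change IsUnit (L₁ ∘L A p)
    rw [hL₁]; exact isUnit_one
  · refine ContDiffOn.clm_comp (fun q hq => ?_) contDiffOn_const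
    obtain ⟨U, hU⟩ := hq.2
    have h1 : ContDiffAt ℝ ∞ Ring.inverse (L₁ ∘L A q) := by
      have := contDiffAt_ringInverse ℝ (n := ∞) U
      rwa [hU] at this
    exact h1.comp_contDiffWithinAt q ((hD q hq.1).mono inter_subset_left)
  · intro q hq c
    exact DFunLike.congr_fun (Ring.inverse_mul_cancel _ hq.2) c

variable {E₁ E₂ : Type*} [NormedAddCommGroup E₁] [NormedSpace ℝ E₁] [FiniteDimensional ℝ E₁]
  [NormedAddCommGroup E₂] [NormedSpace ℝ E₂] [FiniteDimensional ℝ E₂]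

/-- The structure induced by a subspace `S` of `(E₁ × E₂) × (E₁ × E₂)*` on the fibre `E₂`. -/
def fibreStructure (S : Submodule ℝ ((E₁ × E₂) × (E₁ × E₂ →L[ℝ] ℝ))) :
    Submodule ℝ (E₂ × (E₂ →L[ℝ] ℝ)) where
  carrier := {e | ∃ a : E₁ × E₂ →L[ℝ] ℝ, ((0, e.1), a) ∈ S ∧ e.2 = a ∘L .inr ℝ E₁ E₂}
  zero_mem' := ⟨0, S.zero_mem, rfl⟩
  add_mem' := by
    rintro e e' ⟨a, h, ha⟩ ⟨a', h', ha'⟩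
    refine ⟨a + a', ?_, ?_⟩
    · simpa using S.add_mem h h'
    · rw [Prod.snd_add, ha, ha', ContinuousLinearMap.add_comp]
  smul_mem' := by
    rintro c e ⟨a, h, ha⟩
    refine ⟨c • a, ?_, ?_⟩
    · simpa using S.smul_mem c h
    · rw [Prod.smul_snd, ha, ContinuousLinearMap.smul_comp]

/-- The coordinate form, over an open set `O`, of an integrable big-isotropic structure that is
decomposable with respect to the projection of `E₁ × E₂` onto `E₁`. -/
structure IsDecomposableFrame {ι : Type*} [Fintype ι]
    (S : E₁ × E₂ → Submodule ℝ ((E₁ × E₂) × (E₁ × E₂ →L[ℝ] ℝ))) (O : Set (E₁ × E₂))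
    (ε : E₁ × E₂ → (ι → ℝ) →L[ℝ] (E₁ × E₂) × (E₁ × E₂ →L[ℝ] ℝ)) : Prop where
  isOpen : IsOpen O
  smooth : ContDiffOn ℝ ∞ ε O
  injective : ∀ q ∈ O, Function.Injective (ε q)
  mem_iff : ∀ q ∈ O, ∀ e, e ∈ S q ↔ ∃ c, ε q c = e
  bracket : ∀ O' ⊆ O, IsOpen O' → ∀ c c' : E₁ × E₂ → ι → ℝ, ContDiffOn ℝ ∞ c O' →
    ContDiffOn ℝ ∞ c' O' →
    (∀ q ∈ O', (ε q (c q)).2 (ε q (c' q)).1 = 0) → (∀ q ∈ O', (ε q (c' q)).2 (ε q (c q)).1 = 0) →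
    ∀ q ∈ O', ∃ γ : E₁ × E₂ →L[ℝ] ℝ,
      (fderiv ℝ (fun z => (ε z (c' z)).1) q (ε q (c q)).1 -
        fderiv ℝ (fun z => (ε z (c z)).1) q (ε q (c' q)).1, γ) ∈ S q ∧
      ∀ w, γ w = fderiv ℝ (fun z => (ε z (c' z)).2) q (ε q (c q)).1 w -
          fderiv ℝ (fun z => (ε z (c' z)).2) q w (ε q (c q)).1 -
        (fderiv ℝ (fun z => (ε z (c z)).2) q (ε q (c' q)).1 w -
          fderiv ℝ (fun z => (ε z (c z)).2) q w (ε q (c' q)).1)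
  isotropic : ∀ q ∈ O, ∀ e ∈ S q, ∀ e' ∈ S q, e.2 e'.1 + e'.2 e.1 = 0
  exists_lift : ∀ q ∈ O, ∀ ξ : E₁, ∃ e ∈ S q, e.1.1 = ξ ∧ e.2 ∘L .inr ℝ E₁ E₂ = 0
  eq_zero : ∀ q ∈ O, ∀ e ∈ S q, e.1.1 = 0 → e.2 ∘L .inr ℝ E₁ E₂ = 0 → e.1 = 0
  slice : ∀ q ∈ O, q.2 = 0 → ∀ e ∈ S q, e.1.2 = 0

variable {ι : Type*} [Fintype ι]
  {S : E₁ × E₂ → Submodule ℝ ((E₁ × E₂) × (E₁ × E₂ →L[ℝ] ℝ))} {O : Set (E₁ × E₂)}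
  {ε : E₁ × E₂ → (ι → ℝ) →L[ℝ] (E₁ × E₂) × (E₁ × E₂ →L[ℝ] ℝ)}

/-- An element of the structure is determined by its vertical covector part and its horizontal
vector part. -/
def fibreCoordinates (E₁ E₂ : Type*) [NormedAddCommGroup E₁] [NormedSpace ℝ E₁]
    [NormedAddCommGroup E₂] [NormedSpace ℝ E₂] :
    (E₁ × E₂) × (E₁ × E₂ →L[ℝ] ℝ) →L[ℝ] (E₂ →L[ℝ] ℝ) × E₁ :=
  ((ContinuousLinearMap.compL ℝ E₂ (E₁ × E₂) ℝ).flip (.inr ℝ E₁ E₂) ∘L .snd ℝ _ _).prod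
    (.fst ℝ E₁ E₂ ∘L .fst ℝ _ _)

omit [FiniteDimensional ℝ E₁] [FiniteDimensional ℝ E₂] in
@[simp] lemma fibreCoordinates_apply (e : (E₁ × E₂) × (E₁ × E₂ →L[ℝ] ℝ)) :
    fibreCoordinates E₁ E₂ e = (e.2 ∘L .inr ℝ E₁ E₂, e.1.1) := rfl

namespace IsDecomposableFrame

variable (h : IsDecomposableFrame S O ε)
include h

omit [FiniteDimensional ℝ E₁] [FiniteDimensional ℝ E₂] in
-- For an element with zero coordinates, the vector part lies in $H\cap T\mathcal F=0$. The covector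
-- part kills vertical vectors by assumption and horizontal lifts by isotropy; these together span
-- everything.
lemma fibreCoordinates_injective {q : E₁ × E₂} (hq : q ∈ O) :
    Function.Injective (fibreCoordinates E₁ E₂ ∘L ε q) := by
  rw [injective_iff_map_eq_zero]
  intro c hc
  have hc1 : (ε q c).2 ∘L .inr ℝ E₁ E₂ = 0 := congrArg Prod.fst hc
  have hc2 : (ε q c).1.1 = 0 := congrArg Prod.snd hc
  have hmem : ε q c ∈ S q := (h.mem_iff q hq _).2 ⟨c, rfl⟩
  have h1 : (ε q c).1 = 0 := h.eq_zero q hq _ hmem hc2 hc1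
  have hinr : ∀ w, (ε q c).2 (0, w) = 0 := fun w => DFunLike.congr_fun hc1 w
  have h2 : (ε q c).2 = 0 := by
    ext v
    · obtain ⟨e, he, he1, he2⟩ := h.exists_lift q hq v
      have h3 := h.isotropic q hq _ hmem _ he
      rw [h1, map_zero, add_zero] at h3
      have h4 : ((v, 0) : E₁ × E₂) = e.1 - (0, e.1.2) := by
        rw [← he1]; ext <;> simp
      change (ε q c).2 (v, 0) = 0
      rw [h4, map_sub, h3, hinr, sub_zero]
    · exact hinr v
  exact (injective_iff_map_eq_zero _).1 (h.injective q hq) c (Prod.ext h1 h2)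

/-- The lift of a constant vector `ξ` of the base preserves the structure of the fibres,
infinitesimally. -/
lemma exists_infinitesimal_transport {p : E₁ × E₂} (hp : p ∈ O) (ξ : E₁) :
    ∃ O' ⊆ O, IsOpen O' ∧ p ∈ O' ∧ ∃ (Z : E₁ × E₂ → E₁ × E₂) (y : ι → E₁ × E₂ → E₂)
      (β : ι → E₁ × E₂ → E₂ →L[ℝ] ℝ) (c : ι → ι → E₁ × E₂ → ℝ),
      ContDiffOn ℝ ∞ Z O' ∧ (∀ i, ContDiffOn ℝ ∞ (y i) O') ∧ (∀ i, ContDiffOn ℝ ∞ (β i) O') ∧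
      (∀ i j, ContinuousOn (c i j) O') ∧ (∀ q ∈ O', (Z q).1 = ξ) ∧
      (∀ q ∈ O', q.2 = 0 → (Z q).2 = 0) ∧
      (∀ q ∈ O', fibreStructure (S q) = Submodule.span ℝ (range fun i => (y i q, β i q))) ∧
      ∀ q ∈ O', ∀ i,
        fderiv ℝ (y i) q (Z q) = (fderiv ℝ Z q (0, y i q)).2 + ∑ j, c i j q • y j q ∧
        fderiv ℝ (β i) q (Z q) =
          -(β i q ∘L .snd ℝ E₁ E₂ ∘L fderiv ℝ Z q ∘L .inr ℝ E₁ E₂) + ∑ j, c i j q • β j q := by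
  classical
  let A : E₁ × E₂ → (ι → ℝ) →L[ℝ] (E₂ →L[ℝ] ℝ) × E₁ := fun q => fibreCoordinates E₁ E₂ ∘L ε q
  have hA : ContDiffOn ℝ ∞ A O := contDiffOn_const.clm_comp h.smooth
  obtain ⟨O', hO'O, hO', hpO', L, hL, hLA⟩ :=
    exists_smooth_leftInverse h.isOpen hp hA (h.fibreCoordinates_injective hp)
  have hε : ContDiffOn ℝ ∞ ε O' := h.smooth.mono hO'O
  have hA' : ContDiffOn ℝ ∞ A O' := hA.mono hO'O
  -- The smooth left inverse `L` reconstructs an element of the structure from its fibre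
  -- coordinates. Prescribing these coordinates smoothly thus gives smooth sections, as long as an
  -- element having them exists.
  have hrec : ∀ q ∈ O', ∀ e ∈ S q, ε q (L q (fibreCoordinates E₁ E₂ e)) = e := by
    intro q hq e he
    obtain ⟨c, rfl⟩ := (h.mem_iff q (hO'O hq) _).1 he
    exact congrArg (ε q) (hLA q hq c)
  have hmem : ∀ q ∈ O', ∀ c, ε q c ∈ S q := fun q hq c => (h.mem_iff q (hO'O hq) _).2 ⟨c, rfl⟩
  have hlift : ∀ q ∈ O', ∀ ζ : E₁, (ε q (L q (0, ζ))).1.1 = ζ ∧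
      (ε q (L q (0, ζ))).2 ∘L .inr ℝ E₁ E₂ = 0 := by
    intro q hq ζ
    obtain ⟨e, he, he1, he2⟩ := h.exists_lift q (hO'O hq) ζ
    have h1 := hrec q hq e he
    rw [fibreCoordinates_apply, he1, he2] at h1
    rw [h1]; exact ⟨he1, he2⟩
  let l : E₁ × E₂ → ι → ℝ := fun q => L q (0, ξ)
  have hl : ContDiffOn ℝ ∞ l O' := hL.clm_apply contDiffOn_const
  -- Subtracting the horizontal lift of the base component projects coefficient vectors onto those
  -- of sections with vertical vector part. Applied to the standard basis, it yields the generators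
  -- `b i` of the fibre structure, which may be linearly dependent.
  let κ : E₁ × E₂ → (ι → ℝ) → ι → ℝ := fun q c => c - L q (0, (A q c).2)
  have hκ : ∀ c, ContDiffOn ℝ ∞ (fun q => κ q c) O' := fun c =>
    contDiffOn_const.sub (hL.clm_apply (contDiffOn_const.prodMk
      (contDiff_snd.comp_contDiffOn (hA'.clm_apply contDiffOn_const))))
  let a : E₁ × E₂ → (E₁ × E₂) × (E₁ × E₂ →L[ℝ] ℝ) := fun q => ε q (l q)
  have ha : ContDiffOn ℝ ∞ a O' := hε.clm_apply hl
  let b : ι → E₁ × E₂ → (E₁ × E₂) × (E₁ × E₂ →L[ℝ] ℝ) := fun i q => ε q (κ q (Pi.single i 1))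
  have hb : ∀ i, ContDiffOn ℝ ∞ (b i) O' := fun i => hε.clm_apply (hκ _)
  have ha1 : ∀ q ∈ O', (a q).1.1 = ξ := fun q hq => (hlift q hq ξ).1
  have ha2 : ∀ q ∈ O', ∀ w, (a q).2 (0, w) = 0 := fun q hq w =>
    DFunLike.congr_fun (hlift q hq ξ).2 w
  have hb1 : ∀ i, ∀ q ∈ O', (b i q).1.1 = 0 := by
    intro i q hq
    have : (b i q).1.1 =
        (A q (Pi.single i 1)).2 - (ε q (L q (0, (A q (Pi.single i 1)).2))).1.1 := by
      simp only [b, κ, map_sub]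
      rfl
    rw [this, (hlift q hq _).1, sub_self]
  have hb1' : ∀ i, ∀ q ∈ O', (b i q).1 = (0, (b i q).1.2) := fun i q hq =>
    Prod.ext (hb1 i q hq) rfl
  -- The covector of the lift `a` kills the vertical vector of `b i`. Isotropy then makes the
  -- opposite pairing vanish as well, as the simplified bracket formula requires.
  have hab : ∀ i, ∀ q ∈ O', (a q).2 (b i q).1 = 0 := by
    intro i q hq
    rw [hb1' i q hq]; exact ha2 q hq _
  have hba : ∀ i, ∀ q ∈ O', (b i q).2 (a q).1 = 0 := by
    intro i q hq
    have := h.isotropic q (hO'O hq) _ (hmem q hq (l q)) _ (hmem q hq (κ q (Pi.single i 1)))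
    have h' := hab i q hq
    change (a q).2 (b i q).1 + (b i q).2 (a q).1 = 0 at this
    rwa [h', zero_add] at this
  have hsum : ∀ q ∈ O', ∀ c, (A q c).2 = 0 → ∑ i, c i • b i q = ε q c := by
    intro q hq c hc
    have h1 : ∑ i, c i • κ q (Pi.single i 1) = κ q c := by
      let κ' : (ι → ℝ) →ₗ[ℝ] ι → ℝ :=
        ((ContinuousLinearMap.id ℝ (ι → ℝ) - L q ∘L .inr ℝ _ E₁ ∘L .snd ℝ _ E₁ ∘L A q :
          (ι → ℝ) →L[ℝ] ι → ℝ) : (ι → ℝ) →ₗ[ℝ] ι → ℝ)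
      have h2 : ∀ c, κ' c = κ q c := fun c => rfl
      simp only [← h2, ← map_smul, ← map_sum]
      congr 1
      exact (pi_eq_sum_univ' c).symm
    have h3 : κ q c = c := by
      simp only [κ, hc]
      have : ((0 : E₂ →L[ℝ] ℝ), (0 : E₁)) = 0 := rfl
      rw [this, map_zero, sub_zero]
    simp only [b, ← map_smul, ← map_sum]
    rw [h1, h3]
  let Z : E₁ × E₂ → E₁ × E₂ := fun q => (a q).1
  let y : ι → E₁ × E₂ → E₂ := fun i q => (b i q).1.2
  let β : ι → E₁ × E₂ → E₂ →L[ℝ] ℝ := fun i q => (b i q).2 ∘L .inr ℝ E₁ E₂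
  have hZ : ContDiffOn ℝ ∞ Z O' := contDiff_fst.comp_contDiffOn ha
  have hb1s : ∀ i, ContDiffOn ℝ ∞ (fun q => (b i q).1) O' := fun i =>
    contDiff_fst.comp_contDiffOn (hb i)
  have hb2s : ∀ i, ContDiffOn ℝ ∞ (fun q => (b i q).2) O' := fun i =>
    contDiff_snd.comp_contDiffOn (hb i)
  have ha2s : ContDiffOn ℝ ∞ (fun q => (a q).2) O' := contDiff_snd.comp_contDiffOn ha
  have hy : ∀ i, ContDiffOn ℝ ∞ (y i) O' := fun i => contDiff_snd.comp_contDiffOn (hb1s i)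
  have hβ : ∀ i, ContDiffOn ℝ ∞ (β i) O' := fun i => (hb2s i).clm_comp contDiffOn_const
  -- This is $L_Z\beta_i$ along the fibres, the expected vertical covector part of the bracket of
  -- `a` with `b i`. Together with base component $0$ it determines the bracket, whose coefficients
  -- are therefore `C i`.
  let gen : ι → E₁ × E₂ → E₂ →L[ℝ] ℝ := fun i q => fderiv ℝ (β i) q (Z q) +
    β i q ∘L .snd ℝ E₁ E₂ ∘L fderiv ℝ Z q ∘L .inr ℝ E₁ E₂
  let C : ι → E₁ × E₂ → ι → ℝ := fun i q => L q (gen i q, 0)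
  have hgen : ∀ i, ContinuousOn (gen i) O' := fun i =>
    (((hβ i).continuousOn_fderiv_of_isOpen hO' (by simp)).clm_apply hZ.continuousOn).add
      ((hβ i).continuousOn.clm_comp (continuousOn_const.clm_comp
        ((hZ.continuousOn_fderiv_of_isOpen hO' (by simp)).clm_comp continuousOn_const)))
  have hC : ∀ i, ContinuousOn (C i) O' := fun i =>
    hL.continuousOn.clm_apply ((hgen i).prodMk continuousOn_const)
  refine ⟨O', hO'O, hO', hpO', Z, y, β, fun i j q => C i q j, hZ, hy, hβ,
    fun i j => (continuousOn_pi.1 (hC i)) j, ha1,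
    fun q hq hq2 => h.slice q (hO'O hq) hq2 _ (hmem q hq _), ?_, ?_⟩
  · intro q hq
    refine le_antisymm ?_ ?_
    · rintro ⟨u, β'⟩ ⟨α, hα, hα'⟩
      obtain ⟨c, hc⟩ := (h.mem_iff q (hO'O hq) _).1 hα
      have hc2 : (A q c).2 = 0 := by
        change (ε q c).1.1 = 0
        rw [hc]
      have h1 := hsum q hq c hc2
      rw [hc] at h1
      have h2 : (u, β') = ∑ i, c i • (y i q, β i q) := by
        refine Prod.ext ?_ ?_
        · have := congrArg (fun e => e.1.2) h1
          simpa [Prod.fst_sum, Prod.snd_sum, y] using this.symm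
        · have := congrArg (fun e => e.2 ∘L .inr ℝ E₁ E₂) h1
          change β' = α ∘L .inr ℝ E₁ E₂ at hα'
          rw [hα']
          ext w
          have := DFunLike.congr_fun this w
          simpa [Prod.snd_sum, β] using this.symm
      rw [h2]
      exact Submodule.sum_mem _ fun i _ =>
        Submodule.smul_mem _ _ (Submodule.subset_span ⟨i, rfl⟩)
    · rw [Submodule.span_le]
      rintro _ ⟨i, rfl⟩
      refine ⟨(b i q).2, ?_, rfl⟩
      have : ((0, y i q), (b i q).2) = b i q := Prod.ext (hb1' i q hq).symm rfl
      change ((0, y i q), (b i q).2) ∈ S q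
      rw [this]
      exact hmem q hq _
  · intro q hq i
    obtain ⟨γ, hγ, hγw⟩ := h.bracket O' hO'O hO' l (fun q => κ q (Pi.single i 1)) hl (hκ _)
      (hab i) (hba i) q hq
    change (fderiv ℝ (fun z => (b i z).1) q (Z q) - fderiv ℝ Z q (b i q).1, γ) ∈ S q at hγ
    change ∀ w, γ w = fderiv ℝ (fun z => (b i z).2) q (Z q) w -
      fderiv ℝ (fun z => (b i z).2) q w (Z q) -
        (fderiv ℝ (fun z => (a z).2) q (b i q).1 w - fderiv ℝ (fun z => (a z).2) q w (b i q).1)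
      at hγw
    have hDb1 := hasFDerivAt_of_contDiffOn (hb1s i) hO' hq
    have hDb2 := hasFDerivAt_of_contDiffOn (hb2s i) hO' hq
    have hDa2 := hasFDerivAt_of_contDiffOn ha2s hO' hq
    have hDZ := hasFDerivAt_of_contDiffOn hZ hO' hq
    have hZ1 : ∀ v, (fderiv ℝ Z q v).1 = 0 := fun v =>
      DFunLike.congr_fun (hasFDerivAt_eq_zero_of_eqOn_const hO' hq ha1 hDZ.fst) v
    have hb11 : ∀ v, (fderiv ℝ (fun z => (b i z).1) q v).1 = 0 := fun v =>
      DFunLike.congr_fun (hasFDerivAt_eq_zero_of_eqOn_const hO' hq (hb1 i) hDb1.fst) v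
    have hyD : fderiv ℝ (y i) q = .snd ℝ E₁ E₂ ∘L fderiv ℝ (fun z => (b i z).1) q :=
      hDb1.snd.fderiv
    have hβD : ∀ v w, fderiv ℝ (β i) q v w = fderiv ℝ (fun z => (b i z).2) q v (0, w) := by
      intro v w
      have h1 : HasFDerivAt (β i) _ q := hDb2.clm_comp (hasFDerivAt_const _ q)
      rw [h1.fderiv]
      simp
    -- The covector of `a` vanishes identically on vertical vectors, so its exterior derivative is
    -- zero on pairs of vertical vectors.
    have ha2D : ∀ v w, fderiv ℝ (fun z => (a z).2) q v (0, w) = 0 := by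
      intro v w
      have h1 := hasFDerivAt_eq_zero_of_eqOn_const hO' hq (fun z hz => ha2 z hz w)
        (hDa2.clm_apply (hasFDerivAt_const (0, w) q))
      simpa using DFunLike.congr_fun h1 v
    -- Differentiating $b_i(Z)=0$ exchanges the derivative of the form for that of `Z`; this turns
    -- $i_Z db_i$ into the Lie derivative.
    have hbaD : ∀ v, fderiv ℝ (fun z => (b i z).2) q v (Z q) = -(b i q).2 (fderiv ℝ Z q v) := by
      intro v
      have h1 := hasFDerivAt_eq_zero_of_eqOn_const hO' hq (hba i) (hDb2.clm_apply hDZ)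
      have h2 := DFunLike.congr_fun h1 v
      simp only [add_apply, ContinuousLinearMap.comp_apply, ContinuousLinearMap.flip_apply,
        zero_apply] at h2
      linarith
    have hγ' : γ ∘L .inr ℝ E₁ E₂ = gen i q := by
      ext w
      have h1 := hγw (0, w)
      rw [hb1' i q hq, ha2D, ha2D, hbaD] at h1
      have h2 : fderiv ℝ Z q (0, w) = (0, (fderiv ℝ Z q (0, w)).2) := Prod.ext (hZ1 _) rfl
      change γ (0, w) = fderiv ℝ (β i) q (Z q) w + (b i q).2 (0, (fderiv ℝ Z q (0, w)).2)
      rw [← h2, hβD, h1]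
      ring
    let W : E₁ × E₂ := fderiv ℝ (fun z => (b i z).1) q (Z q) - fderiv ℝ Z q (b i q).1
    have hW1 : W.1 = 0 := by
      change (fderiv ℝ (fun z => (b i z).1) q (Z q)).1 - (fderiv ℝ Z q (b i q).1).1 = 0
      rw [hZ1, hb11, sub_zero]
    have hεC : ε q (C i q) = (W, γ) := by
      have := hrec q hq (W, γ) hγ
      rw [fibreCoordinates_apply] at this
      change ε q (L q (γ ∘L .inr ℝ E₁ E₂, W.1)) = _ at this
      rw [hγ', hW1] at this
      exact this
    have hAC : (A q (C i q)).2 = 0 := by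
      change (ε q (C i q)).1.1 = 0
      rw [hεC]; exact hW1
    have hs := hsum q hq _ hAC
    rw [hεC] at hs
    constructor
    · have h1 := congrArg (fun e => e.1.2) hs
      have h2 : ∑ j, C i q j • y j q = W.2 := by
        simpa [Prod.fst_sum, Prod.snd_sum, y] using h1
      rw [h2, hyD]
      have h3 : (0, y i q) = (b i q).1 := (hb1' i q hq).symm
      rw [h3]
      simp [W]
    · have h1 := congrArg (fun e => e.2 ∘L .inr ℝ E₁ E₂) hs
      have h2 : ∑ j, C i q j • β j q = gen i q := by
        rw [← hγ']
        ext w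
        have := DFunLike.congr_fun h1 w
        simpa [Prod.snd_sum, β] using this
      rw [h2]
      simp [gen]

end IsDecomposableFrame

end FibreTransport

/-! ### The flow of a horizontal lift as an equivalence of fibres. -/

section FibreFlow

open Set

variable {E₁ E₂ : Type*} [NormedAddCommGroup E₁] [NormedSpace ℝ E₁] [FiniteDimensional ℝ E₁]
  [NormedAddCommGroup E₂] [NormedSpace ℝ E₂] [FiniteDimensional ℝ E₂]
  {ι : Type*} [Fintype ι]
  {S : E₁ × E₂ → Submodule ℝ ((E₁ × E₂) × (E₁ × E₂ →L[ℝ] ℝ))} {O : Set (E₁ × E₂)}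
  {ε : E₁ × E₂ → (ι → ℝ) →L[ℝ] (E₁ × E₂) × (E₁ × E₂ →L[ℝ] ℝ)}

lemma eqOn_Icc_of_hasDerivWithinAt_smul {F : Type*} [NormedAddCommGroup F] [NormedSpace ℝ F]
    {Z : F → F} {K : NNReal} {U : Set F} (hZ : LipschitzOnWith K Z U) {t : ℝ} {f g : ℝ → F}
    (hf : ∀ s ∈ Icc (0 : ℝ) 1, HasDerivWithinAt f (t • Z (f s)) (Icc 0 1) s)
    (hg : ∀ s ∈ Icc (0 : ℝ) 1, HasDerivWithinAt g (t • Z (g s)) (Icc 0 1) s)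
    (hfU : ∀ s ∈ Icc (0 : ℝ) 1, f s ∈ U) (hgU : ∀ s ∈ Icc (0 : ℝ) 1, g s ∈ U) (h : f 0 = g 0) :
    EqOn f g (Icc 0 1) := by
  have hL : LipschitzOnWith (‖t‖₊ * K) (fun x => t • Z x) U :=
    LipschitzOnWith.of_dist_le_mul fun x hx y hy => by
      rw [dist_smul₀, NNReal.coe_mul, mul_assoc, coe_nnnorm]
      exact mul_le_mul_of_nonneg_left (hZ.dist_le_mul x hx y hy) (norm_nonneg _)
  refine ODE_solution_unique_of_mem_Icc_right (v := fun _ x => t • Z x) (s := fun _ => U)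
    (fun _ _ => hL) (fun s hs => (hf s hs).continuousWithinAt) (fun s hs => ?_)
    (fun s hs => hfU s (Ico_subset_Icc_self hs))
    (fun s hs => (hg s hs).continuousWithinAt) (fun s hs => ?_)
    (fun s hs => hgU s (Ico_subset_Icc_self hs)) h
  · exact (hf s (Ico_subset_Icc_self hs)).mono_of_mem_nhdsWithin (Icc_mem_nhdsGE_of_mem hs)
  · exact (hg s (Ico_subset_Icc_self hs)).mono_of_mem_nhdsWithin (Icc_mem_nhdsGE_of_mem hs)

omit [FiniteDimensional ℝ E₁] [FiniteDimensional ℝ E₂] in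
lemma fst_eq_of_hasDerivWithinAt {f : ℝ → E₁ × E₂} {f' : ℝ → E₁ × E₂} {η : E₁}
    (hf : ∀ s ∈ Icc (0 : ℝ) 1, HasDerivWithinAt f (f' s) (Icc 0 1) s)
    (hf' : ∀ s ∈ Icc (0 : ℝ) 1, (f' s).1 = η) :
    ∀ s ∈ Icc (0 : ℝ) 1, (f s).1 = (f 0).1 + s • η := by
  have h : ∀ s ∈ Icc (0 : ℝ) 1, HasDerivWithinAt (fun s => (f s).1 - ((f 0).1 + s • η))
      ((0 : E₁ →L[ℝ] E₁) ((f s).1 - ((f 0).1 + s • η))) (Icc 0 1) s := by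
    intro s hs
    have h1 : HasDerivWithinAt (fun s => (f s).1) (f' s).1 (Icc 0 1) s :=
      (hasFDerivAt_fst (𝕜 := ℝ) (p := f s)).comp_hasDerivWithinAt s (hf s hs)
    have h2 : HasDerivWithinAt (fun s : ℝ => (f 0).1 + s • η) ((1 : ℝ) • η) (Icc 0 1) s :=
      ((hasDerivWithinAt_id s _).smul_const η).const_add _
    refine (h1.sub h2).congr_deriv ?_
    rw [hf' s hs, one_smul, sub_self, zero_apply]
  intro s hs
  have := eqOn_zero_of_hasDerivWithinAt_linear
    (z := fun s => (f s).1 - ((f 0).1 + s • η)) (A := fun _ => (0 : E₁ →L[ℝ] E₁))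
    continuousOn_const h (Or.inl (by simp)) hs
  exact sub_eq_zero.1 this

/-- The fibres of a decomposable structure over nearby points of the base are equivalent. -/
theorem IsDecomposableFrame.exists_fibre_transport (h : IsDecomposableFrame S O ε) {x₀ : E₁}
    (hp : (x₀, (0 : E₂)) ∈ O) (ξ : E₁) :
    ∃ δ > 0, ∀ t : ℝ, |t| < δ → ∃ Φ : OpenPartialHomeomorph E₂ E₂, (0 : E₂) ∈ Φ.source ∧ Φ 0 = 0 ∧
      ContDiffOn ℝ ∞ Φ Φ.source ∧ ContDiffOn ℝ ∞ Φ.symm Φ.target ∧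
      ∀ w ∈ Φ.source, (x₀, w) ∈ O ∧ (x₀ + t • ξ, Φ w) ∈ O ∧ ∀ u β,
        ((u, β) ∈ fibreStructure (S (x₀, w)) ↔
          ∃ β', (fderiv ℝ Φ w u, β') ∈ fibreStructure (S (x₀ + t • ξ, Φ w)) ∧
            β = β' ∘L fderiv ℝ Φ w) := by
  have : CompleteSpace E₂ := FiniteDimensional.complete ℝ E₂
  obtain ⟨O', hO'O, hO', hpO', Z, y, b, c, hZ, hy, hb, hc, hZ1, hZ2, hspan, hder⟩ :=
    h.exists_infinitesimal_transport hp ξ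
  -- A Lipschitz bound for `Z` near the point gives the uniqueness by which the slice is seen to be
  -- invariant.
  obtain ⟨K, N, hN, hKN⟩ := ((hZ.contDiffAt (hO'.mem_nhds hpO')).of_le
    (by simp : (1 : WithTop ℕ∞) ≤ ∞)).exists_lipschitzOnWith
  have hU : IsOpen (O' ∩ interior N) := hO'.inter isOpen_interior
  have hpU : (x₀, (0 : E₂)) ∈ O' ∩ interior N := ⟨hpO', mem_interior_iff_mem_nhds.2 hN⟩
  have hKU : LipschitzOnWith K Z (O' ∩ interior N) :=
    hKN.mono (inter_subset_right.trans interior_subset)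
  obtain ⟨W, Ψ, hW, hpW, hΨ, hΨU, hΨ0, hΨd, hΨv⟩ :=
    exists_local_flow hU hpU (hZ.mono inter_subset_left)
  have hnear : ∀ᶠ t : ℝ in 𝓝 0, (t, (x₀, (0 : E₂))) ∈ W ∧
      (x₀ + t • ξ, (0 : E₂)) ∈ O' ∩ interior N := by
    refine Filter.Eventually.and ?_ ?_
    · exact (Continuous.prodMk_left _).continuousAt.eventually (hW.mem_nhds hpW)
    · have hcont : Continuous fun t : ℝ => (x₀ + t • ξ, (0 : E₂)) := by fun_prop
      exact hcont.continuousAt.eventually (hU.mem_nhds (by simpa using hpU))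
  obtain ⟨δ, hδ, hδt⟩ := Metric.eventually_nhds_iff.1 hnear
  refine ⟨δ, hδ, fun t ht => ?_⟩
  have htW := (hδt (by simpa using ht)).1
  let i : E₂ → ℝ × (E₁ × E₂) := fun w => (t, (x₀, w))
  have hi : ContDiff ℝ ∞ i := contDiff_const.prodMk (contDiff_const.prodMk contDiff_id)
  have hV : IsOpen (i ⁻¹' W) := hW.preimage hi.continuous
  have hΨ1 : ∀ w, i w ∈ W → ∀ s ∈ Icc (0 : ℝ) 1, (Ψ s (i w)).1 = x₀ + s • t • ξ := by
    intro w hw s hs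
    have := fst_eq_of_hasDerivWithinAt (hΨd _ hw) (η := t • ξ)
      (fun s _ => congrArg (t • ·) (hZ1 _ (hΨU s _ hw).1)) s hs
    rw [this, hΨ0 _ hw]
  -- The base component of `Z` is the constant $\xi$, so the flow takes the whole fibre over $x_0$
  -- to the fibre over $x_0+t\xi$; `ψ` records the vertical coordinate.
  let ψ : E₂ → E₂ := fun w => (Ψ 1 (i w)).2
  have hψs : ContDiffOn ℝ ∞ ψ (i ⁻¹' W) :=
    contDiff_snd.comp_contDiffOn ((hΨ 1).comp hi.contDiffOn fun _ h => h)
  have h1I : (1 : ℝ) ∈ Icc (0 : ℝ) 1 := by simp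
  have hψ0 : ψ 0 = 0 := by
    -- The straight segment in the slice is itself an integral curve, since `Z` has no vertical part
    -- there; by uniqueness it is the trajectory of $(x_0,0)$.
    have hslice : ∀ s ∈ Icc (0 : ℝ) 1, (x₀ + s • t • ξ, (0 : E₂)) ∈ O' ∩ interior N := by
      intro s hs
      rw [smul_smul]
      refine (hδt ?_).2
      rw [dist_zero_right, norm_mul, Real.norm_of_nonneg hs.1]
      exact (mul_le_of_le_one_left (norm_nonneg t) hs.2).trans_lt ht
    have := eqOn_Icc_of_hasDerivWithinAt_smul hKU (hΨd _ htW) (fun s hs => ?_)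
      (fun s _ => hΨU s _ htW) hslice (by simpa using hΨ0 _ htW) h1I
    · exact congrArg Prod.snd this
    · have h1 : HasDerivWithinAt (fun s : ℝ => x₀ + s • t • ξ) ((1 : ℝ) • t • ξ) (Icc 0 1) s :=
        ((hasDerivWithinAt_id s _).smul_const _).const_add _
      refine (h1.prodMk (hasDerivWithinAt_const s _ (0 : E₂))).congr_deriv ?_
      refine Prod.ext ?_ ?_
      · change (1 : ℝ) • t • ξ = t • (Z _).1
        rw [hZ1 _ (hslice s hs).1, one_smul]
      · change 0 = t • (Z _).2
        rw [hZ2 _ (hslice s hs).1 rfl, smul_zero]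
  have key : ∀ w, i w ∈ W → (∃ B₁ : E₂ ≃L[ℝ] E₂, (B₁ : E₂ →L[ℝ] E₂) = fderiv ℝ ψ w) ∧
      ∀ u β, ((u, β) ∈ fibreStructure (S (x₀, w)) ↔
          ∃ β', (fderiv ℝ ψ w u, β') ∈ fibreStructure (S (x₀ + t • ξ, ψ w)) ∧
            β = β' ∘L fderiv ℝ ψ w) := by
    intro w hw
    let D : ℝ → E₂ →L[ℝ] E₁ × E₂ := fun s =>
      fderiv ℝ (Ψ s) (i w) ∘L .inr ℝ ℝ (E₁ × E₂) ∘L .inr ℝ E₁ E₂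
    let B : ℝ → E₂ →L[ℝ] E₂ := fun s => .snd ℝ E₁ E₂ ∘L D s
    let A : ℝ → E₂ →L[ℝ] E₂ := fun s =>
      t • (.snd ℝ E₁ E₂ ∘L fderiv ℝ Z (Ψ s (i w)) ∘L .inr ℝ E₁ E₂)
    have hcurve : ContinuousOn (fun s => Ψ s (i w)) (Icc 0 1) :=
      fun s hs => (hΨd _ hw s hs).continuousWithinAt
    have hcO : MapsTo (fun s => Ψ s (i w)) (Icc 0 1) O' := fun s _ => (hΨU s _ hw).1
    have hA : ContinuousOn A (Icc 0 1) := by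
      have h1 : ContinuousOn (fun s => fderiv ℝ Z (Ψ s (i w))) (Icc 0 1) :=
        (hZ.continuousOn_fderiv_of_isOpen hO' (by simp)).comp hcurve hcO
      exact (continuousOn_const.clm_comp (h1.clm_comp continuousOn_const)).const_smul t
    have hZD : ∀ q ∈ O', ∀ v, (fderiv ℝ Z q v).1 = 0 := fun q hq v =>
      DFunLike.congr_fun (hasFDerivAt_eq_zero_of_eqOn_const hO' hq hZ1
        (hasFDerivAt_of_contDiffOn hZ hO' hq).fst) v
    have hDd : ∀ v, ∀ s ∈ Icc (0 : ℝ) 1, HasDerivWithinAt (fun s => D s v)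
        (t • fderiv ℝ Z (Ψ s (i w)) (D s v)) (Icc 0 1) s := fun v => (hΨv _ hw (0, v)).2
    -- The linearized flow keeps vertical vectors vertical, because the base component of `Z` is
    -- constant. The variational equation therefore restricts to the fibre.
    have hD1 : ∀ v, ∀ s ∈ Icc (0 : ℝ) 1, D s v = (0, B s v) := by
      intro v s hs
      have h1 := fst_eq_of_hasDerivWithinAt (hDd v) (η := 0) (fun s hs => by
        change t • (fderiv ℝ Z (Ψ s (i w)) (D s v)).1 = 0
        rw [hZD _ (hcO hs), smul_zero]) s hs
      have h0 : D 0 v = (0, v) := (hΨv _ hw (0, v)).1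
      rw [h0, smul_zero, add_zero] at h1
      exact Prod.ext h1 rfl
    have hB₀ : B 0 = .id ℝ E₂ := by
      ext v
      exact congrArg Prod.snd (hΨv _ hw (0, v)).1
    have hB : ∀ v, ∀ s ∈ Icc (0 : ℝ) 1,
        HasDerivWithinAt (fun s => B s v) (A s (B s v)) (Icc 0 1) s := by
      intro v s hs
      have h1 : HasDerivWithinAt (fun s => (D s v).2) _ (Icc 0 1) s :=
        (hasFDerivAt_snd (𝕜 := ℝ) (p := D s v)).comp_hasDerivWithinAt s (hDd v s hs)
      refine h1.congr_deriv ?_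
      rw [hD1 v s hs]
      rfl
    have hyd : ∀ j, ∀ s ∈ Icc (0 : ℝ) 1, HasDerivWithinAt (fun s => y j (Ψ s (i w)))
        (A s (y j (Ψ s (i w))) + ∑ l, (t * c j l (Ψ s (i w))) • y l (Ψ s (i w))) (Icc 0 1) s := by
      intro j s hs
      have h1 := (hasFDerivAt_of_contDiffOn (hy j) hO' (hcO hs)).comp_hasDerivWithinAt s
        (hΨd _ hw s hs)
      refine h1.congr_deriv ?_
      change fderiv ℝ (y j) (Ψ s (i w)) (t • Z (Ψ s (i w))) = _
      rw [map_smul, (hder _ (hcO hs) j).1, smul_add, Finset.smul_sum]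
      simp only [smul_smul]
      rfl
    have hbd : ∀ j, ∀ s ∈ Icc (0 : ℝ) 1, HasDerivWithinAt (fun s => b j (Ψ s (i w)))
        (-(b j (Ψ s (i w)) ∘L A s) + ∑ l, (t * c j l (Ψ s (i w))) • b l (Ψ s (i w)))
        (Icc 0 1) s := by
      intro j s hs
      have h1 := (hasFDerivAt_of_contDiffOn (hb j) hO' (hcO hs)).comp_hasDerivWithinAt s
        (hΨd _ hw s hs)
      refine h1.congr_deriv ?_
      change fderiv ℝ (b j) (Ψ s (i w)) (t • Z (Ψ s (i w))) = _
      rw [map_smul, (hder _ (hcO hs) j).2, smul_add, Finset.smul_sum, smul_neg,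
        ContinuousLinearMap.comp_smul]
      simp only [smul_smul]
    have hcc : ∀ j l, ContinuousOn (fun s => t * c j l (Ψ s (i w))) (Icc 0 1) := fun j l =>
      continuousOn_const.mul ((hc j l).comp hcurve hcO)
    have hψD : fderiv ℝ ψ w = B 1 := by
      have h1 : HasFDerivAt i ((0 : E₂ →L[ℝ] ℝ).prod ((0 : E₂ →L[ℝ] E₁).prod (.id ℝ E₂))) w :=
        ((hasFDerivAt_const t w).prodMk ((hasFDerivAt_const x₀ w).prodMk (hasFDerivAt_id w)))
      have h2 := ((hasFDerivAt_of_contDiffOn (hΨ 1) hW hw).comp w h1).snd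
      exact h2.fderiv
    have hend : Ψ 1 (i w) = (x₀ + t • ξ, ψ w) := by
      refine Prod.ext ?_ rfl
      rw [hΨ1 w hw 1 h1I, one_smul]
    have hstart : Ψ 0 (i w) = (x₀, w) := hΨ0 _ hw
    obtain ⟨hB1, hiff⟩ := mem_span_transport_iff hA hcc hB₀ hB hyd hbd
    rw [hψD]
    refine ⟨hB1, fun u β => ?_⟩
    have h0 := hspan _ (hcO (left_mem_Icc.2 zero_le_one))
    have h1 := hspan _ (hcO (right_mem_Icc.2 zero_le_one))
    simp only [hstart] at h0
    simp only [hend] at h1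
    rw [h0, h1]
    simpa only [hstart, hend] using hiff u β
  -- Linear transport also yields invertibility of the derivative at $0$, so `ψ` is a local
  -- diffeomorphism for every admissible `t`.
  obtain ⟨B₁, hB₁⟩ := (key 0 htW).1
  obtain ⟨Φ, h0Φ, hΦ, hΦV, hΦs, hΦs'⟩ := exists_openPartialHomeomorph_of_hasFDerivAt (f := ψ)
    (f' := B₁) (hV.mem_nhds htW) (fun w hw => hψs.contDiffAt (hV.mem_nhds hw))
    (by rw [hB₁]; exact hasFDerivAt_of_contDiffOn hψs hV htW)
  refine ⟨Φ, h0Φ, by rw [hΦ, hψ0], hΦs, hΦs', fun w hw => ?_⟩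
  have hwW := hΦV hw
  rw [hΦ]
  refine ⟨hO'O ?_, hO'O ?_, (key w hwW).2⟩
  · have := (hΨU 0 _ hwW).1
    rwa [hΨ0 _ hwW] at this
  · have := (hΨU 1 _ hwW).1
    have h1 : Ψ 1 (i w) = (x₀ + t • ξ, ψ w) := by
      refine Prod.ext ?_ rfl
      rw [hΨ1 w hwW 1 h1I, one_smul]
    rwa [h1] at this

end FibreFlow

/-! ### Decomposable frames from tubular neighbourhoods. -/

section TubularFrame

open Set

variable {m : ℕ} {M : Type*} [TopologicalSpace M] [ChartedSpace (EuclideanSpace ℝ (Fin m)) M]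
  {F : Type*} [NormedAddCommGroup F] [NormedSpace ℝ F]

/-- The coordinate expression of an element of the big tangent bundle. -/
def ofBigTangent (m : ℕ) {M : Type*} [TopologicalSpace M]
    [ChartedSpace (EuclideanSpace ℝ (Fin m)) M]
    {F : Type*} [NormedAddCommGroup F] [NormedSpace ℝ F] (φ : OpenPartialHomeomorph M F) (q : F) :
    BigTangent m (φ.symm q) →ₗ[ℝ] F × (F →L[ℝ] ℝ) where
  toFun e := (dchart m φ (φ.symm q) e.1, e.2.comp (dchartSymm m φ q))
  map_add' _ _ := Prod.ext (map_add _ _ _) (ContinuousLinearMap.add_comp _ _ _)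
  map_smul' _ _ := Prod.ext (map_smul _ _ _) (ContinuousLinearMap.ext fun _ => rfl)

namespace IsSmoothChart

variable {φ : OpenPartialHomeomorph M F} (hφ : IsSmoothChart m φ)
  {E : ∀ x : M, Submodule ℝ (BigTangent m x)}
include hφ

lemma ofBigTangent_toBigTangent {q : F} (hq : q ∈ φ.target) (e : F × (F →L[ℝ] ℝ)) :
    ofBigTangent m φ q (toBigTangent m φ q e) = e :=
  Prod.ext (hφ.dchart_dchartSymm hq _) (ContinuousLinearMap.ext fun v =>
    congrArg e.2 (hφ.dchart_dchartSymm hq v))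

lemma toBigTangent_ofBigTangent {q : F} (hq : q ∈ φ.target) (e : BigTangent m (φ.symm q)) :
    toBigTangent m φ q (ofBigTangent m φ q e) = e :=
  Prod.ext (hφ.dchartSymm_dchart hq _) (ContinuousLinearMap.ext fun v =>
    congrArg e.2 (hφ.dchartSymm_dchart hq v))

end IsSmoothChart

/-- The frame, in coordinates, given by sections of the big tangent bundle. -/
def coordFrame {k : ℕ} (φ : OpenPartialHomeomorph M F) (e : Fin k → ∀ x : M, BigTangent m x)
    (q : F) : (Fin k → ℝ) →L[ℝ] F × (F →L[ℝ] ℝ) :=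
  ∑ i, (ContinuousLinearMap.proj i : (Fin k → ℝ) →L[ℝ] ℝ).smulRight
    (ofBigTangent m φ q (e i (φ.symm q)))

lemma coordFrame_apply {k : ℕ} (φ : OpenPartialHomeomorph M F)
    (e : Fin k → ∀ x : M, BigTangent m x) (q : F) (c : Fin k → ℝ) :
    coordFrame φ e q c = ofBigTangent m φ q (∑ i, c i • e i (φ.symm q)) := by
  simp only [coordFrame, map_sum, map_smul, sum_apply,
    ContinuousLinearMap.smulRight_apply, ContinuousLinearMap.proj_apply]

namespace TubularNbhd

variable {E : ∀ x : M, Submodule ℝ (BigTangent m x)} {r s : ℕ} (T : TubularNbhd E r s)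

lemma isSmoothChart : IsSmoothChart m T.chart := ⟨T.smooth_chart, T.smooth_symm⟩

lemma mem_fibreTangent {y : M} (hy : y ∈ T.chart.source) (v : TangentSpace (𝓡 m) y) :
    v ∈ T.fibreTangent y ↔ (dchart m T.chart y v).1 = 0 := by
  have h1 := ((T.isSmoothChart.contMDiffAt hy).mdifferentiableAt (by simp)).hasMFDerivAt
  have h2 := (hasFDerivAt_fst (𝕜 := ℝ) (p := T.chart y)).hasMFDerivAt.comp y h1
  have h3 : mfderiv (𝓡 m) 𝓘(ℝ, EuclideanSpace ℝ (Fin r)) (fun z => (T.chart z).1) y =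
    (ContinuousLinearMap.fst ℝ _ _).comp (dchart m T.chart y) := h2.mfderiv
  rw [fibreTangent, h3]
  exact Iff.rfl

lemma mem_charDistribution {y : M} (hy : y ∈ T.slice) (v : TangentSpace (𝓡 m) y) :
    v ∈ charDistribution E y ↔ (dchart m T.chart y v).2 = 0 := by
  have h1 := ((T.isSmoothChart.contMDiffAt hy.1).mdifferentiableAt (by simp)).hasMFDerivAt
  have h2 := (hasFDerivAt_snd (𝕜 := ℝ) (p := T.chart y)).hasMFDerivAt.comp y h1
  have h3 : mfderiv (𝓡 m) 𝓘(ℝ, EuclideanSpace ℝ (Fin s)) (fun z => (T.chart z).2) y =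
    (ContinuousLinearMap.snd ℝ _ _).comp (dchart m T.chart y) := h2.mfderiv
  rw [← T.tangent_slice y hy.1 hy.2, h3]
  exact Iff.rfl

/-- In the coordinates of a tubular neighbourhood, a decomposable structure has a decomposable
frame. -/
theorem exists_isDecomposableFrame [T2Space M] [IsManifold (𝓡 m) ∞ M] {k : ℕ}
    (hE : IsBigIsotropic k E) (hint : IsIntegrable E)
    {p : EuclideanSpace ℝ (Fin r) × EuclideanSpace ℝ (Fin s)} (hp : p ∈ T.chart.target)
    (hdec : ∀ᶠ y in 𝓝 (T.chart.symm p), T.DecomposesAt y) :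
    ∃ O ⊆ T.chart.target, p ∈ O ∧ ∃ ε, IsDecomposableFrame (ι := Fin k)
      (coordStructure T.chart E) O ε := by
  have hφ := T.isSmoothChart
  obtain ⟨U₁, hU₁, hpU₁, e, he, hspan⟩ := hE.1 (T.chart.symm p)
  obtain ⟨U₂, hdecU, hU₂, hpU₂⟩ := eventually_nhds_iff.1 hdec
  have hU : IsOpen (U₁ ∩ U₂) := hU₁.inter hU₂
  -- Combinations of the frame in coordinates are expressions of sections on the manifold, with
  -- coefficients composed with the chart. This lets the bracket condition on the manifold be
  -- applied to them.
  have hvec : ∀ (c : EuclideanSpace ℝ (Fin r) × EuclideanSpace ℝ (Fin s) → Fin k → ℝ),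
      ∀ q ∈ T.chart.target,
      coordFrame T.chart e q (c q) =
        (coordVec T.chart (fun y => (∑ i, c (T.chart y) i • e i y).1) q,
        coordForm T.chart (fun y => (∑ i, c (T.chart y) i • e i y).2) q) := by
    intro c q hq
    rw [coordFrame_apply]
    have : (∑ i, c q i • e i (T.chart.symm q)) =
        ∑ i, c (T.chart (T.chart.symm q)) i • e i (T.chart.symm q) := by
      rw [T.chart.right_inv hq]
    rw [this]
    rfl
  refine ⟨T.chart.target ∩ T.chart.symm ⁻¹' (U₁ ∩ U₂), inter_subset_left,
    ⟨hp, hpU₁, hpU₂⟩, coordFrame T.chart e, ?_⟩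
  refine ⟨T.chart.isOpen_inter_preimage_symm hU, ?_, ?_, ?_, ?_, ?_, ?_, ?_, ?_⟩
  · intro q hq
    refine (contDiffAt_clm_of_apply fun c => ?_).contDiffWithinAt
    have h1 : ∀ i, ContDiffAt ℝ ∞ (fun q => (coordVec T.chart (fun y => (e i y).1) q,
        coordForm T.chart (fun y => (e i y).2) q)) q := fun i =>
      (hφ.contDiffAt_coordVec hq.1 ((he i).1.contMDiffAt (hU₁.mem_nhds hq.2.1))).prodMk
        (hφ.contDiffAt_coordForm hq.1 ((he i).2.contMDiffAt (hU₁.mem_nhds hq.2.1)))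
    have h2 : (fun q => coordFrame T.chart e q c) = fun q => ∑ i, c i •
        (coordVec T.chart (fun y => (e i y).1) q, coordForm T.chart (fun y => (e i y).2) q) := by
      funext q
      rw [coordFrame_apply, map_sum]
      exact Finset.sum_congr rfl fun i _ => map_smul _ _ _
    rw [h2]
    exact ContDiffAt.sum fun i _ => (h1 i).const_smul (c i)
  · intro q hq
    rw [injective_iff_map_eq_zero]
    intro c hc
    rw [coordFrame_apply] at hc
    have h1 := congrArg (toBigTangent m T.chart q) hc
    rw [hφ.toBigTangent_ofBigTangent hq.1, map_zero] at h1
    exact funext (Fintype.linearIndependent_iff.1 (hspan _ hq.2.1).1 c h1)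
  · intro q hq v
    have h1 : v ∈ coordStructure T.chart E q ↔
        toBigTangent m T.chart q v ∈ E (T.chart.symm q) := Iff.rfl
    rw [h1, ← (hspan _ hq.2.1).2, Submodule.mem_span_range_iff_exists_fun]
    refine exists_congr fun c => ?_
    rw [coordFrame_apply]
    exact ⟨fun h => by rw [h, hφ.ofBigTangent_toBigTangent hq.1],
      fun h => by rw [← h, hφ.toBigTangent_ofBigTangent hq.1]⟩
  · intro O' hO'O hO' c c' hc hc' h0 h0' q hq
    have hO'' : IsOpen (T.chart.source ∩ T.chart ⁻¹' O') := T.chart.isOpen_inter_preimage hO'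
    have hUy : ∀ y ∈ T.chart.source ∩ T.chart ⁻¹' O', y ∈ U₁ := by
      intro y hy
      have := (hO'O hy.2).2.1
      rwa [T.chart.left_inv hy.1] at this
    have hsm : ∀ c : EuclideanSpace ℝ (Fin r) × EuclideanSpace ℝ (Fin s) → Fin k → ℝ,
        ContDiffOn ℝ ∞ c O' → SmoothSectionOn (fun y => ∑ i, c (T.chart y) i • e i y)
          (T.chart.source ∩ T.chart ⁻¹' O') := by
      intro c hc
      have hci : ∀ i, ContMDiffOn (𝓡 m) 𝓘(ℝ, ℝ) ∞ (fun y => c (T.chart y) i)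
          (T.chart.source ∩ T.chart ⁻¹' O') := fun i =>
        ((contDiffOn_pi.1 hc i).contMDiffOn).comp (T.smooth_chart.mono inter_subset_left)
          fun y hy => hy.2
      constructor
      · have h1 := ContMDiffOn.sum_section (s := Finset.univ) (fun i _ =>
          (hci i).smul_section ((he i).1.mono hUy))
        refine h1.congr fun y hy => ?_
        exact congrArg (Bundle.TotalSpace.mk y) Prod.fst_sum
      · have h1 := ContMDiffOn.sum_section (s := Finset.univ) (fun i _ =>
          (hci i).smul_section ((he i).2.mono hUy))
        refine h1.congr fun y hy => ?_
        exact congrArg (Bundle.TotalSpace.mk y) Prod.snd_sum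
    have hmemE : ∀ c : EuclideanSpace ℝ (Fin r) × EuclideanSpace ℝ (Fin s) → Fin k → ℝ,
        ∀ y ∈ T.chart.source ∩ T.chart ⁻¹' O', (∑ i, c (T.chart y) i • e i y) ∈ E y := by
      intro c y hy
      rw [← (hspan y (hUy y hy)).2]
      exact Submodule.sum_mem _ fun i _ => Submodule.smul_mem _ _ (Submodule.subset_span ⟨i, rfl⟩)
    have hpair : ∀ c c' : EuclideanSpace ℝ (Fin r) × EuclideanSpace ℝ (Fin s) → Fin k → ℝ,
        (∀ q ∈ O', (coordFrame T.chart e q (c q)).2 (coordFrame T.chart e q (c' q)).1 = 0) →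
        ∀ y ∈ T.chart.source ∩ T.chart ⁻¹' O',
          (∑ i, c (T.chart y) i • e i y).2 (∑ i, c' (T.chart y) i • e i y).1 = 0 := by
      intro c c' h y hy
      have h1 := h _ hy.2
      rw [hvec c _ (T.chart.map_source hy.1), hvec c' _ (T.chart.map_source hy.1)] at h1
      have h2 : (∑ i, c (T.chart (T.chart.symm (T.chart y))) i • e i (T.chart.symm (T.chart y))).2
          (∑ i, c' (T.chart (T.chart.symm (T.chart y))) i • e i (T.chart.symm (T.chart y))).1
          = 0 := by
        refine Eq.trans ?_ h1
        exact congrArg _ (hφ.dchartSymm_dchart (T.chart.map_source hy.1) _).symm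
      have h3 := T.chart.left_inv hy.1
      rw [h3] at h2
      exact h2
    have hqt : q ∈ T.chart.target := (hO'O hq).1
    have hev : ∀ c : EuclideanSpace ℝ (Fin r) × EuclideanSpace ℝ (Fin s) → Fin k → ℝ,
        ∀ᶠ z in 𝓝 q, (coordVec T.chart (fun y => (∑ i, c (T.chart y) i • e i y).1) z,
        coordForm T.chart (fun y => (∑ i, c (T.chart y) i • e i y).2) z) =
          coordFrame T.chart e z (c z) := fun c =>
      Filter.eventually_of_mem (T.chart.open_target.mem_nhds hqt) fun z hz => (hvec c z hz).symm
    refine hφ.coord_courantBracket_mem hint hqt hO'' ⟨T.chart.map_target hqt, ?_⟩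
      (hsm c hc) (hsm c' hc') (hmemE c) (hmemE c') (hpair c c' h0) (hpair c' c h0')
      ((hev c).mono fun z hz => congrArg Prod.fst hz)
      ((hev c).mono fun z hz => congrArg Prod.snd hz)
      ((hev c').mono fun z hz => congrArg Prod.fst hz)
      ((hev c').mono fun z hz => congrArg Prod.snd hz)
    rw [mem_preimage, T.chart.right_inv hqt]
    exact hq
  · intro q hq v hv v' hv'
    have h1 := hE.2 _ _ hv _ hv'
    have h2 : (1 / 2 : ℝ) * (v.2 (dchart m T.chart (T.chart.symm q) (dchartSymm m T.chart q v'.1)) +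
      v'.2 (dchart m T.chart (T.chart.symm q) (dchartSymm m T.chart q v.1))) = 0 := h1
    rw [hφ.dchart_dchartSymm hq.1, hφ.dchart_dchartSymm hq.1] at h2
    linarith
  · intro q hq ξ
    have hsrc := T.chart.map_target hq.1
    have hcompl : IsCompl (pseudoNormal E _ (T.fibreTangent (T.chart.symm q))) _ :=
      hdecU _ hq.2.2
    -- The horizontal component of the coordinate vector $(\xi,0)$ is the lift: it differs from that
    -- vector by a vertical one, so its base component is still $\xi$.
    have h1 : dchartSymm m T.chart q (ξ, 0) ∈
        pseudoNormal E _ (T.fibreTangent (T.chart.symm q)) ⊔ T.fibreTangent (T.chart.symm q) := by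
      rw [hcompl.sup_eq_top]; trivial
    obtain ⟨Z, ⟨α, hα, hZα⟩, v, hv, hZv⟩ := Submodule.mem_sup.1 h1
    refine ⟨ofBigTangent m T.chart q (Z, α), ?_, ?_, ?_⟩
    · change toBigTangent m T.chart q _ ∈ E _
      rw [hφ.toBigTangent_ofBigTangent hq.1]
      exact hZα
    · change (dchart m T.chart (T.chart.symm q) Z).1 = ξ
      have h2 := congrArg (fun x => (dchart m T.chart (T.chart.symm q) x).1) hZv
      have h3 : (dchart m T.chart (T.chart.symm q) (Z + v)).1 =
        (dchart m T.chart (T.chart.symm q) (dchartSymm m T.chart q (ξ, 0))).1 := h2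
      rw [hφ.dchart_dchartSymm hq.1, map_add, Prod.fst_add, (T.mem_fibreTangent hsrc v).1 hv,
        add_zero] at h3
      exact h3
    · ext w
      refine hα _ ((T.mem_fibreTangent hsrc _).2 ?_)
      change (dchart m T.chart (T.chart.symm q) (dchartSymm m T.chart q (0, w))).1 = 0
      rw [hφ.dchart_dchartSymm hq.1]
  · intro q hq v hv h1 h2
    have hsrc := T.chart.map_target hq.1
    have hcompl : IsCompl (pseudoNormal E _ (T.fibreTangent (T.chart.symm q))) _ :=
      hdecU _ hq.2.2
    have hV : dchartSymm m T.chart q v.1 ∈ T.fibreTangent (T.chart.symm q) := by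
      rw [T.mem_fibreTangent hsrc, hφ.dchart_dchartSymm hq.1, h1]
    have hH : dchartSymm m T.chart q v.1 ∈
        pseudoNormal E _ (T.fibreTangent (T.chart.symm q)) := by
      refine ⟨v.2.comp (dchart m T.chart (T.chart.symm q)), fun u hu => ?_, hv⟩
      have h3 := (T.mem_fibreTangent hsrc u).1 hu
      change v.2 (dchart m T.chart (T.chart.symm q) u) = 0
      have h4 : dchart m T.chart (T.chart.symm q) u =
        (0, (dchart m T.chart (T.chart.symm q) u).2) := Prod.ext h3 rfl
      rw [h4]
      exact DFunLike.congr_fun h2 _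
    have h3 := Submodule.disjoint_def.1 hcompl.disjoint _ hH hV
    have h4 := congrArg (dchart m T.chart (T.chart.symm q)) h3
    rw [hφ.dchart_dchartSymm hq.1, map_zero] at h4
    exact h4
  · intro q hq hq2 v hv
    have hsl : T.chart.symm q ∈ T.slice :=
      ⟨T.chart.map_target hq.1, by rw [T.chart.right_inv hq.1, hq2]⟩
    have h1 : dchartSymm m T.chart q v.1 ∈ charDistribution E (T.chart.symm q) :=
      ⟨_, hv, rfl⟩
    rwa [T.mem_charDistribution hsl, hφ.dchart_dchartSymm hq.1] at h1

end TubularNbhd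

end TubularFrame

/-! ### Pullbacks, local equivalence and germs of transversals. -/

section LocalEquivalence

open Set

variable {m n n₀ n₁ n₂ : ℕ}
  {M : Type*} [TopologicalSpace M] [ChartedSpace (EuclideanSpace ℝ (Fin m)) M]
  {N : Type*} [TopologicalSpace N] [ChartedSpace (EuclideanSpace ℝ (Fin n)) N]
  {N₀ : Type*} [TopologicalSpace N₀] [ChartedSpace (EuclideanSpace ℝ (Fin n₀)) N₀]
  {N₁ : Type*} [TopologicalSpace N₁] [ChartedSpace (EuclideanSpace ℝ (Fin n₁)) N₁]
  {N₂ : Type*} [TopologicalSpace N₂] [ChartedSpace (EuclideanSpace ℝ (Fin n₂)) N₂]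
  {E : ∀ x : M, Submodule ℝ (BigTangent m x)}

lemma mem_pullback {f : N → M} {q : N} {e : BigTangent n q} :
    e ∈ pullback f E q ↔ ∃ α : Cotangent m (f q),
      ((mfderiv (𝓡 n) (𝓡 m) f q e.1, α) : BigTangent m (f q)) ∈ E (f q) ∧
        e.2 = α.comp (mfderiv (𝓡 n) (𝓡 m) f q) := Iff.rfl

lemma pullback_congr {f g : N → M} {q : N} (h : f =ᶠ[𝓝 q] g) :
    pullback (n := n) f E q = pullback g E q := by
  -- The fibres of the big tangent bundle at `f q` and `g q` are distinct types. Generalizing the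
  -- point and the derivative permits substitution of both equalities.
  have key : ∀ (z z' : M) (D D' : EuclideanSpace ℝ (Fin n) →L[ℝ] EuclideanSpace ℝ (Fin m)),
      z = z' → D = D' → ∀ e : EuclideanSpace ℝ (Fin n) × (EuclideanSpace ℝ (Fin n) →L[ℝ] ℝ),
      ((∃ α : Cotangent m z, ((D e.1, α) : BigTangent m z) ∈ E z ∧ e.2 = α.comp D) ↔
        ∃ α : Cotangent m z', ((D' e.1, α) : BigTangent m z') ∈ E z' ∧ e.2 = α.comp D') := by
    rintro z _ D _ rfl rfl e
    exact Iff.rfl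
  ext e
  exact key _ _ _ _ h.self_of_nhds h.mfderiv_eq e

lemma pullback_congr_structure {E' : ∀ x : M, Submodule ℝ (BigTangent m x)} {f : N → M} {q : N}
    (h : E (f q) = E' (f q)) : pullback (n := n) f E q = pullback f E' q := by
  ext e
  rw [mem_pullback, mem_pullback, h]

lemma pullback_id (q : M) : pullback (m := m) (id : M → M) E q = E q := by
  ext e
  rw [mem_pullback, mfderiv_id]
  constructor
  · rintro ⟨α, h, hα⟩
    have : e = (e.1, α) := Prod.ext rfl hα
    rw [this]
    exact h
  · intro h
    exact ⟨e.2, h, rfl⟩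

lemma pullback_pullback {f : N₀ → N} {g : N → M} {q : N₀}
    (hf : MDifferentiableAt (𝓡 n₀) (𝓡 n) f q) (hg : MDifferentiableAt (𝓡 n) (𝓡 m) g (f q)) :
    pullback (m := n) (n := n₀) f (pullback g E) q = pullback (g ∘ f) E q := by
  ext e
  rw [mem_pullback, mem_pullback, mfderiv_comp q hg hf]
  constructor
  · rintro ⟨_, ⟨α, h, rfl⟩, hα⟩
    exact ⟨α, h, hα⟩
  · rintro ⟨α, h, hα⟩
    exact ⟨_, ⟨α, h, rfl⟩, hα⟩

/-- Local equivalence of fields of subspaces of the big tangent bundles of two manifolds. -/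
def LocEquiv (S₀ : ∀ q : N₀, Submodule ℝ (BigTangent n₀ q)) (q₀ : N₀)
    (S₁ : ∀ q : N₁, Submodule ℝ (BigTangent n₁ q)) (q₁ : N₁) : Prop :=
  ∃ Φ : OpenPartialHomeomorph N₀ N₁, q₀ ∈ Φ.source ∧ Φ q₀ = q₁ ∧
    ContMDiffOn (𝓡 n₀) (𝓡 n₁) ∞ Φ Φ.source ∧ ContMDiffOn (𝓡 n₁) (𝓡 n₀) ∞ Φ.symm Φ.target ∧
    ∀ q ∈ Φ.source, pullback (m := n₁) (n := n₀) Φ S₁ q = S₀ q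

section

variable {S₀ : ∀ q : N₀, Submodule ℝ (BigTangent n₀ q)} {q₀ : N₀}
  {S₁ : ∀ q : N₁, Submodule ℝ (BigTangent n₁ q)} {q₁ : N₁}
  {S₂ : ∀ q : N₂, Submodule ℝ (BigTangent n₂ q)} {q₂ : N₂}

lemma mdifferentiableAt_of_contMDiffOn {f : N → M} {s : Set N}
    (h : ContMDiffOn (𝓡 n) (𝓡 m) ∞ f s) (hs : IsOpen s) {q : N} (hq : q ∈ s) :
    MDifferentiableAt (𝓡 n) (𝓡 m) f q :=
  (h.contMDiffAt (hs.mem_nhds hq)).mdifferentiableAt (by simp)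

lemma LocEquiv.refl : LocEquiv S₀ q₀ S₀ q₀ :=
  ⟨.refl N₀, trivial, rfl, contMDiffOn_id, contMDiffOn_id, fun q _ => pullback_id q⟩

lemma LocEquiv.symm (h : LocEquiv S₀ q₀ S₁ q₁) : LocEquiv S₁ q₁ S₀ q₀ := by
  obtain ⟨Φ, hq, rfl, hs, hs', hp⟩ := h
  refine ⟨Φ.symm, Φ.map_source hq, Φ.left_inv hq, hs', hs, fun q hqt => ?_⟩
  have h1 : pullback (m := n₀) (n := n₁) Φ.symm S₀ q =
      pullback Φ.symm (pullback (m := n₁) (n := n₀) Φ S₁) q :=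
    pullback_congr_structure (hp _ (Φ.map_target hqt)).symm
  rw [h1, pullback_pullback (mdifferentiableAt_of_contMDiffOn hs' Φ.open_target hqt)
    (mdifferentiableAt_of_contMDiffOn hs Φ.open_source (Φ.map_target hqt))]
  exact (pullback_congr (g := id) (Φ.eventually_right_inverse hqt)).trans (pullback_id q)

lemma LocEquiv.trans (h : LocEquiv S₀ q₀ S₁ q₁) (h' : LocEquiv S₁ q₁ S₂ q₂) :
    LocEquiv S₀ q₀ S₂ q₂ := by
  obtain ⟨Φ, hq, rfl, hs, hs', hp⟩ := h
  obtain ⟨Ψ, hq', rfl, ht, ht', hp'⟩ := h'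
  refine ⟨Φ.trans Ψ, ⟨hq, hq'⟩, rfl, ?_, ?_, fun q hqs => ?_⟩
  · exact ht.comp (hs.mono inter_subset_left) fun q hq => hq.2
  · exact hs'.comp (ht'.mono inter_subset_left) fun q hq => hq.2
  · have h1 : pullback (m := n₁) (n := n₀) Φ S₁ q =
        pullback Φ (pullback (m := n₂) (n := n₁) Ψ S₂) q :=
      pullback_congr_structure (hp' _ hqs.2).symm
    rw [← hp q hqs.1, h1,
      pullback_pullback (mdifferentiableAt_of_contMDiffOn hs Φ.open_source hqs.1)
      (mdifferentiableAt_of_contMDiffOn ht Ψ.open_source hqs.2)]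
    rfl

end

/-- Maps that differ by a local diffeomorphism of their domains induce equivalent structures. -/
lemma locEquiv_of_comp {f : N₀ → M} {g : N₁ → M} {q₀ : N₀} (Φ : OpenPartialHomeomorph N₀ N₁)
    (hq : q₀ ∈ Φ.source) (hs : ContMDiffOn (𝓡 n₀) (𝓡 n₁) ∞ Φ Φ.source)
    (hs' : ContMDiffOn (𝓡 n₁) (𝓡 n₀) ∞ Φ.symm Φ.target)
    (hg : ∀ q ∈ Φ.source, MDifferentiableAt (𝓡 n₁) (𝓡 m) g (Φ q))
    (h : ∀ q ∈ Φ.source, f q = g (Φ q)) :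
    LocEquiv (pullback (n := n₀) f E) q₀ (pullback (n := n₁) g E) (Φ q₀) := by
  refine ⟨Φ, hq, rfl, hs, hs', fun q hqs => ?_⟩
  rw [pullback_pullback (mdifferentiableAt_of_contMDiffOn hs Φ.open_source hqs) (hg q hqs)]
  exact pullback_congr (Filter.eventually_of_mem (Φ.open_source.mem_nhds hqs)
    fun z hz => (h z hz).symm)

/-- The germ at `q` of a map transversal to the characteristic distribution. -/
structure IsTransversalGerm (E : ∀ x : M, Submodule ℝ (BigTangent m x)) (f : N → M) (q : N) :
    Prop where
  smooth : ∀ᶠ z in 𝓝 q, ContMDiffAt (𝓡 n) (𝓡 m) ∞ f z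
  injective : Function.Injective (mfderiv (𝓡 n) (𝓡 m) f q)
  isCompl : IsCompl (LinearMap.range (mfderiv (𝓡 n) (𝓡 m) f q).toLinearMap)
    (charDistribution E (f q))

lemma isSmoothChart_of_mem_maximalAtlas [IsManifold (𝓡 n) ∞ N]
    {φ : OpenPartialHomeomorph N (EuclideanSpace ℝ (Fin n))}
    (h : φ ∈ IsManifold.maximalAtlas (𝓡 n) ∞ N) : IsSmoothChart n φ :=
  ⟨contMDiffOn_of_mem_maximalAtlas h, contMDiffOn_symm_of_mem_maximalAtlas h⟩

/-- In the charts of the immersion the map is the injective linear map `j`, and the differential of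
the domain chart is injective. -/
lemma injective_mfderiv_of_isImmersionAt [IsManifold (𝓡 n) ∞ N] [IsManifold (𝓡 m) ∞ M] {f : N → M}
    {q : N} (h : Manifold.IsImmersionAt (𝓡 n) (𝓡 m) ∞ f q) :
    Function.Injective (mfderiv (𝓡 n) (𝓡 m) f q) := by
  have hφ := isSmoothChart_of_mem_maximalAtlas h.domChart_mem_maximalAtlas
  have hψ := isSmoothChart_of_mem_maximalAtlas h.codChart_mem_maximalAtlas
  have hq := h.mem_domChart_source
  let j : EuclideanSpace ℝ (Fin n) →L[ℝ] EuclideanSpace ℝ (Fin m) :=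
    (h.equiv : (EuclideanSpace ℝ (Fin n) × h.complement) →L[ℝ] EuclideanSpace ℝ (Fin m)) ∘L
      .inl ℝ _ _
  have hj : Function.Injective j := h.equiv.injective.comp (LinearMap.inl_injective (R := ℝ))
  have h1 : h.codChart ∘ f =ᶠ[𝓝 q] j ∘ h.domChart := by
    filter_upwards [h.domChart.open_source.mem_nhds hq] with z hz
    have hzt : h.domChart z ∈ (h.domChart.extend (𝓡 n)).target := by
      simpa using h.domChart.map_source hz
    have h2 := h.writtenInCharts hzt
    simpa [h.domChart.left_inv hz, j] using h2
  have hf := (h.contMDiffAt.mdifferentiableAt (by simp)).hasMFDerivAt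
  have hD := ((hψ.contMDiffAt h.mem_codChart_source).mdifferentiableAt (by simp)).hasMFDerivAt
  have hD' := ((hφ.contMDiffAt hq).mdifferentiableAt (by simp)).hasMFDerivAt
  have h2 := hD.comp q hf
  have h3 := (j.hasFDerivAt (x := h.domChart q)).hasMFDerivAt.comp q hD'
  have h4 := hasMFDerivAt_unique h2 (h3.congr_of_eventuallyEq h1)
  have hinjφ : Function.Injective (dchart n h.domChart q) := by
    have h5 : ∀ q', q' ∈ h.domChart.source → Function.Injective (dchart n h.domChart q') := by
      intro q' hq'
      have h6 := fun v => hφ.dchartSymm_dchart (h.domChart.map_source hq') v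
      rw [h.domChart.left_inv hq'] at h6
      exact Function.LeftInverse.injective h6
    exact h5 q hq
  have h5 : Function.Injective (j ∘ dchart n h.domChart q) := hj.comp hinjφ
  have h6 : ∀ v, j (dchart n h.domChart q v) =
      mfderiv (𝓡 m) 𝓘(ℝ, EuclideanSpace ℝ (Fin m)) h.codChart (f q) (mfderiv (𝓡 n) (𝓡 m) f q v) :=
    fun v => (DFunLike.congr_fun h4 v).symm
  intro v w hvw
  refine h5 ?_
  change j (dchart n h.domChart q v) = j (dchart n h.domChart q w)
  rw [h6, h6, hvw]

/-- Passing to germs puts transversals on the same footing as tubular fibres, whose parametrizations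
are controlled only on an open set. -/
lemma IsLocalTransversal.isTransversalGerm [IsManifold (𝓡 n) ∞ N] [IsManifold (𝓡 m) ∞ M] {f : N → M}
    {q : N} (h : IsLocalTransversal (m := m) (n := n) E f q) :
    IsTransversalGerm (n := n) E f q where
  smooth := .of_forall fun _ => h.embedding.isImmersion.contMDiff.contMDiffAt
  injective := injective_mfderiv_of_isImmersionAt (h.embedding.isImmersion.isImmersionAt q)
  isCompl := h.isCompl

end LocalEquivalence

/-! ### Equivalence of the fibres of one tubular neighbourhood. -/

section TubularFibres

open Set

variable {m : ℕ} {M : Type*} [TopologicalSpace M] [ChartedSpace (EuclideanSpace ℝ (Fin m)) M]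
  {E : ∀ x : M, Submodule ℝ (BigTangent m x)} {r s : ℕ}

namespace TubularNbhd

variable (T : TubularNbhd E r s)

/-- The parametrization `w ↦ (x, w)` of the tubular fibre `x = a`. -/
def fibreMap (a : EuclideanSpace ℝ (Fin r)) (w : EuclideanSpace ℝ (Fin s)) : M :=
  T.chart.symm (a, w)

variable {T}

lemma mk_mem_target {a : EuclideanSpace ℝ (Fin r)} {w : EuclideanSpace ℝ (Fin s)}
    (ha : a ∈ T.base) (hw : w ∈ T.fibre) : (a, w) ∈ T.chart.target := by
  rw [T.target_eq]; exact ⟨ha, hw⟩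

lemma isOpen_base : IsOpen T.base := by
  have h : (fun a => (a, (0 : EuclideanSpace ℝ (Fin s)))) ⁻¹' T.chart.target = T.base := by
    ext a
    simp [T.target_eq, T.zero_mem_fibre]
  rw [← h]
  exact T.chart.open_target.preimage (by fun_prop)

lemma isOpen_fibre : IsOpen T.fibre := by
  obtain ⟨a, ha⟩ := T.isConnected_base.nonempty
  have h : (fun w => (a, w)) ⁻¹' T.chart.target = T.fibre := by
    ext w
    simp [T.target_eq, ha]
  rw [← h]
  exact T.chart.open_target.preimage (by fun_prop)

lemma contMDiffAt_fibreMap {a : EuclideanSpace ℝ (Fin r)} {w : EuclideanSpace ℝ (Fin s)}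
    (h : (a, w) ∈ T.chart.target) : ContMDiffAt (𝓡 s) (𝓡 m) ∞ (T.fibreMap a) w := by
  have h1 : ContMDiffAt (𝓡 s) 𝓘(ℝ, EuclideanSpace ℝ (Fin r) × EuclideanSpace ℝ (Fin s)) ∞
      (fun w : EuclideanSpace ℝ (Fin s) => (a, w)) w :=
    (contDiffAt_const.prodMk contDiffAt_id).contMDiffAt
  exact (T.isSmoothChart.contMDiffAt_symm h).comp w h1

lemma mfderiv_fibreMap {a : EuclideanSpace ℝ (Fin r)} {w : EuclideanSpace ℝ (Fin s)}
    (h : (a, w) ∈ T.chart.target) :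
    mfderiv (𝓡 s) (𝓡 m) (T.fibreMap a) w = (dchartSymm m T.chart (a, w)).comp (.inr ℝ _ _) := by
  have h1 := ((T.isSmoothChart.contMDiffAt_symm h).mdifferentiableAt (by simp)).hasMFDerivAt
  have h2 : HasMFDerivAt (𝓡 s) 𝓘(ℝ, EuclideanSpace ℝ (Fin r) × EuclideanSpace ℝ (Fin s))
      (fun w : EuclideanSpace ℝ (Fin s) => (a, w)) w (.inr ℝ _ _) :=
    (hasFDerivAt_prodMk_right a w).hasMFDerivAt
  exact (h1.comp w h2).mfderiv

lemma mem_pullback_fibreMap {a : EuclideanSpace ℝ (Fin r)} {w : EuclideanSpace ℝ (Fin s)}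
    (h : (a, w) ∈ T.chart.target) (e : BigTangent s w) :
    e ∈ pullback (T.fibreMap a) E w ↔ e ∈ fibreStructure (coordStructure T.chart E (a, w)) := by
  have hφ := T.isSmoothChart
  rw [mem_pullback, mfderiv_fibreMap h]
  constructor
  · rintro ⟨α, hα, he⟩
    refine ⟨α.comp (dchartSymm m T.chart (a, w)), ?_, he⟩
    have h1 : (α.comp (dchartSymm m T.chart (a, w))).comp (dchart m T.chart (T.chart.symm (a, w)))
        = α := ContinuousLinearMap.ext fun v => congrArg α (hφ.dchartSymm_dchart h v)
    rw [mem_coordStructure, h1]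
    exact hα
  · rintro ⟨α, hα, he⟩
    refine ⟨α.comp (dchart m T.chart (T.chart.symm (a, w))), hα, he.trans ?_⟩
    ext v
    exact congrArg α (hφ.dchart_dchartSymm h (0, v)).symm

lemma fibreMap_zero_mem_slice {a : EuclideanSpace ℝ (Fin r)} (ha : a ∈ T.base) :
    T.fibreMap a 0 ∈ T.slice :=
  ⟨T.chart.map_target (mk_mem_target ha T.zero_mem_fibre), by
    rw [fibreMap, T.chart.right_inv (mk_mem_target ha T.zero_mem_fibre)]⟩

variable [T2Space M] [IsManifold (𝓡 m) ∞ M] {k : ℕ}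

/-- Fibre transport read on the manifold. The bound `δ` depends on the direction `ξ`, so no full
neighbourhood of `a` is covered at this stage. -/
lemma exists_locEquiv_fibreMap (hE : IsBigIsotropic k E) (hint : IsIntegrable E)
    (hdec : ∀ᶠ y in 𝓝ˢ T.slice, T.DecomposesAt y) {a : EuclideanSpace ℝ (Fin r)} (ha : a ∈ T.base)
    (ξ : EuclideanSpace ℝ (Fin r)) : ∃ δ > 0, ∀ t : ℝ, |t| < δ →
      LocEquiv (pullback (n := s) (T.fibreMap a) E) 0
        (pullback (n := s) (T.fibreMap (a + t • ξ)) E) 0 := by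
  have hp := mk_mem_target ha T.zero_mem_fibre
  obtain ⟨O, hO, hpO, ε, hε⟩ := T.exists_isDecomposableFrame hE hint hp
    (hdec.filter_mono (nhds_le_nhdsSet (fibreMap_zero_mem_slice ha)))
  obtain ⟨δ, hδ, h⟩ := hε.exists_fibre_transport hpO ξ
  refine ⟨δ, hδ, fun t ht => ?_⟩
  obtain ⟨Φ, h0, hΦ0, hs, hs', hΦ⟩ := h t ht
  refine ⟨Φ, h0, hΦ0, hs.contMDiffOn, hs'.contMDiffOn, fun w hw => ?_⟩
  obtain ⟨hw1, hw2, hiff⟩ := hΦ w hw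
  ext e
  rw [mem_pullback_fibreMap (hO hw1), mem_pullback, mfderiv_eq_fderiv]
  refine Iff.trans ?_ (hiff e.1 e.2).symm
  exact exists_congr fun β' => and_congr_left fun _ =>
    mem_pullback_fibreMap (hO hw2) (fderiv ℝ Φ w e.1, β')

/-- Any two tubular fibres are equivalent, near the slice. -/
theorem locEquiv_fibreMap (hE : IsBigIsotropic k E) (hint : IsIntegrable E)
    (hdec : ∀ᶠ y in 𝓝ˢ T.slice, T.DecomposesAt y) {a c : EuclideanSpace ℝ (Fin r)}
    (ha : a ∈ T.base) (hc : c ∈ T.base) :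
    LocEquiv (pullback (n := s) (T.fibreMap a) E) 0 (pullback (n := s) (T.fibreMap c) E) 0 := by
  refine T.isConnected_base.isPreconnected.induction₂ (fun a c => LocEquiv
    (pullback (n := s) (T.fibreMap a) E) 0 (pullback (n := s) (T.fibreMap c) E) 0) ?_
    (fun _ _ _ _ _ _ h h' => h.trans h') (fun _ _ _ _ h => h.symm) ha hc
  intro a ha
  obtain ⟨ρ, hρ, hball⟩ := Metric.isOpen_iff.1 T.isOpen_base a ha
  refine mem_nhdsWithin_of_mem_nhds (Filter.mem_of_superset (Metric.ball_mem_nhds a hρ) ?_)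
  intro c hc
  -- To reach a nearby `c`, the direction `c - a` is kept fixed and the segment is traversed by
  -- connectedness of $[0,1]$. No uniformity of `δ` in the direction is needed.
  have hseg : ∀ τ ∈ Icc (0 : ℝ) 1, a + τ • (c - a) ∈ T.base := fun τ hτ =>
    hball ((convex_ball a ρ).add_smul_sub_mem (Metric.mem_ball_self hρ) hc hτ)
  have h := (isPreconnected_Icc (a := (0 : ℝ)) (b := 1)).induction₂ (fun τ τ' => LocEquiv
    (pullback (n := s) (T.fibreMap (a + τ • (c - a))) E) 0
    (pullback (n := s) (T.fibreMap (a + τ' • (c - a))) E) 0) ?_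
    (fun _ _ _ _ _ _ h h' => h.trans h') (fun _ _ _ _ h => h.symm)
    (left_mem_Icc.2 zero_le_one) (right_mem_Icc.2 zero_le_one)
  · simpa using h
  · intro τ hτ
    obtain ⟨δ, hδ, h⟩ := exists_locEquiv_fibreMap hE hint hdec (hseg τ hτ) (c - a)
    refine mem_nhdsWithin_of_mem_nhds (Filter.mem_of_superset (Metric.ball_mem_nhds τ hδ) ?_)
    intro τ' hτ'
    have h1 := h (τ' - τ) (by simpa [Real.dist_eq] using hτ')
    rwa [add_assoc, ← add_smul, add_sub_cancel] at h1

end TubularNbhd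

end TubularFibres

/-! ### A shear moving one fibre to a graph and fixing another. -/

section Shear

open Set

variable {E₁ E₂ : Type*} [NormedAddCommGroup E₁] [NormedSpace ℝ E₁]
  [NormedAddCommGroup E₂] [NormedSpace ℝ E₂]

/-- The map `(x, w) ↦ (x + (1 - ℓ (x - a)) u(w), w)`. -/
def shear (a : E₁) (ℓ : E₁ →L[ℝ] ℝ) (u : E₂ → E₁) (q : E₁ × E₂) : E₁ × E₂ :=
  (q.1 + (1 - ℓ (q.1 - a)) • u q.2, q.2)

/-- The inverse of `shear`, where `ℓ (u(w)) ≠ 1`. -/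
def shearInv (a : E₁) (ℓ : E₁ →L[ℝ] ℝ) (u : E₂ → E₁) (q : E₁ × E₂) : E₁ × E₂ :=
  (q.1 - ((1 - ℓ (q.1 - a)) * (1 - ℓ (u q.2))⁻¹) • u q.2, q.2)

variable {a : E₁} {ℓ : E₁ →L[ℝ] ℝ} {u : E₂ → E₁} {q : E₁ × E₂}

omit [NormedAddCommGroup E₂] [NormedSpace ℝ E₂] in
lemma shearInv_shear (h : ℓ (u q.2) ≠ 1) : shearInv a ℓ u (shear a ℓ u q) = q := by
  have h' : 1 - ℓ (u q.2) ≠ 0 := sub_ne_zero.2 h.symm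
  refine Prod.ext ?_ rfl
  -- For fixed `w` the shear multiplies the factor $1-\ell(x-a)$ by the constant $1-\ell(u(w))$, so
  -- the original factor is recovered by division.
  have h1 : 1 - ℓ (q.1 + (1 - ℓ (q.1 - a)) • u q.2 - a) =
      (1 - ℓ (q.1 - a)) * (1 - ℓ (u q.2)) := by
    simp only [map_add, map_sub, map_smul, smul_eq_mul]; ring
  change q.1 + (1 - ℓ (q.1 - a)) • u q.2 -
    ((1 - ℓ (q.1 + (1 - ℓ (q.1 - a)) • u q.2 - a)) * (1 - ℓ (u q.2))⁻¹) • u q.2 = q.1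
  rw [h1, mul_assoc, mul_inv_cancel₀ h', mul_one, add_sub_cancel_right]

omit [NormedAddCommGroup E₂] [NormedSpace ℝ E₂] in
lemma shear_shearInv (h : ℓ (u q.2) ≠ 1) : shear a ℓ u (shearInv a ℓ u q) = q := by
  have h' : 1 - ℓ (u q.2) ≠ 0 := sub_ne_zero.2 h.symm
  refine Prod.ext ?_ rfl
  have h1 : 1 - ℓ (q.1 - ((1 - ℓ (q.1 - a)) * (1 - ℓ (u q.2))⁻¹) • u q.2 - a) =
      (1 - ℓ (q.1 - a)) * (1 - ℓ (u q.2))⁻¹ := by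
    simp only [map_sub, map_smul, smul_eq_mul]
    field_simp
    ring
  change q.1 - ((1 - ℓ (q.1 - a)) * (1 - ℓ (u q.2))⁻¹) • u q.2 +
    (1 - ℓ (q.1 - ((1 - ℓ (q.1 - a)) * (1 - ℓ (u q.2))⁻¹) • u q.2 - a)) • u q.2 = q.1
  rw [h1, sub_add_cancel]

lemma contDiffAt_shear (hu : ContDiffAt ℝ ∞ u q.2) : ContDiffAt ℝ ∞ (shear a ℓ u) q := by
  have hu' : ContDiffAt ℝ ∞ (fun q : E₁ × E₂ => u q.2) q := hu.comp q contDiffAt_snd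
  have hℓ : ContDiffAt ℝ ∞ (fun q : E₁ × E₂ => 1 - ℓ (q.1 - a)) q :=
    contDiffAt_const.sub (ℓ.contDiff.contDiffAt.comp q (contDiffAt_fst.sub contDiffAt_const))
  exact (contDiffAt_fst.add (hℓ.smul hu')).prodMk contDiffAt_snd

lemma contDiffAt_shearInv (hu : ContDiffAt ℝ ∞ u q.2) (h : ℓ (u q.2) ≠ 1) :
    ContDiffAt ℝ ∞ (shearInv a ℓ u) q := by
  have hu' : ContDiffAt ℝ ∞ (fun q : E₁ × E₂ => u q.2) q := hu.comp q contDiffAt_snd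
  have hℓ : ContDiffAt ℝ ∞ (fun q : E₁ × E₂ => 1 - ℓ (q.1 - a)) q :=
    contDiffAt_const.sub (ℓ.contDiff.contDiffAt.comp q (contDiffAt_fst.sub contDiffAt_const))
  have hinv : ContDiffAt ℝ ∞ (fun q : E₁ × E₂ => (1 - ℓ (u q.2))⁻¹) q :=
    (contDiffAt_const.sub (ℓ.contDiff.contDiffAt.comp q hu')).inv (sub_ne_zero.2 h.symm)
  exact (contDiffAt_fst.sub ((hℓ.mul hinv).smul hu')).prodMk contDiffAt_snd

/-- The map `shear` as a partial homeomorphism with source `A × B`. -/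
def shearHomeomorph (a : E₁) (ℓ : E₁ →L[ℝ] ℝ) (u : E₂ → E₁) {A : Set E₁} {B : Set E₂}
    (hA : IsOpen A) (hB : IsOpen B) (hu : ∀ w ∈ B, ContDiffAt ℝ ∞ u w) (h : ∀ w ∈ B, ℓ (u w) ≠ 1) :
    OpenPartialHomeomorph (E₁ × E₂) (E₁ × E₂) where
  toFun := shear a ℓ u
  invFun := shearInv a ℓ u
  source := A ×ˢ B
  target := (Prod.snd ⁻¹' B) ∩ shearInv a ℓ u ⁻¹' (A ×ˢ B)
  map_source' q hq := ⟨hq.2, by rw [mem_preimage, shearInv_shear (h _ hq.2)]; exact hq⟩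
  map_target' q hq := hq.2
  left_inv' q hq := shearInv_shear (h _ hq.2)
  right_inv' q hq := shear_shearInv (h _ hq.1)
  open_source := hA.prod hB
  open_target := ContinuousOn.isOpen_inter_preimage (fun q hq =>
    (contDiffAt_shearInv (hu _ hq) (h _ hq)).continuousAt.continuousWithinAt)
    (hB.preimage continuous_snd) (hA.prod hB)
  continuousOn_toFun q hq := (contDiffAt_shear (hu _ hq.2)).continuousAt.continuousWithinAt
  continuousOn_invFun q hq :=
    (contDiffAt_shearInv (hu _ hq.1) (h _ hq.1)).continuousAt.continuousWithinAt

end Shear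

/-! ### Graphs over a tubular fibre. -/

section ShearedTubularNbhd

open Set

variable {m : ℕ} {M : Type*} [TopologicalSpace M] [ChartedSpace (EuclideanSpace ℝ (Fin m)) M]
  {E : ∀ x : M, Submodule ℝ (BigTangent m x)} {r s : ℕ}

namespace TubularNbhd

/-- A tubular neighbourhood of a piece of a slice, one fibre of which is a given graph over the
fibre `x = a`, and another fibre of which is a fibre of the initial neighbourhood. -/
lemma exists_fibre_eq_graph (T : TubularNbhd E r s) (hr : Nontrivial (EuclideanSpace ℝ (Fin r)))
    {g : EuclideanSpace ℝ (Fin s) → EuclideanSpace ℝ (Fin r)}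
    (hg : ∀ᶠ w in 𝓝 0, ContDiffAt ℝ ∞ g w) (hg0 : g 0 ∈ T.base) :
    ∃ T' : TubularNbhd E r s, ∃ c ∈ T'.base, c ∈ T.base ∧ g 0 ∈ T'.base ∧
      (∀ w, T'.fibreMap (g 0) w = T.chart.symm (g w, w)) ∧ T'.fibreMap c = T.fibreMap c := by
  set a := g 0 with ha
  obtain ⟨ρ, hρ, hball⟩ := Metric.isOpen_iff.1 T.isOpen_base a hg0
  -- The second fibre will be the one over `a + v`, which must lie in the smaller ball and differ
  -- from the fibre over `a`.
  obtain ⟨v, hv, hvρ⟩ : ∃ v : EuclideanSpace ℝ (Fin r), v ≠ 0 ∧ ‖v‖ < ρ / 2 := by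
    obtain ⟨v, hv⟩ := exists_ne (0 : EuclideanSpace ℝ (Fin r))
    refine ⟨(ρ / 4 * ‖v‖⁻¹) • v, ?_, ?_⟩
    · have := norm_pos_iff.2 hv
      exact smul_ne_zero (by positivity) hv
    · have := norm_pos_iff.2 hv
      rw [norm_smul, Real.norm_of_nonneg (by positivity), mul_assoc, inv_mul_cancel₀ this.ne']
      linarith
  -- The factor $1-\ell(x-a)$ equals $1$ at $x=a$ and $0$ at $x=a+v$. The shear thus sends the first
  -- fibre to the graph and fixes the second.
  obtain ⟨ℓ, hℓ⟩ := SeparatingDual.exists_eq_one (R := ℝ) hv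
  let u : EuclideanSpace ℝ (Fin s) → EuclideanSpace ℝ (Fin r) := fun w => g w - a
  have hu0 : u 0 = 0 := sub_self _
  have hgc : ContinuousAt u 0 := hg.self_of_nhds.continuousAt.sub continuousAt_const
  -- On these `w` the shear is invertible. The last bound limits the displacement to $\rho/2$, since
  -- $|1-\ell(x-a)|\le 1+\|\ell\|\rho$; the image of the ball of radius $\rho/2$ stays in the base.
  have hsmall : ∀ᶠ w in 𝓝 (0 : EuclideanSpace ℝ (Fin s)), w ∈ T.fibre ∧ ContDiffAt ℝ ∞ u w ∧
      ℓ (u w) ≠ 1 ∧ (1 + ‖ℓ‖ * ρ) * ‖u w‖ < ρ / 2 := by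
    refine Filter.Eventually.and (T.isOpen_fibre.mem_nhds T.zero_mem_fibre)
      (Filter.Eventually.and (hg.mono fun w hw => hw.sub contDiffAt_const)
        (Filter.Eventually.and ?_ ?_))
    · exact (ℓ.continuous.continuousAt.comp hgc).eventually_ne (by simp [hu0])
    · refine (continuousAt_const.mul hgc.norm).eventually_lt continuousAt_const ?_
      simp [hu0, hρ]
  obtain ⟨η, hη, hB⟩ := Metric.eventually_nhds_iff_ball.1 hsmall
  let G := shearHomeomorph a ℓ u (A := Metric.ball a (ρ / 2)) (B := Metric.ball 0 η)
    Metric.isOpen_ball Metric.isOpen_ball (fun w hw => (hB w hw).2.1) (fun w hw => (hB w hw).2.2.1)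
  have hGmaps : MapsTo G G.source T.chart.target := by
    rintro ⟨x, w⟩ ⟨hx, hw⟩
    refine mk_mem_target (hball ?_) (hB w hw).1
    have hx' : ‖x - a‖ < ρ / 2 := by simpa [dist_eq_norm] using hx
    rw [Metric.mem_ball, dist_eq_norm]
    have h1 : |1 - ℓ (x - a)| ≤ 1 + ‖ℓ‖ * ρ := by
      refine (abs_sub _ _).trans ?_
      rw [abs_one]
      have := ℓ.le_opNorm (x - a)
      rw [Real.norm_eq_abs] at this
      have h2 : ‖ℓ‖ * ‖x - a‖ ≤ ‖ℓ‖ * ρ :=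
        mul_le_mul_of_nonneg_left (by linarith) (norm_nonneg _)
      linarith
    calc ‖x + (1 - ℓ (x - a)) • u w - a‖ = ‖(x - a) + (1 - ℓ (x - a)) • u w‖ := by
          congr 1; abel
      _ ≤ ‖x - a‖ + |1 - ℓ (x - a)| * ‖u w‖ := by
          refine (norm_add_le _ _).trans ?_
          rw [norm_smul, Real.norm_eq_abs]
      _ ≤ ‖x - a‖ + (1 + ‖ℓ‖ * ρ) * ‖u w‖ := by
          have := mul_le_mul_of_nonneg_right h1 (norm_nonneg (u w))
          linarith
      _ < ρ := by linarith [(hB w hw).2.2.2]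
  have htarget : (T.chart.trans G.symm).target = Metric.ball a (ρ / 2) ×ˢ Metric.ball 0 η := by
    refine Subset.antisymm inter_subset_left fun q hq => ⟨hq, hGmaps hq⟩
  have hsm : ∀ q ∈ G.source, ContDiffAt ℝ ∞ G q := fun q hq => contDiffAt_shear (hB _ hq.2).2.1
  have hsm' : ∀ q ∈ G.target, ContDiffAt ℝ ∞ G.symm q := fun q hq =>
    contDiffAt_shearInv (hB _ hq.1).2.1 (hB _ hq.1).2.2.1
  -- The coordinate `w` is unchanged by the shear, so the slice equation and the tangent condition
  -- are inherited from `T`.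
  let T' : TubularNbhd E r s :=
    { chart := T.chart.trans G.symm
      smooth_chart := by
        have h1 : ContMDiffOn 𝓘(ℝ, EuclideanSpace ℝ (Fin r) × EuclideanSpace ℝ (Fin s))
            𝓘(ℝ, EuclideanSpace ℝ (Fin r) × EuclideanSpace ℝ (Fin s)) ∞ G.symm G.target :=
          fun q hq => (hsm' q hq).contMDiffAt.contMDiffWithinAt
        exact h1.comp (T.smooth_chart.mono inter_subset_left) fun y hy => hy.2
      smooth_symm := by
        have h1 : ContMDiffOn 𝓘(ℝ, EuclideanSpace ℝ (Fin r) × EuclideanSpace ℝ (Fin s))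
            𝓘(ℝ, EuclideanSpace ℝ (Fin r) × EuclideanSpace ℝ (Fin s)) ∞ G G.source :=
          fun q hq => (hsm q hq).contMDiffAt.contMDiffWithinAt
        exact T.smooth_symm.comp (h1.mono inter_subset_left) fun y hy => hy.2
      base := Metric.ball a (ρ / 2)
      fibre := Metric.ball 0 η
      target_eq := htarget
      isConnected_base := (convex_ball _ _).isConnected ⟨a, Metric.mem_ball_self (by positivity)⟩
      isConnected_fibre := (convex_ball _ _).isConnected ⟨0, Metric.mem_ball_self hη⟩
      zero_mem_fibre := Metric.mem_ball_self hη
      tangent_slice := fun y hy hy2 => T.tangent_slice y hy.1 hy2 }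
  have hca : a + v ∈ Metric.ball a (ρ / 2) := by simpa using hvρ
  refine ⟨T', a + v, hca, hball (Metric.ball_subset_ball (by linarith) hca),
    Metric.mem_ball_self (by positivity), fun w => ?_, funext fun w => ?_⟩
  · change T.chart.symm (a + (1 - ℓ (a - a)) • (g w - a), w) = _
    simp
  · change T.chart.symm (a + v + (1 - ℓ (a + v - a)) • (g w - a), w) = T.chart.symm (a + v, w)
    simp [hℓ]

variable [T2Space M] [IsManifold (𝓡 m) ∞ M] {k : ℕ}

/-- The structure of a graph over a tubular fibre is equivalent to that of the fibre. -/
theorem locEquiv_graph (T : TubularNbhd E r s) (hE : IsBigIsotropic k E) (hint : IsIntegrable E)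
    (hdec : IsStronglyLocallyDecomposable E)
    {g : EuclideanSpace ℝ (Fin s) → EuclideanSpace ℝ (Fin r)}
    (hg : ∀ᶠ w in 𝓝 0, ContDiffAt ℝ ∞ g w) (hg0 : g 0 ∈ T.base) :
    LocEquiv (pullback (n := s) (fun w => T.chart.symm (g w, w)) E) 0
      (pullback (n := s) (T.fibreMap (g 0)) E) 0 := by
  -- For $r=0$ no nonzero `v` exists, but then the graph is the fibre itself.
  rcases subsingleton_or_nontrivial (EuclideanSpace ℝ (Fin r)) with hr | hr
  · have : (fun w => T.chart.symm (g w, w)) = T.fibreMap (g 0) :=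
      funext fun w => by rw [fibreMap, Subsingleton.elim (g w) (g 0)]
    rw [this]
    exact LocEquiv.refl
  · obtain ⟨T', c, hc', hc, ha, hga, hgc⟩ := T.exists_fibre_eq_graph hr hg hg0
    -- Strong decomposability is essential here: `T'` depends on the graph, so it is not a
    -- neighbourhood chosen in advance. The fibre over `c`, common to `T` and `T'`, links the graph
    -- to the original fibre.
    have h1 := locEquiv_fibreMap hE hint (hdec.2 _ _ T') ha hc'
    rw [funext hga, hgc] at h1
    exact h1.trans (locEquiv_fibreMap hE hint (hdec.2 _ _ T) hc hg0)

end TubularNbhd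

end ShearedTubularNbhd

/-! ### Transversals compared with tubular fibres. -/

section Transversals

open Set

variable {m n : ℕ} {M : Type*} [TopologicalSpace M] [ChartedSpace (EuclideanSpace ℝ (Fin m)) M]
  {N : Type*} [TopologicalSpace N] [ChartedSpace (EuclideanSpace ℝ (Fin n)) N]
  {E : ∀ x : M, Submodule ℝ (BigTangent m x)} {r s k : ℕ}

lemma IsSmoothChart.exists_local_diffeomorph
    {φ : OpenPartialHomeomorph N (EuclideanSpace ℝ (Fin n))} (hφ : IsSmoothChart n φ)
    {p : EuclideanSpace ℝ (Fin n)} (hp : p ∈ φ.target) {f : N → EuclideanSpace ℝ (Fin s)}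
    {U : Set N} (hU : U ∈ 𝓝 (φ.symm p)) (hf : ∀ z ∈ U, ContMDiffAt (𝓡 n) (𝓡 s) ∞ f z)
    (hD : Function.Bijective (mfderiv (𝓡 n) (𝓡 s) f (φ.symm p))) :
    ∃ Φ : OpenPartialHomeomorph N (EuclideanSpace ℝ (Fin s)), φ.symm p ∈ Φ.source ∧
      Φ.source ⊆ U ∧ (∀ z ∈ Φ.source, Φ z = f z) ∧
      ContMDiffOn (𝓡 n) (𝓡 s) ∞ Φ Φ.source ∧ ContMDiffOn (𝓡 s) (𝓡 n) ∞ Φ.symm Φ.target := by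
  have hV : φ.target ∩ φ.symm ⁻¹' U ∈ 𝓝 p :=
    Filter.inter_mem (φ.open_target.mem_nhds hp) (φ.continuousAt_symm hp hU)
  have hs : ∀ z ∈ φ.target ∩ φ.symm ⁻¹' U, ContDiffAt ℝ ∞ (f ∘ φ.symm) z := fun z hz =>
    ((hf _ hz.2).comp z (hφ.contMDiffAt_symm hz.1)).contDiffAt
  have hd1 := ((hf _ (mem_of_mem_nhds hU)).mdifferentiableAt (by simp)).hasMFDerivAt
  have hd2 := ((hφ.contMDiffAt_symm hp).mdifferentiableAt (by simp)).hasMFDerivAt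
  have hd : HasFDerivAt (f ∘ φ.symm)
      ((mfderiv (𝓡 n) (𝓡 s) f (φ.symm p)).comp (dchartSymm n φ p)) p :=
    (hd1.comp p hd2).hasFDerivAt
  have hsymm : Function.Bijective (dchartSymm n φ p) :=
    ⟨Function.LeftInverse.injective (hφ.dchart_dchartSymm hp),
      Function.RightInverse.surjective (hφ.dchartSymm_dchart hp)⟩
  let D : EuclideanSpace ℝ (Fin n) →L[ℝ] EuclideanSpace ℝ (Fin s) :=
    (mfderiv (𝓡 n) (𝓡 s) f (φ.symm p)).comp (dchartSymm n φ p)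
  have hbij : Function.Bijective D := hD.comp hsymm
  let D' : EuclideanSpace ℝ (Fin n) ≃L[ℝ] EuclideanSpace ℝ (Fin s) :=
    (LinearEquiv.ofBijective (D : EuclideanSpace ℝ (Fin n) →ₗ[ℝ] EuclideanSpace ℝ (Fin s))
      hbij).toContinuousLinearEquiv
  have hD' : (D' : EuclideanSpace ℝ (Fin n) →L[ℝ] EuclideanSpace ℝ (Fin s)) = D := by
    ext v; rfl
  obtain ⟨Ψ, hpΨ, hΨ, hΨV, hΨs, hΨs'⟩ := exists_openPartialHomeomorph_of_hasFDerivAt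
    (f' := D') hV hs (by rw [hD']; exact hd)
  refine ⟨φ.trans Ψ, ⟨φ.map_target hp, ?_⟩, fun z hz => ?_, fun z hz => ?_, ?_, ?_⟩
  · change φ (φ.symm p) ∈ Ψ.source
    rw [φ.right_inv hp]; exact hpΨ
  · have h1 : φ.symm (φ z) ∈ U := (hΨV hz.2).2
    rwa [φ.left_inv hz.1] at h1
  · change Ψ (φ z) = f z
    rw [hΨ, Function.comp_apply, φ.left_inv hz.1]
  · exact hΨs.contMDiffOn.comp (hφ.smooth.mono inter_subset_left) fun z hz => hz.2
  · exact hφ.smooth_symm.comp (hΨs'.contMDiffOn.mono inter_subset_left) fun z hz => hz.2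

lemma exists_local_diffeomorph [IsManifold (𝓡 n) ∞ N] {f : N → EuclideanSpace ℝ (Fin s)} {q : N}
    {U : Set N} (hU : U ∈ 𝓝 q) (hf : ∀ z ∈ U, ContMDiffAt (𝓡 n) (𝓡 s) ∞ f z)
    (hD : Function.Bijective (mfderiv (𝓡 n) (𝓡 s) f q)) :
    ∃ Φ : OpenPartialHomeomorph N (EuclideanSpace ℝ (Fin s)), q ∈ Φ.source ∧
      Φ.source ⊆ U ∧ (∀ z ∈ Φ.source, Φ z = f z) ∧
      ContMDiffOn (𝓡 n) (𝓡 s) ∞ Φ Φ.source ∧ ContMDiffOn (𝓡 s) (𝓡 n) ∞ Φ.symm Φ.target := by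
  have hφ := isSmoothChart_chartAt (m := n) q
  obtain ⟨p, hp, hpq⟩ : ∃ p ∈ (chartAt (EuclideanSpace ℝ (Fin n)) q).target,
      (chartAt (EuclideanSpace ℝ (Fin n)) q).symm p = q :=
    ⟨_, mem_chart_target _ q, (chartAt _ q).left_inv (mem_chart_source _ q)⟩
  have key := hφ.exists_local_diffeomorph hp (f := f) (U := U)
  rw [hpq] at key
  exact key hU hf hD

namespace TubularNbhd

variable (T : TubularNbhd E r s)

/-- On the slice the characteristic distribution is given by $dw=0$, a complement of the vertical
space. This allows a fibre of one tubular neighbourhood to be treated as a transversal in another.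
-/
lemma isTransversalGerm_fibreMap {a : EuclideanSpace ℝ (Fin r)} (ha : a ∈ T.base) :
    IsTransversalGerm (n := s) E (T.fibreMap a) 0 := by
  have hφ := T.isSmoothChart
  have hp := mk_mem_target ha T.zero_mem_fibre
  have hsl := fibreMap_zero_mem_slice ha
  refine ⟨?_, ?_, ?_⟩
  · filter_upwards [T.isOpen_fibre.mem_nhds T.zero_mem_fibre] with w hw
    exact contMDiffAt_fibreMap (mk_mem_target ha hw)
  · rw [mfderiv_fibreMap hp]
    exact (Function.LeftInverse.injective (hφ.dchart_dchartSymm hp)).comp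
      (Prod.mk_right_injective (0 : EuclideanSpace ℝ (Fin r)))
  · rw [mfderiv_fibreMap hp]
    constructor
    · rw [Submodule.disjoint_def]
      rintro _ ⟨w, rfl⟩ hw
      have h1 := (T.mem_charDistribution hsl _).1 hw
      have h2 : (dchart m T.chart (T.chart.symm (a, 0))
        (dchartSymm m T.chart (a, 0) (0, w))).2 = 0 := h1
      rw [hφ.dchart_dchartSymm hp] at h2
      have h3 : w = 0 := h2
      rw [h3]
      exact map_zero _
    · rw [codisjoint_iff, eq_top_iff]
      intro v _
      let d := dchart m T.chart (T.chart.symm (a, 0)) v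
      have h1 : v = dchartSymm m T.chart (a, 0) (0, d.2) +
          dchartSymm m T.chart (a, 0) (d.1, 0) := by
        rw [← map_add, Prod.mk_add_mk, zero_add, add_zero]
        exact (hφ.dchartSymm_dchart hp v).symm
      rw [h1]
      refine Submodule.add_mem_sup ⟨d.2, rfl⟩ ((T.mem_charDistribution hsl _).2 ?_)
      change (dchart m T.chart (T.chart.symm (a, 0)) (dchartSymm m T.chart (a, 0) (d.1, 0))).2 = 0
      rw [hφ.dchart_dchartSymm hp]

end TubularNbhd

/-- A transversal is equivalent to the tubular fibre through the same point of the slice. -/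
theorem IsTransversalGerm.locEquiv_fibreMap [T2Space M] [IsManifold (𝓡 m) ∞ M]
    [IsManifold (𝓡 n) ∞ N] {f : N → M} {q : N} (hf : IsTransversalGerm (n := n) E f q)
    (T : TubularNbhd E r s) (hq : f q ∈ T.slice)
    (hE : IsBigIsotropic k E) (hint : IsIntegrable E) (hdec : IsStronglyLocallyDecomposable E) :
    LocEquiv (pullback (n := n) f E) q
      (pullback (n := s) (T.fibreMap (T.chart (f q)).1) E) 0 := by
  have hφ := T.isSmoothChart
  let U : Set N := {z | ContMDiffAt (𝓡 n) (𝓡 m) ∞ f z ∧ f z ∈ T.chart.source}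
  have hU : U ∈ 𝓝 q := Filter.Eventually.and hf.smooth
    (hf.smooth.self_of_nhds.continuousAt.eventually (T.chart.open_source.mem_nhds hq.1))
  have hφf : ∀ z ∈ U, ContMDiffAt (𝓡 n)
      𝓘(ℝ, EuclideanSpace ℝ (Fin r) × EuclideanSpace ℝ (Fin s)) ∞ (fun z => T.chart (f z)) z :=
    fun z hz => (hφ.contMDiffAt hz.2).comp z hz.1
  -- The kernel of $dw$ at a point of the slice is the characteristic space, so transversality says
  -- exactly that $w\circ f$ has bijective differential at `q`. Hence `w` parametrizes the
  -- transversal, which is the graph of `g`.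
  let θ : N → EuclideanSpace ℝ (Fin s) := fun z => (T.chart (f z)).2
  have hθ : ∀ z ∈ U, ContMDiffAt (𝓡 n) (𝓡 s) ∞ θ z := fun z hz =>
    ContMDiffAt.comp z (contDiffAt_snd (𝕜 := ℝ)).contMDiffAt (hφf z hz)
  have hD : ∀ v, mfderiv (𝓡 n) (𝓡 s) θ q v =
      (dchart m T.chart (f q) (mfderiv (𝓡 n) (𝓡 m) f q v)).2 := by
    have h1 := (hf.smooth.self_of_nhds.mdifferentiableAt (by simp)).hasMFDerivAt
    have h2 := ((hφ.contMDiffAt hq.1).mdifferentiableAt (by simp)).hasMFDerivAt.comp q h1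
    have h3 := (hasFDerivAt_snd (𝕜 := ℝ) (p := T.chart (f q))).hasMFDerivAt.comp q h2
    exact fun v => DFunLike.congr_fun h3.mfderiv v
  have hbij : Function.Bijective (mfderiv (𝓡 n) (𝓡 s) θ q) := by
    constructor
    · rw [injective_iff_map_eq_zero]
      intro v hv
      rw [hD] at hv
      refine (injective_iff_map_eq_zero _).1 hf.injective v ?_
      exact Submodule.disjoint_def.1 hf.isCompl.disjoint _ ⟨v, rfl⟩
        ((T.mem_charDistribution hq _).2 hv)
    · intro w
      have key : ∀ y ∈ T.chart.source, ∃ v : TangentSpace (𝓡 m) y,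
          dchart m T.chart y v = (0, w) := by
        intro y hy
        obtain ⟨p, hp, rfl⟩ : ∃ p ∈ T.chart.target, T.chart.symm p = y :=
          ⟨T.chart y, T.chart.map_source hy, T.chart.left_inv hy⟩
        exact ⟨_, hφ.dchart_dchartSymm hp (0, w)⟩
      obtain ⟨v, hv⟩ := key _ hq.1
      have h1 : v ∈ LinearMap.range (mfderiv (𝓡 n) (𝓡 m) f q).toLinearMap ⊔
          charDistribution E (f q) := by
        rw [hf.isCompl.sup_eq_top]; trivial
      obtain ⟨_, ⟨u, rfl⟩, v', hv', huv⟩ := Submodule.mem_sup.1 h1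
      refine ⟨u, ?_⟩
      have h2 := (T.mem_charDistribution hq _).1 hv'
      have h3 : (dchart m T.chart (f q) (mfderiv (𝓡 n) (𝓡 m) f q u + v')).2 =
          (dchart m T.chart (f q) v).2 := congrArg (fun x => (dchart m T.chart (f q) x).2) huv
      rw [hD]
      rw [map_add, Prod.snd_add, h2, add_zero, hv] at h3
      exact h3
  obtain ⟨Φ, hqΦ, hΦU, hΦθ, hs, hs'⟩ := exists_local_diffeomorph hU hθ hbij
  have hΦq : Φ q = 0 := (hΦθ q hqΦ).trans hq.2
  let g : EuclideanSpace ℝ (Fin s) → EuclideanSpace ℝ (Fin r) := fun w => (T.chart (f (Φ.symm w))).1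
  have hgs : ∀ w ∈ Φ.target, ContDiffAt ℝ ∞ g w := by
    intro w hw
    have h1 := (hφf _ (hΦU (Φ.map_target hw))).comp w (hs'.contMDiffAt (Φ.open_target.mem_nhds hw))
    exact (ContMDiffAt.comp w (contDiffAt_fst (𝕜 := ℝ)).contMDiffAt h1).contDiffAt
  have hgw : ∀ w ∈ Φ.target, (g w, w) = T.chart (f (Φ.symm w)) := by
    intro w hw
    refine Prod.ext rfl ?_
    change w = θ (Φ.symm w)
    rw [← hΦθ _ (Φ.map_target hw), Φ.right_inv hw]
  have h0 : (0 : EuclideanSpace ℝ (Fin s)) ∈ Φ.target := hΦq ▸ Φ.map_source hqΦ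
  have hg0 : g 0 = (T.chart (f q)).1 := by
    change (T.chart (f (Φ.symm 0))).1 = _
    rw [← hΦq, Φ.left_inv hqΦ]
  have hbase : g 0 ∈ T.base := by
    have := T.chart.map_source hq.1
    rw [T.target_eq] at this
    rw [hg0]; exact this.1
  have h1 := T.locEquiv_graph hE hint hdec
    (Filter.eventually_of_mem (Φ.open_target.mem_nhds h0) hgs) hbase
  rw [hg0] at h1
  have h2 := locEquiv_of_comp (E := E) (f := f) (g := fun w => T.chart.symm (g w, w))
    Φ hqΦ hs hs' ?_ ?_
  · rw [hΦq] at h2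
    exact h2.trans h1
  · intro z hz
    have hw := Φ.map_source hz
    have ht : (g (Φ z), Φ z) ∈ T.chart.target := by
      rw [hgw _ hw]
      exact T.chart.map_source (hΦU (Φ.map_target hw)).2
    have h3 : ContMDiffAt (𝓡 s) 𝓘(ℝ, EuclideanSpace ℝ (Fin r) × EuclideanSpace ℝ (Fin s)) ∞
        (fun w => (g w, w)) (Φ z) := ((hgs _ hw).prodMk contDiffAt_id).contMDiffAt
    exact (ContMDiffAt.comp (g := T.chart.symm) (f := fun w => (g w, w)) (Φ z)
      (hφ.contMDiffAt_symm ht) h3).mdifferentiableAt (by simp)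
  · intro z hz
    rw [hgw _ (Φ.map_source hz), Φ.left_inv hz, T.chart.left_inv (hΦU hz).2]

end Transversals

/-! ### Propagation along a characteristic leaf. -/

section CharacteristicLeaf

open Set

variable {m n : ℕ} {M : Type*} [TopologicalSpace M] [ChartedSpace (EuclideanSpace ℝ (Fin m)) M]
  [IsManifold (𝓡 m) ∞ M]
  {E : ∀ x : M, Submodule ℝ (BigTangent m x)} {r s k : ℕ}

/-- An integral curve that meets a characteristic slice remains in it for a while. -/
lemma TubularNbhd.eventually_mem_slice (T : TubularNbhd E r s) {e : ∀ x : M, BigTangent m x}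
    (he : IsSection E e) {γ : ℝ → M}
    (hγ : IsMIntegralCurveOn (I := 𝓡 m) γ (fun z => (e z).1) (Icc 0 1)) {t₀ : ℝ}
    (ht₀ : t₀ ∈ Icc (0 : ℝ) 1) (h : γ t₀ ∈ T.slice) :
    ∀ᶠ t in 𝓝[Icc 0 1] t₀, γ t ∈ T.slice := by
  have hφ := T.isSmoothChart
  let X := coordVec T.chart fun y => (e y).1
  have hp := T.chart.map_source h.1
  have hX : ContDiffAt ℝ ∞ X (T.chart (γ t₀)) :=
    hφ.contDiffAt_coordVec hp (he.1.1.contMDiffAt Filter.univ_mem)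
  obtain ⟨K, Ω, hΩ, hK⟩ := (hX.of_le (by simp : (1 : WithTop ℕ∞) ≤ ∞)).exists_lipschitzOnWith
  obtain ⟨U₁, hU₁, U₂, hU₂, hUΩ⟩ := mem_nhds_prod_iff.1
    (Filter.inter_mem hΩ (T.chart.open_target.mem_nhds hp))
  have hU₂0 : (0 : EuclideanSpace ℝ (Fin s)) ∈ U₂ := by
    rw [← h.2]; exact mem_of_mem_nhds hU₂
  -- The vector field takes values in the characteristic distribution, hence is tangent to the slice
  -- along it.
  have hslice : ∀ x ∈ U₁, (X (x, 0)).2 = 0 := by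
    intro x hx
    have hxt : (x, (0 : EuclideanSpace ℝ (Fin s))) ∈ T.chart.target := (hUΩ ⟨hx, hU₂0⟩).2
    have hsl : T.chart.symm (x, 0) ∈ T.slice :=
      ⟨T.chart.map_target hxt, by rw [T.chart.right_inv hxt]⟩
    exact (T.mem_charDistribution hsl _).1 ⟨_, he.2 _, rfl⟩
  have hev : ∀ᶠ t in 𝓝[Icc 0 1] t₀, γ t ∈ T.chart.source ∧ T.chart (γ t) ∈ U₁ ×ˢ U₂ := by
    have hc : ContinuousWithinAt γ (Icc 0 1) t₀ := (hγ t₀ ht₀).continuousWithinAt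
    have hc' : ContinuousWithinAt (fun t => T.chart (γ t)) (Icc 0 1) t₀ :=
      (T.chart.continuousAt h.1).comp_continuousWithinAt hc
    exact (hc.eventually (T.chart.open_source.mem_nhds h.1)).and
      (hc'.eventually (prod_mem_nhds hU₁ hU₂))
  obtain ⟨δ, hδ, hball⟩ := Metric.mem_nhdsWithin_iff.1 hev
  have hder : ∀ t ∈ Icc (0 : ℝ) 1, γ t ∈ T.chart.source → HasDerivWithinAt
      (fun t => (T.chart (γ t)).2) (X (T.chart (γ t))).2 (Icc 0 1) t := by
    intro t ht hts
    have h1 := ((hφ.contMDiffAt hts).mdifferentiableAt (by simp)).hasMFDerivAt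
    have h2 : HasFDerivWithinAt (fun t => T.chart (γ t))
        ((dchart m T.chart (γ t)).comp ((1 : ℝ →L[ℝ] ℝ).smulRight (e (γ t)).1) :
          ℝ →L[ℝ] EuclideanSpace ℝ (Fin r) × EuclideanSpace ℝ (Fin s)) (Icc 0 1) t :=
      (h1.comp_hasMFDerivWithinAt t (hγ t ht)).hasFDerivWithinAt
    have h3 : HasDerivWithinAt (fun t => T.chart (γ t)) (X (T.chart (γ t))) (Icc 0 1) t := by
      refine h2.hasDerivWithinAt.congr_deriv ?_
      change dchart m T.chart (γ t) ((1 : ℝ) • (e (γ t)).1) =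
        dchart m T.chart (T.chart.symm (T.chart (γ t))) (e (T.chart.symm (T.chart (γ t)))).1
      rw [T.chart.left_inv hts, one_smul]
    exact (hasFDerivAt_snd (𝕜 := ℝ) (p := T.chart (γ t))).comp_hasDerivWithinAt t h3
  -- With the base curve $x(t)$ regarded as given, $w$ satisfies a time-dependent equation,
  -- Lipschitz in $w$, that has the zero solution. Uniqueness forwards and backwards from $t_0$
  -- keeps the curve in the slice.
  have hL : ∀ t, (T.chart (γ t)).1 ∈ U₁ →
      LipschitzOnWith K (fun w => (X ((T.chart (γ t)).1, w)).2) U₂ := by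
    intro t ht
    refine LipschitzOnWith.of_dist_le_mul fun w hw w' hw' => ?_
    have h1 := hK.dist_le_mul ((T.chart (γ t)).1, w) (hUΩ (mk_mem_prod ht hw)).1
      ((T.chart (γ t)).1, w') (hUΩ (mk_mem_prod ht hw')).1
    rw [dist_prod_same_left] at h1
    exact (le_max_right _ _).trans h1
  filter_upwards [hev, Filter.inter_mem self_mem_nhdsWithin
    (mem_nhdsWithin_of_mem_nhds (Metric.ball_mem_nhds t₀ hδ))] with t htev ht
  refine ⟨htev.1, ?_⟩
  have hin : ∀ τ ∈ uIcc t₀ t, τ ∈ Icc (0 : ℝ) 1 ∧ γ τ ∈ T.chart.source ∧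
      T.chart (γ τ) ∈ U₁ ×ˢ U₂ := by
    intro τ hτ
    have h1 : τ ∈ Icc (0 : ℝ) 1 := ordConnected_Icc.uIcc_subset ht₀ ht.1 hτ
    have h2 : τ ∈ Metric.ball t₀ δ := by
      rw [Real.ball_eq_Ioo] at ht ⊢
      have ht₀' : t₀ ∈ Ioo (t₀ - δ) (t₀ + δ) := ⟨by linarith, by linarith⟩
      exact ordConnected_Ioo.uIcc_subset ht₀' ht.2 hτ
    exact ⟨h1, hball ⟨h2, h1⟩⟩
  have hfc : ContinuousOn (fun t => (T.chart (γ t)).2) (uIcc t₀ t) := fun τ hτ =>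
    ((hder τ (hin τ hτ).1 (hin τ hτ).2.1).continuousWithinAt).mono fun σ hσ => (hin σ hσ).1
  rcases le_total t₀ t with hle | hle
  · rw [uIcc_of_le hle] at hin hfc
    refine ODE_solution_unique_of_mem_Icc_right (K := K) (s := fun _ => U₂)
      (v := fun τ w => (X ((T.chart (γ τ)).1, w)).2) (g := fun _ => 0)
      (fun τ hτ => hL τ (hin τ (Ico_subset_Icc_self hτ)).2.2.1) hfc (fun τ hτ => ?_)
      (fun τ hτ => (hin τ (Ico_subset_Icc_self hτ)).2.2.2) continuousOn_const (fun τ hτ => ?_)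
      (fun _ _ => hU₂0) h.2 (right_mem_Icc.2 hle)
    · have h1 := hin τ (Ico_subset_Icc_self hτ)
      exact (hder τ h1.1 h1.2.1).mono_of_mem_nhdsWithin
        (Icc_mem_nhdsGE_of_mem ⟨h1.1.1, hτ.2.trans_le ht.1.2⟩)
    · change HasDerivWithinAt _ (X ((T.chart (γ τ)).1, 0)).2 _ _
      rw [hslice _ (hin τ (Ico_subset_Icc_self hτ)).2.2.1]
      exact hasDerivWithinAt_const _ _ _
  · rw [uIcc_of_ge hle] at hin hfc
    refine ODE_solution_unique_of_mem_Icc_left (K := K) (s := fun _ => U₂)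
      (v := fun τ w => (X ((T.chart (γ τ)).1, w)).2) (g := fun _ => 0)
      (fun τ hτ => hL τ (hin τ (Ioc_subset_Icc_self hτ)).2.2.1) hfc (fun τ hτ => ?_)
      (fun τ hτ => (hin τ (Ioc_subset_Icc_self hτ)).2.2.2) continuousOn_const (fun τ hτ => ?_)
      (fun _ _ => hU₂0) h.2 (left_mem_Icc.2 hle)
    · have h1 := hin τ (Ioc_subset_Icc_self hτ)
      exact (hder τ h1.1 h1.2.1).mono_of_mem_nhdsWithin
        (Icc_mem_nhdsLE_of_mem ⟨ht.1.1.trans_lt hτ.1, h1.1.2⟩)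
    · change HasDerivWithinAt _ (X ((T.chart (γ τ)).1, 0)).2 _ _
      rw [hslice _ (hin τ (Ioc_subset_Icc_self hτ)).2.2.1]
      exact hasDerivWithinAt_const _ _ _

/-- The tubular fibres through the points `x` and `y` are equivalent. -/
def EquivalentFibres (E : ∀ x : M, Submodule ℝ (BigTangent m x)) (x y : M) : Prop :=
  ∀ (r s : ℕ) (T : TubularNbhd E r s) (r' s' : ℕ) (T' : TubularNbhd E r' s'), x ∈ T.slice →
    y ∈ T'.slice → LocEquiv (pullback (n := s) (T.fibreMap (T.chart x).1) E) 0
      (pullback (n := s') (T'.fibreMap (T'.chart y).1) E) 0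

omit [IsManifold (𝓡 m) ∞ M] in
lemma EquivalentFibres.symm {x y : M} (h : EquivalentFibres E x y) : EquivalentFibres E y x :=
  fun r s T r' s' T' hy hx => (h r' s' T' r s T hx hy).symm

omit [IsManifold (𝓡 m) ∞ M] in
-- The relation quantifies over tubular neighbourhoods, so composing it requires one whose slice
-- contains the middle point; local decomposability supplies it.
lemma EquivalentFibres.trans (hdec : IsLocallyDecomposable E) {x y z : M}
    (h : EquivalentFibres E x y) (h' : EquivalentFibres E y z) : EquivalentFibres E x z := by
  intro r s T r' s' T' hx hz
  obtain ⟨r₁, s₁, T₁, hy, -⟩ := hdec y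
  exact (h r s T r₁ s₁ T₁ hx hy).trans (h' r₁ s₁ T₁ r' s' T' hy hz)

variable [T2Space M]

/-- The fibres of arbitrary neighbourhoods through `x` and `y` are transversals, hence equivalent to
the fibres of `T` through these points, and the latter are equivalent to each other. -/
lemma TubularNbhd.equivalentFibres (T : TubularNbhd E r s) (hE : IsBigIsotropic k E)
    (hint : IsIntegrable E) (hdec : IsStronglyLocallyDecomposable E) {x y : M} (hx : x ∈ T.slice)
    (hy : y ∈ T.slice) : EquivalentFibres E x y := by
  have hbase : ∀ {r s : ℕ} (T : TubularNbhd E r s) {z : M}, z ∈ T.slice →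
      (T.chart z).1 ∈ T.base := by
    intro r s T z hz
    have := T.chart.map_source hz.1
    rw [T.target_eq] at this
    exact this.1
  have key : ∀ {r' s' : ℕ} (T' : TubularNbhd E r' s') {z : M}, z ∈ T.slice → z ∈ T'.slice →
      LocEquiv (pullback (n := s') (T'.fibreMap (T'.chart z).1) E) 0
        (pullback (n := s) (T.fibreMap (T.chart z).1) E) 0 := by
    intro r' s' T' z hz hz'
    have hz0 : T'.fibreMap (T'.chart z).1 0 = z := by
      rw [TubularNbhd.fibreMap, ← hz'.2]
      exact T'.chart.left_inv hz'.1
    have h := (T'.isTransversalGerm_fibreMap (hbase T' hz')).locEquiv_fibreMap T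
      (by rw [hz0]; exact hz) hE hint hdec
    rwa [hz0] at h
  intro r₀ s₀ T₀ r₁ s₁ T₁ hx₀ hy₁
  exact (key T₀ hx hx₀).trans ((TubularNbhd.locEquiv_fibreMap hE hint (hdec.2 _ _ T) (hbase T hx)
    (hbase T hy)).trans (key T₁ hy hy₁).symm)

/-- Along one integral curve the relation holds for nearby parameters, as the curve stays locally in
a slice. Connectedness of $[0,1]$ joins the endpoints, and induction treats the chain of curves. -/
lemma equivalentFibres_of_sameCharLeaf (hE : IsBigIsotropic k E) (hint : IsIntegrable E)
    (hdec : IsStronglyLocallyDecomposable E) {x y : M} (h : SameCharLeaf E x y) :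
    EquivalentFibres E x y := by
  have hstep : ∀ x y : M, FlowStep E x y → EquivalentFibres E x y := by
    rintro x y ⟨e, he, γ, hγ, rfl, rfl⟩
    refine (isPreconnected_Icc (a := (0 : ℝ)) (b := 1)).induction₂
      (fun t t' => EquivalentFibres E (γ t) (γ t')) (fun t ht => ?_)
      (fun _ _ _ _ _ _ h h' => h.trans hdec.1 h') (fun _ _ _ _ h => h.symm)
      (left_mem_Icc.2 zero_le_one) (right_mem_Icc.2 zero_le_one)
    obtain ⟨r, s, T, hT, -⟩ := hdec.1 (γ t)
    filter_upwards [T.eventually_mem_slice he hγ ht hT] with t' ht'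
    exact T.equivalentFibres hE hint hdec hT ht'
  induction h with
  | refl =>
    obtain ⟨r, s, T, hT, -⟩ := hdec.1 x
    exact T.equivalentFibres hE hint hdec hT hT
  | tail _ h ih => exact ih.trans hdec.1 (hstep _ _ h)

end CharacteristicLeaf

end BigIso

end

theorem proposition4p3 {m k n : ℕ}
    {M : Type*} [TopologicalSpace M] [T2Space M] [SecondCountableTopology M]
    [ChartedSpace (EuclideanSpace ℝ (Fin m)) M] [IsManifold (𝓡 m) ∞ M]
    (E : ∀ x : M, Submodule ℝ (BigIso.BigTangent m x))
    (hE : BigIso.IsBigIsotropic k E) (hint : BigIso.IsIntegrable E)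
    (hdec : BigIso.IsStronglyLocallyDecomposable E)
    {N₀ : Type*} [TopologicalSpace N₀] [ChartedSpace (EuclideanSpace ℝ (Fin n)) N₀]
    [IsManifold (𝓡 n) ∞ N₀]
    {N₁ : Type*} [TopologicalSpace N₁] [ChartedSpace (EuclideanSpace ℝ (Fin n)) N₁]
    [IsManifold (𝓡 n) ∞ N₁]
    (ι₀ : N₀ → M) (q₀ : N₀) (h₀ : BigIso.IsLocalTransversal (m := m) (n := n) E ι₀ q₀)
    (ι₁ : N₁ → M) (q₁ : N₁) (h₁ : BigIso.IsLocalTransversal (m := m) (n := n) E ι₁ q₁)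
    (hleaf : BigIso.SameCharLeaf E (ι₀ q₀) (ι₁ q₁)) :
    ∃ Φ : OpenPartialHomeomorph N₀ N₁,
      q₀ ∈ Φ.source ∧ Φ q₀ = q₁ ∧
      ContMDiffOn (𝓡 n) (𝓡 n) ∞ Φ Φ.source ∧
      ContMDiffOn (𝓡 n) (𝓡 n) ∞ Φ.symm Φ.target ∧
      ∀ q ∈ Φ.source,
        BigIso.pullback (m := n) (n := n) Φ
            (BigIso.transversalStructure (m := m) (n := n) E ι₁) q
          = BigIso.transversalStructure (m := m) (n := n) E ι₀ q := by
  obtain ⟨r₀, s₀, T₀, hT₀, -⟩ := hdec.1 (ι₀ q₀)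
  obtain ⟨r₁, s₁, T₁, hT₁, -⟩ := hdec.1 (ι₁ q₁)
  have h := (h₀.isTransversalGerm.locEquiv_fibreMap T₀ hT₀ hE hint hdec).trans
    ((BigIso.equivalentFibres_of_sameCharLeaf hE hint hdec hleaf r₀ s₀ T₀ r₁ s₁ T₁ hT₀ hT₁).trans
      (h₁.isTransversalGerm.locEquiv_fibreMap T₁ hT₁ hE hint hdec).symm)
  exact h
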